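/- Let $\alpha\in\mathbb R$, $\sigma>0$, and let $b(x)=x^{\alpha}\ell(x)$ for $x>0$, where $\ell$ is slowly varying at $+\infty$: $\ell$ is a real-valued measurable function on $(0,\infty)$ that is eventually positive and satisfies $\ell(\lambda x)/\ell(x)\to1$ as $x\to+\infty$ for every $\lambda>0$. Let $\xi_0,\xi_1,\xi_2,\dots$ be independent isotropic complex Gaussian variables with variance parameter $\sigma^2$, meaning that $\operatorname{Re}\xi_k$ and $\operatorname{Im}\xi_k$ are independent $N(0,\sigma^2)$ variables. For $m\in\mathbb N$ let $\nu_m$ be the number of zeros (with multiplicity) on the unit circle $\{|z|=1\}$ of the self-inversive polynomial $$K_m(z)=1+\sum_{k=1}^m b(k)\xi_kz^k+\sum_{k=1}^m b(k)\overline{\xi_k}\,z^{2m+1-k}+z^{2m+1}.$$ Put $g_1(m)=\sigma^2\sum_{k=1}^m b^2(k)$ and $S(\gamma)=\sum_{k\ge1}k^{\gamma}\ell^2(k)$, and write $f(m)\sim g(m)$ if $f(m)/g(m)\to1$ as $m\to\infty$. Then $\nu_m$ is integrable for every $m$, and the following hold. (i) If $\alpha=-\tfrac12$, then $$1-\mathbb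 E\Big[\frac{\nu_m}{2m+1}\Big]\sim\frac{3e^{-1/(2g_1(m))}}{4}\,\frac{\ell^2(m)}{\sum_{k=1}^m k^{-1}\ell^2(k)}.$$ (ii) If $-1<\alpha<-\tfrac12$, then $S(2\alpha)<\infty$ and $$1-\mathbb E\Big[\frac{\nu_m}{2m+1}\Big]\sim\frac{e^{-1/(2\sigma^2S(2\alpha))}(2+\alpha)}{2(1+\alpha)(3+2\alpha)S(2\alpha)}\,m^{1+2\alpha}\ell^2(m).$$ (iii) If $\alpha\le-1$, then $S(2\alpha)<\infty$ and $$1-\mathbb E\Big[\frac{\nu_m}{2m+1}\Big]\sim\frac{e^{-1/(2\sigma^2S(2\alpha))}}{S(2\alpha)}\,\frac{\sum_{k=1}^m k^{1+2\alpha}\ell^2(k)}{m}.$$ -/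

import Mathlib

open MeasureTheory ProbabilityTheory Filter Topology Polynomial

noncomputable section

/-- A function `ℓ` on `(0, ∞)` is slowly varying at `+∞`: it is (Lebesgue) measurable,
eventually positive, and `ℓ (c x) / ℓ x → 1` as `x → +∞` for every `c > 0`.
The values of `ℓ` on `(-∞, 0]` are irrelevant. -/
structure IsSlowlyVarying (ℓ : ℝ → ℝ) : Prop where
  aemeasurable : AEMeasurable ℓ (volume.restrict (Set.Ioi 0))
  eventually_pos : ∀ᶠ x in atTop, 0 < ℓ x
  tendsto_ratio : ∀ c : ℝ, 0 < c → Tendsto (fun x => ℓ (c * x) / ℓ x) atTop (𝓝 1)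

/-- The isotropic complex Gaussian law with variance parameter `σ²`: the real and imaginary
parts are independent real centred Gaussian variables, each with variance `σ²`. -/
def isotropicGaussian (σ : ℝ) : Measure ℂ :=
  ((gaussianReal 0 (σ ^ 2).toNNReal).prod (gaussianReal 0 (σ ^ 2).toNNReal)).map
    (fun p : ℝ × ℝ => (⟨p.1, p.2⟩ : ℂ))

/-- The self-inversive polynomial
`K_m(z) = 1 + ∑_{k=1}^m b(k) x_k z^k + ∑_{k=1}^m b(k) conj(x_k) z^(2m+1-k) + z^(2m+1)`. -/
def selfInversivePoly (b : ℝ → ℝ) (x : ℕ → ℂ) (m : ℕ) : ℂ[X] :=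
  1 + ∑ k ∈ Finset.Icc 1 m, C ((b k : ℂ) * x k) * X ^ k
    + ∑ k ∈ Finset.Icc 1 m, C ((b k : ℂ) * starRingEnd ℂ (x k)) * X ^ (2 * m + 1 - k)
    + X ^ (2 * m + 1)

/-- The number of zeros of `K_m` on the unit circle, counted with multiplicity. -/
def numUnitCircleZeros (b : ℝ → ℝ) (x : ℕ → ℂ) (m : ℕ) : ℕ :=
  ((selfInversivePoly b x m).roots.filter (fun z => ‖z‖ = 1)).card

/-- `g₁(m) = σ² ∑_{k=1}^m b(k)²`. -/
def gOne (b : ℝ → ℝ) (σ : ℝ) (m : ℕ) : ℝ :=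
  σ ^ 2 * ∑ k ∈ Finset.Icc 1 m, b k ^ 2

/-- The `k`-th term, with `k ≥ 1` written as `k = j + 1`, of `S(γ; ℓ)`. -/
def sTerm (ℓ : ℝ → ℝ) (γ : ℝ) (j : ℕ) : ℝ :=
  ((j : ℝ) + 1) ^ γ * ℓ ((j : ℝ) + 1) ^ 2

/-- `S(γ; ℓ) = ∑_{k ≥ 1} k^γ ℓ(k)²`, used only where the series converges. -/
def sSum (ℓ : ℝ → ℝ) (γ : ℝ) : ℝ := ∑' j : ℕ, sTerm ℓ γ j

/-- The asymptotic equivalence `f(m) ∼ g(m)` as `m → ∞`, that is `f(m) / g(m) → 1`. -/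
def AsympEquiv (f g : ℕ → ℝ) : Prop := Tendsto (fun m => f m / g m) atTop (𝓝 1)

end

/-! The proof rests on an exact formula for `E ν_m` and on Karamata's theorem. Put `n = 2m + 1`.

**A formula for the mean.** On the unit circle `K_m(e^{iθ}) = P(θ) + e^{inθ} conj (P(θ))`, where
`P(θ) = 1 + ∑_{k ≤ m} b(k) ξ_k e^{ikθ}` (`trigSum`). Almost surely `P` has no zero
(`ae_trigSum_ne_zero`), so the zeros of `K_m` on the circle are the points where the unimodular
function `-e^{inθ} conj P / P = e^{iψ(θ)}` equals `1`. Its phase has derivative `ψ' = n Re (R / P)`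
(`hasDerivAt_phase`), where `R` arises from `P` by multiplying `b(k)` by `1 - 2k / n`
(`tiltedCoeff`). Replacing `ξ_k` by `e^{iku/n} ξ_k` preserves the law of the coefficients and turns
the zeros into the points with `e^{iψ} = e^{iu}`. For almost every `u` these are simple zeros, and
the area formula `lintegral_count_exp_eq` gives their average over `u` as `(2π)⁻¹ ∫ |ψ'|`
(`lintegral_numUnitCircleZeros_rotateSeq`). As the law of `(P(θ), R(θ))` does not depend on `θ`,
`E ν_m = n E |Re (R / P)|` at `θ = 0` (`lintegral_numUnitCircleZeros`).

**Two-sided bounds.** Let `v ≥ w` be `σ²` times the sums of squares of the real coefficients of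
the `ξ_k` in `P` and `R`. Splitting `R - 1` into a multiple of `P - 1` and an independent
part, and passing to polar coordinates with a signed radius, one obtains
`2 E |Re (R / P)| = ∫_{-π}^{π} (2πv)^{-1/2} e^{-sin² t / (2v)} E |cos t + √w Z| dt`, `Z` standard
Gaussian (`two_mul_lintegral_abs_re_trigSum_div`). For `w = v` the left side is `2`, as one may take
`R = P`. The map `a ↦ E |s + a Z|` is convex with derivative `2 φ(s / a)`, so comparing it with its
tangents at `√v` and `√w` yields
`(1 - √(w/v)) e^{-1/(2w)} ≤ 1 - E ν_m / n ≤ (1 - √(w/v)) e^{-1/(2v)}`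
(`one_sub_integral_numUnitCircleZeros_bounds`).

**Asymptotics.** It follows that `1 - E ν_m / n ∼ e^{-1/(2v)} (v - w) / (2v)` as soon as
`w / v → 1`, and `(v - w) / (2σ²) = 2 A₁ / n - 2 A₂ / n²` with `A_j = ∑_{k ≤ m} k^{2α + j} ℓ(k)²`.
For `α > -1` both sums are given by Karamata's theorem (`IsSlowlyVarying.tendsto_sum_div`), and for
`α ≤ -1` the second is negligible (`tendsto_powSum_div_mul_powSum`). At `α = -1/2` the variance `v`
diverges or not, but `ℓ(m)² = o(v)` in any case (`IsSlowlyVarying.tendsto_div_sum_inv`), while for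
`α < -1/2` it converges and can be replaced by its limit. The two facts on slowly varying sums are
derived from uniform convergence (`IsSlowlyVarying.eventually_forall_ratio`) by comparing `m` with
`m / 2`. -/

/-! ### Slowly varying functions -/

lemma IsSlowlyVarying.sq {ℓ : ℝ → ℝ} (h : IsSlowlyVarying ℓ) :
    IsSlowlyVarying (fun x => ℓ x ^ 2) where
  aemeasurable := h.aemeasurable.pow_const 2
  eventually_pos := h.eventually_pos.mono fun x hx => by positivity
  tendsto_ratio c hc := by
    have := (h.tendsto_ratio c hc).pow 2
    simpa [div_pow] using this

lemma IsSlowlyVarying.nullMeasurableSet_ratio {L : ℝ → ℝ} (hL : IsSlowlyVarying L) {x : ℝ}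
    (hx : 0 < x) (δ : ℝ) :
    NullMeasurableSet {u : ℝ | |L (u * x) / L x - 1| < δ} (volume.restrict (Set.Ioi 0)) := by
  have hq : Measure.QuasiMeasurePreserving (fun u : ℝ => u * x)
      (volume.restrict (Set.Ioi 0)) (volume.restrict (Set.Ioi 0)) := by
    refine Measure.QuasiMeasurePreserving.restrict ?_ ?_
    · refine ⟨by fun_prop, ?_⟩
      rw [Real.map_volume_mul_right hx.ne']
      exact Measure.smul_absolutelyContinuous
    · intro u hu
      exact mul_pos hu hx
  have h1 : AEMeasurable (fun u : ℝ => |L (u * x) / L x - 1|) (volume.restrict (Set.Ioi 0)) := by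
    have := hL.aemeasurable.comp_quasiMeasurePreserving hq
    exact continuous_abs.measurable.comp_aemeasurable ((this.div_const _).sub_const 1)
  exact nullMeasurableSet_lt h1 aemeasurable_const

/-- The points of `[1, B]` at which `L (u x k) / L (x k)` is `δ`-close to `1` for all `k ≥ N`
exhaust `[1, B]` in measure as `N → ∞`. -/
lemma IsSlowlyVarying.exists_large_set {L : ℝ → ℝ} (hL : IsSlowlyVarying L) {x : ℕ → ℝ}
    (hx : Tendsto x atTop atTop) {B δ η : ℝ} (hB : 1 < B) (hδ : 0 < δ) (hη : 0 < η) :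
    ∀ᶠ N in atTop, ENNReal.ofReal (B - 1 - η) < volume.restrict (Set.Ioi 0)
      {u : ℝ | u ∈ Set.Icc 1 B ∧ ∀ k ≥ N, |L (u * x k) / L (x k) - 1| < δ} := by
  have hmono : Monotone fun N : ℕ =>
      {u : ℝ | u ∈ Set.Icc 1 B ∧ ∀ k ≥ N, |L (u * x k) / L (x k) - 1| < δ} := by
    intro N M hNM u hu
    exact ⟨hu.1, fun k hk => hu.2 k (hNM.trans hk)⟩
  have hU : (⋃ N : ℕ, {u : ℝ | u ∈ Set.Icc 1 B ∧ ∀ k ≥ N, |L (u * x k) / L (x k) - 1| < δ})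
      = Set.Icc 1 B := by
    ext u
    simp only [Set.mem_iUnion, Set.mem_ofPred_eq]
    refine ⟨fun ⟨_, h⟩ => h.1, fun h => ?_⟩
    have := (hL.tendsto_ratio u (by linarith [h.1])).comp hx
    obtain ⟨N, hN⟩ := (Metric.tendsto_atTop.1 this) δ hδ
    exact ⟨N, h, fun k hk => by simpa [Real.dist_eq] using hN k hk⟩
  have ht := tendsto_measure_iUnion_atTop (μ := volume.restrict (Set.Ioi (0 : ℝ))) hmono
  have hsub : Set.Icc 1 B ⊆ Set.Ioi 0 := fun u hu => lt_of_lt_of_le one_pos hu.1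
  rw [hU, Measure.restrict_eq_self _ hsub, Real.volume_Icc] at ht
  refine ht.eventually_const_lt ?_
  rw [ENNReal.ofReal_lt_ofReal_iff (by linarith)]
  linarith

open scoped Pointwise in
/-- **Uniform convergence theorem.** For a slowly varying function `L (c x) / L x → 1` uniformly for
`c` in a compact interval. If it failed along `x k` with multipliers `c k`, then for one large `k`
two subsets of an interval, both of almost full measure, would have to be disjoint: the `u` with
`L (u x) ≈ L x`, and `c` times the `v` with `L (v c x) ≈ L (c x)`. -/
theorem IsSlowlyVarying.eventually_forall_ratio {L : ℝ → ℝ} (hL : IsSlowlyVarying L) {A ε : ℝ}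
    (hA : 1 ≤ A) (hε : 0 < ε) :
    ∀ᶠ x in atTop, ∀ c ∈ Set.Icc 1 A, |L (c * x) / L x - 1| < ε := by
  by_contra hcon
  rw [not_eventually] at hcon
  obtain ⟨x, hxt, hx⟩ := exists_seq_forall_of_frequently
    (hcon.and_eventually (eventually_gt_atTop 0))
  have hx0 : ∀ k, 0 < x k := fun k => (hx k).2
  have hx' : ∀ k, ∃ c ∈ Set.Icc 1 A, ε ≤ |L (c * x k) / L (x k) - 1| := by
    intro k
    have := (hx k).1
    push Not at this
    exact this
  choose c hc hcε using hx'
  have hc0 : ∀ k, 0 < c k := fun k => lt_of_lt_of_le one_pos (hc k).1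
  have hyt : Tendsto (fun k => c k * x k) atTop atTop := by
    refine tendsto_atTop_mono (fun k => ?_) hxt
    nlinarith [(hc k).1, hx0 k]
  set δ : ℝ := min (1 / 2) (ε / 4) with hδdef
  have hδ : 0 < δ := by positivity
  have hδ1 : δ ≤ 1 / 2 := min_le_left _ _
  have hδ2 : δ ≤ ε / 4 := min_le_right _ _
  set η : ℝ := 1 / (1 + A) with hηdef
  have hη : 0 < η := by positivity
  have hη1 : η * (1 + A) = 1 := by rw [hηdef]; field_simp
  set B : ℝ := A + 3
  obtain ⟨N, hN1, hN2⟩ := ((hL.exists_large_set hxt (B := B) (by simp [B]; linarith) hδ hη).and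
    (hL.exists_large_set hyt (B := B) (by simp [B]; linarith) hδ hη)).exists
  set U := {u : ℝ | u ∈ Set.Icc 1 B ∧ ∀ k ≥ N, |L (u * x k) / L (x k) - 1| < δ}
  set V := {u : ℝ | u ∈ Set.Icc 1 B ∧ ∀ k ≥ N, |L (u * (c k * x k)) / L (c k * x k) - 1| < δ}
  have hUm : NullMeasurableSet U (volume.restrict (Set.Ioi 0)) := by
    have : U = Set.Icc 1 B ∩ ⋂ k : ℕ, ⋂ _ : k ≥ N, {u : ℝ | |L (u * x k) / L (x k) - 1| < δ} := by
      ext u; simp [U]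
    rw [this]
    exact measurableSet_Icc.nullMeasurableSet.inter
      (.iInter fun k => .iInter fun _ => hL.nullMeasurableSet_ratio (hx0 k) δ)
  have hVpos : V ⊆ Set.Ioi 0 := fun v hv => lt_of_lt_of_le one_pos hv.1.1
  have hcV : volume.restrict (Set.Ioi 0) (c N • V)
      = ENNReal.ofReal (c N) * volume.restrict (Set.Ioi 0) V := by
    rw [Measure.restrict_eq_self _ hVpos, Measure.restrict_eq_self, Measure.addHaar_smul]
    · simp [abs_of_pos (hc0 N)]
    · rintro _ ⟨v, hv, rfl⟩
      exact mul_pos (hc0 N) (hVpos hv)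
  have hne : ¬ Disjoint U (c N • V) := by
    intro hd
    have h1 := measure_union₀' hUm hd.aedisjoint
    have hsub : U ∪ c N • V ⊆ Set.Icc 1 (c N * B) := by
      have hc1 := (hc N).1
      have hB0 : 0 < B := by simp only [B]; linarith
      rintro w (hw | ⟨v, hv, rfl⟩)
      · exact ⟨hw.1.1, hw.1.2.trans (by nlinarith)⟩
      · refine ⟨?_, mul_le_mul_of_nonneg_left hv.1.2 (hc0 N).le⟩
        have := hv.1.1
        simp only [smul_eq_mul]
        nlinarith
    have h2 : volume.restrict (Set.Ioi 0) (U ∪ c N • V) ≤ ENNReal.ofReal (c N * B - 1) := by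
      calc _ ≤ volume (U ∪ c N • V) := Measure.restrict_apply_le _ _
        _ ≤ _ := measure_mono hsub
        _ = _ := Real.volume_Icc
    have h3 : ENNReal.ofReal ((B - 1 - η) + c N * (B - 1 - η))
        ≤ volume.restrict (Set.Ioi 0) (U ∪ c N • V) := by
      have hpos : 0 ≤ B - 1 - η := by
        have : η ≤ 1 := by rw [hηdef, div_le_one (by linarith)]; linarith
        simp only [B]; linarith
      rw [h1, hcV, ENNReal.ofReal_add hpos (mul_nonneg (hc0 N).le hpos),
        ENNReal.ofReal_mul (hc0 N).le]
      gcongr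
    have h4 := h3.trans h2
    have hcA := (hc N).2
    have hc1 := (hc N).1
    rw [ENNReal.ofReal_le_ofReal_iff (by simp only [B]; nlinarith)] at h4
    simp only [B] at h4
    nlinarith
  rw [Set.not_disjoint_iff] at hne
  obtain ⟨_, hu, ⟨v, hv, rfl⟩⟩ := hne
  have e1 := hu.2 N le_rfl
  have e2 := hv.2 N le_rfl
  have e3 := hcε N
  have e4 : c N • v * x N = v * (c N * x N) := by simp only [smul_eq_mul]; ring
  simp only [e4] at e1
  set a := L (v * (c N * x N))
  set p := L (x N)
  set q := L (c N * x N)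
  rw [abs_lt] at e1 e2
  have hp : p ≠ 0 := by
    rintro h; rw [h] at e1; simp at e1; linarith [e1]
  have hq : q ≠ 0 := by
    rintro h; rw [h] at e2; simp at e2; linarith [e2]
  have hqa : 1 / 2 < a / q := by linarith
  have e5 : (q / p) * (a / q) = a / p := by field_simp
  apply absurd e3
  rw [not_le, abs_lt]
  constructor
  · by_contra hle
    push Not at hle
    have : q / p ≤ 1 - ε := by linarith
    nlinarith
  · by_contra hle
    push Not at hle
    have : 1 + ε ≤ q / p := by linarith
    nlinarith

/-! ### Karamata's theorem for sums -/

lemma abs_sub_le_mul_of_abs_sub_lt {a c δ ε : ℝ} (ha : 0 < a) (hδ1 : δ ≤ 1 / 2) (hδ2 : δ ≤ ε / 2)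
    (h : |c - a| < δ * a) : |a - c| ≤ ε * c := by
  have h0 : 0 < δ * a := (abs_nonneg _).trans_lt h
  have hδ : 0 < δ := pos_of_mul_pos_left h0 ha.le
  have h1 : δ * a ≤ 1 / 2 * a := by gcongr
  have hc : a ≤ 2 * c := by rw [abs_lt] at h; linarith
  rw [abs_sub_comm]
  calc |c - a| ≤ δ * a := h.le
    _ ≤ δ * (2 * c) := by gcongr
    _ ≤ ε / 2 * (2 * c) := by
        have : 0 ≤ 2 * c := ha.le.trans hc
        gcongr
    _ = ε * c := by ring

/-- On the integers `m / 4 ≤ k ≤ m` a slowly varying function is almost constant. -/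
lemma IsSlowlyVarying.eventually_natCast {L : ℝ → ℝ} (hL : IsSlowlyVarying L) {ε : ℝ}
    (hε : 0 < ε) :
    ∀ᶠ m : ℕ in atTop, ∀ k : ℕ, m ≤ 4 * k → k ≤ m → 0 < L k ∧ |L k - L m| ≤ ε * L m := by
  set δ : ℝ := min (1 / 2) (ε / 2) with hδdef
  have hδ : 0 < δ := by positivity
  have hδ1 : δ ≤ 1 / 2 := min_le_left _ _
  have hδ2 : δ ≤ ε / 2 := min_le_right _ _
  obtain ⟨X, hX⟩ := eventually_atTop.1
    ((hL.eventually_forall_ratio (A := 4) (by norm_num) hδ).and hL.eventually_pos)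
  obtain ⟨N, hN⟩ := exists_nat_ge (max X 1)
  filter_upwards [eventually_ge_atTop (4 * N)] with m hm k hk hkm
  have hNk : (N : ℝ) ≤ k := by exact_mod_cast (by omega : N ≤ k)
  have hk1 : (1 : ℝ) ≤ k := (le_max_right X 1).trans (hN.trans hNk)
  obtain ⟨h1, h2⟩ := hX k ((le_max_left X 1).trans (hN.trans hNk))
  have hkm' : (k : ℝ) ≤ m := by exact_mod_cast hkm
  have hk' : (m : ℝ) ≤ 4 * k := by exact_mod_cast hk
  have h3 := h1 (m / k) ⟨by rw [le_div_iff₀ (by linarith)]; linarith,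
    by rw [div_le_iff₀ (by linarith)]; linarith⟩
  rw [div_mul_cancel₀ _ (by linarith)] at h3
  have h4 : |L m - L k| < δ * L k := by
    have : L m - L k = (L m / L k - 1) * L k := by field_simp
    rw [this, abs_mul, abs_of_pos h2]
    gcongr
  exact ⟨h2, abs_sub_le_mul_of_abs_sub_lt h2 hδ1 hδ2 h4⟩

/-- A sequence with `|d m| ≤ q |d (m / 2)| + o(1)` for some `q < 1` tends to zero. -/
lemma tendsto_zero_of_le_half {d : ℕ → ℝ} {q : ℝ} (hq0 : 0 ≤ q) (hq : q < 1)
    (h : ∀ ε > 0, ∀ᶠ m in atTop, |d m| ≤ q * |d (m / 2)| + ε) : Tendsto d atTop (𝓝 0) := by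
  rw [Metric.tendsto_atTop]
  intro ε hε
  set η := ε * (1 - q) / 2 with hη
  have h1q : 0 < 1 - q := by linarith
  have hη0 : 0 < η := by positivity
  obtain ⟨N, hN⟩ := eventually_atTop.1 ((h η hη0).and (eventually_ge_atTop 1))
  set M := ∑ j ∈ Finset.range N, |d j|
  have hM0 : 0 ≤ M := Finset.sum_nonneg fun _ _ => abs_nonneg _
  have hfix : q * (ε / 2) + η = ε / 2 := by rw [hη]; ring
  have hbd : ∀ m, |d m| ≤ M + ε / 2 := by
    intro m
    induction m using Nat.strong_induction_on with
    | _ m ih =>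
      by_cases hm : m < N
      · have := Finset.single_le_sum (f := fun j => |d j|) (fun j _ => abs_nonneg _)
          (Finset.mem_range.2 hm)
        linarith
      · push Not at hm
        obtain ⟨h1, h2⟩ := hN m hm
        have h3 := ih (m / 2) (by omega)
        have : q * |d (m / 2)| ≤ q * (M + ε / 2) := by gcongr
        nlinarith
  have hpow : ∀ j : ℕ, ∀ m, 2 ^ j * N ≤ m → |d m| ≤ M * q ^ j + ε / 2 := by
    intro j
    induction j with
    | zero => intro m _; simpa using hbd m
    | succ j ih =>
      intro m hm
      have hm2 : 2 ^ j * N ≤ m / 2 := by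
        rw [Nat.le_div_iff_mul_le (by norm_num)]
        calc 2 ^ j * N * 2 = 2 ^ (j + 1) * N := by ring
          _ ≤ m := hm
      have hmN : N ≤ m := le_trans (Nat.le_mul_of_pos_left N (by positivity)) hm
      have h1 := (hN m hmN).1
      have : q * |d (m / 2)| ≤ q * (M * q ^ j + ε / 2) := by gcongr; exact ih _ hm2
      rw [pow_succ]
      nlinarith
  have hlim : Tendsto (fun j : ℕ => M * q ^ j) atTop (𝓝 0) := by
    simpa using (tendsto_pow_atTop_nhds_zero_of_lt_one hq0 hq).const_mul M
  obtain ⟨j, hj⟩ := (hlim.eventually_lt_const (half_pos hε)).exists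
  refine ⟨2 ^ j * N, fun m hm => ?_⟩
  rw [Real.dist_eq, sub_zero]
  linarith [hpow j m hm]

lemma natCast_rpow_half_le {p : ℝ} (hp : 0 ≤ p) (m : ℕ) :
    ((m / 2 : ℕ) : ℝ) ^ p ≤ 2 ^ (-p) * (m : ℝ) ^ p := by
  rw [Real.rpow_neg (by norm_num), ← Real.inv_rpow (by norm_num),
    ← Real.mul_rpow (by norm_num) (by positivity)]
  refine Real.rpow_le_rpow (by positivity) ?_ hp
  have : ((m / 2 : ℕ) : ℝ) ≤ (m : ℝ) / 2 := Nat.cast_div_le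
  linarith

/-- A slowly varying function grows more slowly than every positive power. -/
lemma IsSlowlyVarying.tendsto_rpow_neg_mul {L : ℝ → ℝ} (hL : IsSlowlyVarying L) {δ : ℝ}
    (hδ : 0 < δ) : Tendsto (fun m : ℕ => (m : ℝ) ^ (-δ) * L m) atTop (𝓝 0) := by
  have h2 : (2 : ℝ) ^ (-δ) < 1 := Real.rpow_lt_one_of_one_lt_of_neg (by norm_num) (by linarith)
  have h20 : (0 : ℝ) < 2 ^ (-δ) := by positivity
  set r : ℝ := 2 ^ (-δ)
  set q : ℝ := (1 + r) / 2 with hq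
  have hq1 : q < 1 := by linarith
  have hrq : r < q := by linarith
  have hq0 : 0 < q := by linarith
  refine tendsto_zero_of_le_half (q := q) (by linarith) hq1 fun ε hε => ?_
  have hκ : 0 < 1 - r / q := by rw [sub_pos, div_lt_one (by linarith)]; exact hrq
  filter_upwards [hL.eventually_natCast hκ, eventually_ge_atTop 4] with m hm hm4
  obtain ⟨h1, h3⟩ := hm (m / 2) (by omega) (by omega)
  obtain ⟨h1', -⟩ := hm m (by omega) le_rfl
  have hh : (2 : ℝ) ≤ ((m / 2 : ℕ) : ℝ) := by exact_mod_cast (by omega : 2 ≤ m / 2)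
  have hmh : ((m / 2 : ℕ) : ℝ) ≤ (m : ℝ) / 2 := Nat.cast_div_le
  set h : ℝ := ((m / 2 : ℕ) : ℝ)
  have hpow : (m : ℝ) ^ (-δ) ≤ r * h ^ (-δ) := by
    rw [← Real.mul_rpow (by norm_num) (by linarith)]
    exact Real.rpow_le_rpow_of_nonpos (by linarith) (by linarith) (by linarith)
  have hLm : r * L m ≤ q * L h := by
    rw [abs_le] at h3
    have h4 : r / q * L m ≤ L h := by linarith [h3.1]
    have : q * (r / q * L m) ≤ q * L h := by gcongr
    calc r * L m = q * (r / q * L m) := by field_simp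
      _ ≤ _ := this
  have hh0 : 0 < h ^ (-δ) := Real.rpow_pos_of_pos (by linarith) _
  rw [abs_of_pos (mul_pos (Real.rpow_pos_of_pos (by linarith) _) h1'), abs_of_pos (mul_pos hh0 h1)]
  calc (m : ℝ) ^ (-δ) * L m ≤ r * h ^ (-δ) * L m := by gcongr
    _ = h ^ (-δ) * (r * L m) := by ring
    _ ≤ h ^ (-δ) * (q * L h) := by gcongr
    _ = q * (h ^ (-δ) * L h) := by ring
    _ ≤ _ := by linarith

lemma IsSlowlyVarying.tendsto_rpow_mul {L : ℝ → ℝ} (hL : IsSlowlyVarying L) {γ : ℝ}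
    (hγ : γ < 0) : Tendsto (fun m : ℕ => (m : ℝ) ^ γ * L m) atTop (𝓝 0) := by
  simpa using hL.tendsto_rpow_neg_mul (δ := -γ) (by linarith)

lemma IsSlowlyVarying.summable_rpow_mul {L : ℝ → ℝ} (hL : IsSlowlyVarying L) {γ : ℝ}
    (hγ : γ < -1) : Summable (fun m : ℕ => (m : ℝ) ^ γ * L m) := by
  set δ : ℝ := (-1 - γ) / 2 with hδ
  have h := hL.tendsto_rpow_neg_mul (δ := δ) (by linarith)
  have hs : Summable (fun m : ℕ => (m : ℝ) ^ (γ + δ)) := Real.summable_nat_rpow.2 (by linarith)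
  refine summable_of_isBigO_nat hs ?_
  have hO : (fun m : ℕ => (m : ℝ) ^ (-δ) * L m) =O[atTop] (fun _ => (1 : ℝ)) := h.isBigO_one ℝ
  have h2 := (Asymptotics.isBigO_refl (fun m : ℕ => (m : ℝ) ^ (γ + δ)) atTop).mul hO
  refine (h2.congr' ?_ ?_)
  · filter_upwards [eventually_gt_atTop 0] with m hm
    rw [← mul_assoc, ← Real.rpow_add (by exact_mod_cast hm)]
    congr 2; ring
  · simp

/-- The increments of `x ^ p / p` are asymptotic to `k ^ (p - 1)`. -/
lemma eventually_rpow_sub_one_near {p ε : ℝ} (hp : 0 < p) (hε : 0 < ε) :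
    ∀ᶠ k : ℕ in atTop, |(k : ℝ) ^ (p - 1) - ((k : ℝ) ^ p - ((k : ℝ) - 1) ^ p) / p|
      ≤ ε * (((k : ℝ) ^ p - ((k : ℝ) - 1) ^ p) / p) := by
  have hder : HasDerivAt (fun x : ℝ => x ^ p) p 1 := by
    simpa using Real.hasDerivAt_rpow_const (x := 1) (p := p) (Or.inl one_ne_zero)
  rw [hasDerivAt_iff_tendsto_slope] at hder
  have hseq : Tendsto (fun k : ℕ => 1 - ((k : ℝ))⁻¹) atTop (𝓝[≠] 1) := by
    rw [tendsto_nhdsWithin_iff]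
    constructor
    · simpa using tendsto_const_nhds.sub (tendsto_inv_atTop_nhds_zero_nat (𝕜 := ℝ)) (a := (1 : ℝ))
    · filter_upwards [eventually_gt_atTop 0] with k hk
      have : (0 : ℝ) < (k : ℝ)⁻¹ := by positivity
      simp only [Set.mem_compl_iff, Set.mem_singleton_iff]
      linarith
  have h1 := (hder.comp hseq).div_const p
  rw [div_self hp.ne'] at h1
  set δ := min (1 / 2) (ε / 2) with hδd
  have hδ : 0 < δ := by positivity
  have hδ1 : δ ≤ 1 / 2 := min_le_left _ _
  have hδ2 : δ ≤ ε / 2 := min_le_right _ _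
  filter_upwards [(Metric.tendsto_nhds.1 h1) δ hδ, eventually_gt_atTop 0] with k hk hk0
  have hk0' : (0 : ℝ) < k := by exact_mod_cast hk0
  have hk1 : (1 : ℝ) ≤ k := by exact_mod_cast hk0
  have e : (slope (fun x : ℝ => x ^ p) 1 ∘ fun k : ℕ => 1 - ((k : ℝ))⁻¹) k / p
      = (((k : ℝ) ^ p - ((k : ℝ) - 1) ^ p) / p) / (k : ℝ) ^ (p - 1) := by
    have e1 : (1 : ℝ) - (k : ℝ)⁻¹ = ((k : ℝ) - 1) / k := by field_simp
    simp only [Function.comp, slope_def_field, Real.one_rpow]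
    rw [e1, Real.div_rpow (by linarith) hk0'.le, Real.rpow_sub hk0', Real.rpow_one]
    have : (k : ℝ) ^ p ≠ 0 := (Real.rpow_pos_of_pos hk0' p).ne'
    have h3 : ((k : ℝ) - 1) / k - 1 = - (1 / k) := by field_simp; ring
    rw [h3]
    field_simp
    ring
  rw [e, Real.dist_eq] at hk
  have hpos : 0 < (k : ℝ) ^ (p - 1) := Real.rpow_pos_of_pos hk0' _
  set a := (k : ℝ) ^ (p - 1)
  set c := ((k : ℝ) ^ p - ((k : ℝ) - 1) ^ p) / p
  have h2 : |c - a| < δ * a := by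
    have : c - a = (c / a - 1) * a := by field_simp
    rw [this, abs_mul, abs_of_pos hpos]
    gcongr
  exact abs_sub_le_mul_of_abs_sub_lt hpos hδ1 hδ2 h2

lemma sum_Ioc_rpow_sub (p : ℝ) {h m : ℕ} (hm : h ≤ m) :
    ∑ k ∈ Finset.Ioc h m, ((k : ℝ) ^ p - ((k : ℝ) - 1) ^ p) / p
      = ((m : ℝ) ^ p - (h : ℝ) ^ p) / p := by
  induction m, hm using Nat.le_induction with
  | base => simp
  | succ m hm ih =>
    rw [Finset.sum_Ioc_succ_top (by omega), ih]
    push_cast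
    rw [add_sub_cancel_right]
    ring

/-- **Karamata's theorem** for sums: `∑_{k ≤ m} k ^ γ L(k) ∼ m ^ (γ + 1) L(m) / (γ + 1)` when
`γ > -1`. The relative error `d m` obeys `|d m| ≤ q |d (m / 2)| + o(1)`, since on the block
`(m / 2, m]` the function `L` is almost constant. -/
theorem IsSlowlyVarying.tendsto_sum_div {L : ℝ → ℝ} (hL : IsSlowlyVarying L) {γ : ℝ}
    (hγ : -1 < γ) :
    Tendsto (fun m : ℕ => (∑ k ∈ Finset.Ioc 0 m, (k : ℝ) ^ γ * L k) /
      ((m : ℝ) ^ (γ + 1) * L m / (γ + 1))) atTop (𝓝 1) := by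
  set p := γ + 1 with hp
  have hp0 : 0 < p := by linarith
  have hγp : γ = p - 1 := by rw [hp]; ring
  set A : ℕ → ℝ := fun m => ∑ k ∈ Finset.Ioc 0 m, (k : ℝ) ^ γ * L k with hA
  set T : ℕ → ℝ := fun m => (m : ℝ) ^ p * L m / p with hT
  have h2 : (2 : ℝ) ^ (-p) < 1 := Real.rpow_lt_one_of_one_lt_of_neg (by norm_num) (by linarith)
  have h20 : (0 : ℝ) < 2 ^ (-p) := by positivity
  set r : ℝ := 2 ^ (-p) with hr
  set q : ℝ := (1 + r) / 2 with hq
  have hq1 : q < 1 := by linarith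
  have hrq : r < q := by linarith
  have hκ : 0 < q / r - 1 := by rw [sub_pos, lt_div_iff₀ h20]; linarith
  suffices Tendsto (fun m => A m / T m - 1) atTop (𝓝 0) by
    simpa using this.add_const 1
  refine tendsto_zero_of_le_half (q := q) (by linarith) hq1 fun ε hε => ?_
  set η := min 1 (min (ε / 4) (q / r - 1)) with hη
  have hη0 : 0 < η := by positivity
  have hη1 : η ≤ 1 := min_le_left _ _
  have hη2 : η ≤ ε / 4 := (min_le_right _ _).trans (min_le_left _ _)
  have hη3 : η ≤ q / r - 1 := (min_le_right _ _).trans (min_le_right _ _)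
  obtain ⟨K, hK⟩ := eventually_atTop.1 (eventually_rpow_sub_one_near hp0 hη0)
  filter_upwards [hL.eventually_natCast hη0, eventually_ge_atTop 4,
    eventually_ge_atTop (2 * K)] with m hm hm4 hmK
  have hhm : m / 2 ≤ m := by omega
  obtain ⟨hLh, hLh'⟩ := hm (m / 2) (by omega) (by omega)
  obtain ⟨hLm, -⟩ := hm m (by omega) le_rfl
  have hm0 : (0 : ℝ) < m := by exact_mod_cast (by omega : 0 < m)
  have hh0 : (0 : ℝ) < (m / 2 : ℕ) := by exact_mod_cast (by omega : 0 < m / 2)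
  have hTm : 0 < T m := by simp only [hT]; positivity
  have hTh : 0 < T (m / 2) := by simp only [hT]; positivity
  have hhp := natCast_rpow_half_le hp0.le m
  rw [← hr] at hhp
  -- the block `(m / 2, m]`, compared with a telescoping sum
  have hblock : |A m - A (m / 2) - L m * (((m : ℝ) ^ p - ((m / 2 : ℕ) : ℝ) ^ p) / p)|
      ≤ 3 * η * T m := by
    have e1 : A m - A (m / 2) = ∑ k ∈ Finset.Ioc (m / 2) m, (k : ℝ) ^ γ * L k := by
      simp only [hA]
      rw [← Finset.sum_Ioc_consecutive _ (Nat.zero_le _) hhm]; ring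
    rw [e1, ← sum_Ioc_rpow_sub p hhm, Finset.mul_sum, ← Finset.sum_sub_distrib]
    refine (Finset.abs_sum_le_sum_abs _ _).trans ?_
    calc _ ≤ ∑ k ∈ Finset.Ioc (m / 2) m,
          3 * η * L m * (((k : ℝ) ^ p - ((k : ℝ) - 1) ^ p) / p) := by
            refine Finset.sum_le_sum fun k hk => ?_
            rw [Finset.mem_Ioc] at hk
            obtain ⟨hk1, hk2⟩ := hm k (by omega) hk.2
            have hk3 := hK k (by omega)
            rw [hγp]
            set c := ((k : ℝ) ^ p - ((k : ℝ) - 1) ^ p) / p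
            set a := (k : ℝ) ^ (p - 1)
            have hc : 0 ≤ c := by
              have := (abs_nonneg _).trans hk3
              exact nonneg_of_mul_nonneg_right this hη0
            have hk4 : L k ≤ 2 * L m := by rw [abs_le] at hk2; nlinarith
            calc |a * L k - L m * c| = |(a - c) * L k + c * (L k - L m)| := by ring_nf
              _ ≤ |(a - c) * L k| + |c * (L k - L m)| := abs_add_le _ _
              _ = |a - c| * L k + c * |L k - L m| := by
                  rw [abs_mul, abs_mul, abs_of_pos hk1, abs_of_nonneg hc]
              _ ≤ (η * c) * (2 * L m) + c * (η * L m) := by gcongr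
              _ = _ := by ring
      _ = 3 * η * L m * (((m : ℝ) ^ p - ((m / 2 : ℕ) : ℝ) ^ p) / p) := by
            rw [← Finset.mul_sum, sum_Ioc_rpow_sub p hhm]
      _ ≤ 3 * η * L m * ((m : ℝ) ^ p / p) := by
            gcongr
            have : (0 : ℝ) ≤ ((m / 2 : ℕ) : ℝ) ^ p := by positivity
            linarith
      _ = _ := by simp only [hT]; ring
  have hT' : |L m * (((m : ℝ) ^ p - ((m / 2 : ℕ) : ℝ) ^ p) / p) - (T m - T (m / 2))|
      ≤ η * T m := by
    have e : L m * (((m : ℝ) ^ p - ((m / 2 : ℕ) : ℝ) ^ p) / p) - (T m - T (m / 2))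
        = ((m / 2 : ℕ) : ℝ) ^ p / p * (L (m / 2 : ℕ) - L m) := by
      simp only [hT]; ring
    rw [e, abs_mul, abs_of_pos (by positivity)]
    calc _ ≤ (m : ℝ) ^ p / p * (η * L m) := by
          gcongr
      _ = _ := by simp only [hT]; ring
  have hTT : T (m / 2) ≤ q * T m := by
    have h5 : L (m / 2 : ℕ) ≤ q / r * L m := by
      rw [abs_le] at hLh'; nlinarith
    calc T (m / 2) = ((m / 2 : ℕ) : ℝ) ^ p * L (m / 2 : ℕ) / p := rfl
      _ ≤ (r * (m : ℝ) ^ p) * (q / r * L m) / p := by gcongr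
      _ = q * T m := by simp only [hT]; field_simp
  have key : |A m - T m| ≤ |A (m / 2) - T (m / 2)| + 4 * η * T m := by
    have e : A m - T m = (A (m / 2) - T (m / 2)) +
      ((A m - A (m / 2) - L m * (((m : ℝ) ^ p - ((m / 2 : ℕ) : ℝ) ^ p) / p)) +
        (L m * (((m : ℝ) ^ p - ((m / 2 : ℕ) : ℝ) ^ p) / p) - (T m - T (m / 2)))) := by ring
    rw [e]
    refine (abs_add_le _ _).trans ?_
    have := abs_add_le (A m - A (m / 2) - L m * (((m : ℝ) ^ p - ((m / 2 : ℕ) : ℝ) ^ p) / p))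
      (L m * (((m : ℝ) ^ p - ((m / 2 : ℕ) : ℝ) ^ p) / p) - (T m - T (m / 2)))
    linarith
  have d1 : |A m / T m - 1| = |A m - T m| / T m := by
    rw [← abs_of_pos hTm, ← abs_div, abs_of_pos hTm]; congr 1; field_simp
  have d2 : |A (m / 2) - T (m / 2)| = |A (m / 2) / T (m / 2) - 1| * T (m / 2) := by
    rw [← abs_of_pos hTh, ← abs_mul, abs_of_pos hTh]; congr 1; field_simp
  rw [d1, div_le_iff₀ hTm]
  rw [d2] at key
  have := mul_le_mul_of_nonneg_left hTT (abs_nonneg (A (m / 2) / T (m / 2) - 1))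
  nlinarith

/-- `L(m) = o(∑_{k ≤ m} L(k) / k)`: with `A` the sum,
`A m / L m ≥ (1 - ε) A (m / 2) / L (m / 2) + 1 / 3`, so the ratio eventually exceeds every bound. -/
theorem IsSlowlyVarying.tendsto_div_sum_inv {L : ℝ → ℝ} (hL : IsSlowlyVarying L)
    (hL0 : ∀ x, 0 ≤ L x) :
    Tendsto (fun m : ℕ => L m / ∑ k ∈ Finset.Ioc 0 m, L k / k) atTop (𝓝 0) := by
  set A : ℕ → ℝ := fun m => ∑ k ∈ Finset.Ioc 0 m, L k / k with hA
  have hA0 : ∀ m, 0 ≤ A m := fun m => Finset.sum_nonneg fun k _ => div_nonneg (hL0 _) (by positivity)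
  suffices h : Tendsto (fun m => A m / L m) atTop atTop by
    have := h.inv_tendsto_atTop
    refine this.congr fun m => ?_
    simp [hA]
  rw [tendsto_atTop]
  intro b
  set B := max b 0 + 1 with hB
  have hB1 : 1 ≤ B := by simp [hB]
  have hBb : b ≤ B - 1 := by simp [hB]
  set ε := 1 / (6 * B) with hε
  have hε0 : 0 < ε := by positivity
  have hεB : ε * B = 1 / 6 := by rw [hε]; field_simp
  have hε1 : ε ≤ 1 / 6 := by rw [hε]; gcongr; linarith
  have hlim : Tendsto (fun m => max (B - A m / L m) 0) atTop (𝓝 0) := by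
    refine tendsto_zero_of_le_half (q := 1 - ε) (by linarith) (by linarith) fun ε' hε' => ?_
    filter_upwards [hL.eventually_natCast hε0, eventually_ge_atTop 4] with m hm hm4
    obtain ⟨hLh, hLh'⟩ := hm (m / 2) (by omega) (by omega)
    obtain ⟨hLm, -⟩ := hm m (by omega) le_rfl
    have hm0 : (0 : ℝ) < m := by exact_mod_cast (by omega : 0 < m)
    have hstep : A (m / 2) + 1 / 3 * L m ≤ A m := by
      have e1 : A m = A (m / 2) + ∑ k ∈ Finset.Ioc (m / 2) m, L k / k := by
        simp only [hA]
        rw [← Finset.sum_Ioc_consecutive _ (Nat.zero_le _) (by omega : m / 2 ≤ m)]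
      rw [e1]
      have : ∑ k ∈ Finset.Ioc (m / 2) m, (5 / 6 * L m / m) ≤ ∑ k ∈ Finset.Ioc (m / 2) m, L k / k := by
        refine Finset.sum_le_sum fun k hk => ?_
        rw [Finset.mem_Ioc] at hk
        obtain ⟨hk1, hk2⟩ := hm k (by omega) hk.2
        have hk0 : (0 : ℝ) < k := by exact_mod_cast (by omega : 0 < k)
        have hkm : (k : ℝ) ≤ m := by exact_mod_cast hk.2
        have : 5 / 6 * L m ≤ L k := by rw [abs_le] at hk2; nlinarith
        gcongr
      rw [Finset.sum_const, Nat.card_Ioc, nsmul_eq_mul, Nat.cast_sub (by omega)] at this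
      have hmh : ((m / 2 : ℕ) : ℝ) ≤ (m : ℝ) / 2 := Nat.cast_div_le
      have h6 : 1 / 3 * L m ≤ ((m : ℝ) - ((m / 2 : ℕ) : ℝ)) * (5 / 6 * L m / m) := by
        calc 1 / 3 * L m ≤ ((m : ℝ) / 2) * (5 / 6 * L m / m) := by
              have : ((m : ℝ) / 2) * (5 / 6 * L m / m) = 5 / 12 * L m := by field_simp; ring
              rw [this]; nlinarith
          _ ≤ _ := by gcongr; linarith
      linarith
    have hratio : (1 - ε) * (A (m / 2) / L (m / 2 : ℕ)) + 1 / 3 ≤ A m / L m := by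
      have h7 : (1 - ε) * (A (m / 2) / L (m / 2 : ℕ)) ≤ A (m / 2) / L m := by
        rw [mul_div_assoc', div_le_div_iff₀ hLh hLm]
        have : (1 - ε) * L m ≤ L (m / 2 : ℕ) := by rw [abs_le] at hLh'; linarith [hLh'.1]
        calc (1 - ε) * A (m / 2) * L m = A (m / 2) * ((1 - ε) * L m) := by ring
          _ ≤ _ := mul_le_mul_of_nonneg_left this (hA0 _)
      have h8 : A (m / 2) / L m + 1 / 3 ≤ A m / L m := by
        rw [div_add' _ _ _ hLm.ne']
        gcongr
      linarith
    rw [abs_of_nonneg (le_max_right _ _), abs_of_nonneg (le_max_right _ _)]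
    have h9 : B - A (m / 2) / L (m / 2 : ℕ) ≤ max (B - A (m / 2) / L (m / 2 : ℕ)) 0 := le_max_left _ _
    have h10 : 0 ≤ max (B - A (m / 2) / L (m / 2 : ℕ)) 0 := le_max_right _ _
    apply max_le
    · nlinarith
    · nlinarith
  filter_upwards [hlim.eventually_lt_const one_pos] with m hm
  have := (le_max_left (B - A m / L m) 0).trans_lt hm
  linarith

/-! ### The area formula with multiplicity for functions of one variable -/

section AreaFormula

variable {ψ ψ' : ℝ → ℝ}

/-- Sard's lemma in dimension one. -/
lemma volume_image_critical_eq_zero (hψ : ∀ x, HasDerivAt ψ (ψ' x) x) :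
    volume (ψ '' {x | ψ' x = 0}) = 0 := by
  refine addHaar_image_eq_zero_of_det_fderivWithin_eq_zero volume
    (f' := fun x => ContinuousLinearMap.toSpanSingleton ℝ (ψ' x))
    (fun x _ => (hψ x).hasFDerivAt.hasFDerivWithinAt) fun x hx => ?_
  have hx' : ψ' x = 0 := hx
  rw [hx']
  simp

/-- The set where `ψ' ≠ 0` is a countable disjoint union of measurable sets on which `ψ` is
injective. -/
lemma exists_partition_injOn (hψ : ∀ x, HasDerivAt ψ (ψ' x) x) (hc : Continuous ψ') :
    ∃ A : ℕ → Set ℝ, (∀ n, MeasurableSet (A n)) ∧ Pairwise (Function.onFun Disjoint A) ∧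
      (⋃ n, A n) = {x | ψ' x ≠ 0} ∧ ∀ n, Set.InjOn ψ (A n) := by
  classical
  obtain ⟨f, hf⟩ := exists_surjective_nat (ℚ × ℚ)
  set J : ℕ → Set ℝ := fun n =>
    if ∀ x ∈ Set.Ioo ((f n).1 : ℝ) (f n).2, ψ' x ≠ 0 then Set.Ioo ((f n).1 : ℝ) (f n).2 else ∅
    with hJ
  have hJm : ∀ n, MeasurableSet (J n) := by
    intro n; simp only [hJ]; split_ifs
    · exact measurableSet_Ioo
    · exact MeasurableSet.empty
  have hJinj : ∀ n, Set.InjOn ψ (J n) := by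
    intro n
    simp only [hJ]
    split_ifs with h
    · have key : ∀ x ∈ Set.Ioo ((f n).1 : ℝ) (f n).2, ∀ y ∈ Set.Ioo ((f n).1 : ℝ) (f n).2,
          x < y → ψ x ≠ ψ y := by
        intro x hx y hy hlt hxy
        obtain ⟨c, hc1, hc2⟩ := exists_hasDerivAt_eq_zero hlt
          (fun z _ => (hψ z).continuousAt.continuousWithinAt) hxy (fun z _ => hψ z)
        exact h c ⟨hx.1.trans hc1.1, hc1.2.trans hy.2⟩ hc2
      intro x hx y hy hxy
      by_contra hne
      rcases lt_or_gt_of_ne hne with hlt | hlt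
      · exact key x hx y hy hlt hxy
      · exact key y hy x hx hlt hxy.symm
    · exact Set.injOn_empty _
  have hJU : (⋃ n, J n) = {x | ψ' x ≠ 0} := by
    ext x
    simp only [Set.mem_iUnion, Set.mem_ofPred_eq]
    constructor
    · rintro ⟨n, hn⟩
      simp only [hJ] at hn
      split_ifs at hn with h
      · exact h x hn
      · exact absurd hn (Set.notMem_empty x)
    · intro hx
      have hev : ∀ᶠ y in 𝓝 x, ψ' y ≠ 0 := hc.continuousAt.eventually_ne hx
      obtain ⟨ε, hε, hball⟩ := Metric.eventually_nhds_iff.1 hev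
      obtain ⟨p, hp1, hp2⟩ := exists_rat_btwn (show x - ε < x by linarith)
      obtain ⟨r, hr1, hr2⟩ := exists_rat_btwn (show x < x + ε by linarith)
      obtain ⟨n, hn⟩ := hf (p, r)
      refine ⟨n, ?_⟩
      have : ∀ y ∈ Set.Ioo ((f n).1 : ℝ) (f n).2, ψ' y ≠ 0 := by
        intro y hy
        rw [hn] at hy
        refine hball ?_
        rw [Real.dist_eq, abs_lt]
        constructor <;> linarith [hy.1, hy.2]
      simp only [hJ, if_pos this]
      rw [hn]
      exact ⟨hp2, hr1⟩
  refine ⟨disjointed J, fun n => MeasurableSet.disjointed hJm n, disjoint_disjointed J, ?_,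
    fun n => (hJinj n).mono (disjointed_subset J n)⟩
  rw [iUnion_disjointed, hJU]

/-- **Area formula.** The number of preimages in `s`, integrated over all levels, is the total
variation `∫_s |ψ'|`. -/
theorem lintegral_count_preimage (hψ : ∀ x, HasDerivAt ψ (ψ' x) x) (hc : Continuous ψ') {s : Set ℝ}
    (hs : MeasurableSet s) :
    AEMeasurable (fun u => Measure.count (s ∩ ψ ⁻¹' {u})) ∧
    ∫⁻ u, Measure.count (s ∩ ψ ⁻¹' {u}) = ∫⁻ x in s, ENNReal.ofReal |ψ' x| := by
  obtain ⟨A, hAm, hAd, hAU, hAi⟩ := exists_partition_injOn hψ hc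
  have hψc : Continuous ψ := continuous_iff_continuousAt.2 fun x => (hψ x).continuousAt
  set B : ℕ → Set ℝ := fun n => A n ∩ s with hB
  have hBm : ∀ n, MeasurableSet (B n) := fun n => (hAm n).inter hs
  have hBi : ∀ n, Set.InjOn ψ (B n) := fun n => (hAi n).mono Set.inter_subset_left
  have hBd : Pairwise (Function.onFun Disjoint B) := fun i j hij =>
    (hAd hij).mono Set.inter_subset_left Set.inter_subset_left
  have hIm : ∀ n, MeasurableSet (ψ '' B n) := fun n =>
    (hBm n).image_of_continuousOn_injOn hψc.continuousOn (hBi n)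
  have hae : ∀ᵐ u, Measure.count (s ∩ ψ ⁻¹' {u})
      = ∑' n, (ψ '' B n).indicator (fun _ => (1 : ENNReal)) u := by
    have h0 := volume_image_critical_eq_zero hψ
    filter_upwards [measure_eq_zero_iff_ae_notMem.1 h0] with u hu
    have e : s ∩ ψ ⁻¹' {u} = ⋃ n, B n ∩ ψ ⁻¹' {u} := by
      rw [← Set.iUnion_inter]
      have : (⋃ n, B n) = {x | ψ' x ≠ 0} ∩ s := by rw [← hAU, Set.iUnion_inter]
      rw [this]
      ext x
      simp only [Set.mem_inter_iff, Set.mem_ofPred_eq, Set.mem_preimage, Set.mem_singleton_iff]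
      constructor
      · rintro ⟨h1, h2⟩
        exact ⟨⟨fun h => hu ⟨x, h, h2⟩, h1⟩, h2⟩
      · rintro ⟨⟨h1, h2⟩, h3⟩
        exact ⟨h2, h3⟩
    rw [e, measure_iUnion]
    · refine tsum_congr fun n => ?_
      by_cases hn : u ∈ ψ '' B n
      · rw [Set.indicator_of_mem hn]
        obtain ⟨x, hx, rfl⟩ := hn
        have : B n ∩ ψ ⁻¹' {ψ x} = {x} := by
          ext y
          simp only [Set.mem_inter_iff, Set.mem_preimage, Set.mem_singleton_iff]
          constructor
          · rintro ⟨h1, h2⟩; exact hBi n h1 hx h2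
          · rintro rfl; exact ⟨hx, rfl⟩
        rw [this, Measure.count_singleton]
      · rw [Set.indicator_of_notMem hn]
        have : B n ∩ ψ ⁻¹' {u} = ∅ := by
          ext y
          simp only [Set.mem_inter_iff, Set.mem_preimage, Set.mem_singleton_iff,
            Set.mem_empty_iff_false, iff_false, not_and]
          intro h1 h2
          exact hn ⟨y, h1, h2⟩
        rw [this, measure_empty]
    · exact fun i j hij => (hBd hij).mono Set.inter_subset_left Set.inter_subset_left
    · exact fun n => (hBm n).inter (hψc.measurable (measurableSet_singleton u))
  have hmeas : ∀ n, Measurable ((ψ '' B n).indicator (fun _ => (1 : ENNReal))) := fun n =>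
    measurable_const.indicator (hIm n)
  refine ⟨⟨_, Measurable.tsum hmeas, hae⟩, ?_⟩
  rw [lintegral_congr_ae hae, lintegral_tsum fun n => (hmeas n).aemeasurable]
  have h1 : ∀ n, ∫⁻ u, (ψ '' B n).indicator (fun _ => (1 : ENNReal)) u
      = ∫⁻ x in B n, ENNReal.ofReal |ψ' x| := by
    intro n
    rw [lintegral_indicator_const (hIm n), one_mul]
    have := lintegral_image_eq_lintegral_abs_deriv_mul (hBm n)
      (fun x _ => (hψ x).hasDerivWithinAt) (hBi n) (fun _ => 1)
    simpa using this
  simp_rw [h1]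
  rw [← lintegral_iUnion hBm hBd]
  have hBU : (⋃ n, B n) = s ∩ {x | ψ' x ≠ 0} := by
    rw [← hAU, Set.inter_comm, Set.iUnion_inter]
  have hm0 : MeasurableSet {x | ψ' x ≠ 0} := by rw [← hAU]; exact MeasurableSet.iUnion hAm
  rw [hBU, ← lintegral_inter_add_sdiff (μ := volume) _ s hm0]
  have : ∫⁻ x in s \ {x | ψ' x ≠ 0}, ENNReal.ofReal |ψ' x| = 0 := by
    rw [setLIntegral_congr_fun (g := fun _ => 0) (hs.diff hm0)]
    · simp
    · rintro x ⟨-, hx⟩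
      simp only [Set.mem_ofPred_eq, not_not] at hx
      simp [hx]
  rw [this, add_zero]

lemma exp_mul_I_eq_iff {x u : ℝ} :
    Complex.exp (x * Complex.I) = Complex.exp (u * Complex.I) ↔
      ∃ j : ℤ, x = u + j * (2 * Real.pi) := by
  rw [Complex.exp_eq_exp_iff_exists_int]
  refine exists_congr fun j => ?_
  rw [← Complex.ofReal_inj]
  push_cast
  rw [show (u : ℂ) * Complex.I + j * (2 * Real.pi * Complex.I)
    = (u + j * (2 * Real.pi)) * Complex.I by ring]
  exact mul_left_inj' Complex.I_ne_zero

/-- Almost every point of the circle is a regular value of `θ ↦ exp (i ψ(θ))`. -/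
lemma ae_regular_value (hψ : ∀ x, HasDerivAt ψ (ψ' x) x) :
    ∀ᵐ u : ℝ, ∀ x : ℝ, Complex.exp (ψ x * Complex.I) = Complex.exp (u * Complex.I) → ψ' x ≠ 0 := by
  have h0 := measure_eq_zero_iff_ae_notMem.1 (volume_image_critical_eq_zero hψ)
  have h1 : ∀ j : ℤ, ∀ᵐ u : ℝ, u + j * (2 * Real.pi) ∉ ψ '' {x | ψ' x = 0} := fun j =>
    (measurePreserving_add_right volume ((j : ℝ) * (2 * Real.pi))).quasiMeasurePreserving.ae h0
  filter_upwards [ae_all_iff.2 h1] with u hu x hx hx0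
  obtain ⟨j, hj⟩ := exp_mul_I_eq_iff.1 hx
  exact hu j ⟨x, hx0, hj⟩

/-- The area formula for the circle-valued map `θ ↦ exp (i ψ(θ))`. -/
theorem lintegral_count_exp_eq (hψ : ∀ x, HasDerivAt ψ (ψ' x) x) (hc : Continuous ψ') {s : Set ℝ}
    (hs : MeasurableSet s) :
    ∫⁻ u in Set.Ioc 0 (2 * Real.pi),
      Measure.count {x ∈ s | Complex.exp (ψ x * Complex.I) = Complex.exp (u * Complex.I)}
      = ∫⁻ x in s, ENNReal.ofReal |ψ' x| := by
  have hψc : Continuous ψ := continuous_iff_continuousAt.2 fun x => (hψ x).continuousAt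
  obtain ⟨hm, hint⟩ := lintegral_count_preimage hψ hc hs
  set N : ℝ → ENNReal := fun u => Measure.count (s ∩ ψ ⁻¹' {u}) with hN
  have hcount : ∀ u : ℝ,
      Measure.count {x ∈ s | Complex.exp (ψ x * Complex.I) = Complex.exp (u * Complex.I)}
        = ∑' j : ℤ, N (u + j * (2 * Real.pi)) := by
    intro u
    have e : {x ∈ s | Complex.exp (ψ x * Complex.I) = Complex.exp (u * Complex.I)}
        = ⋃ j : ℤ, s ∩ ψ ⁻¹' {u + j * (2 * Real.pi)} := by
      ext x
      simp [exp_mul_I_eq_iff]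
    rw [e, measure_iUnion]
    · intro i j hij
      refine Set.disjoint_left.2 fun x hx hx' => hij ?_
      have h1 : ψ x = u + i * (2 * Real.pi) := hx.2
      have h2 : ψ x = u + j * (2 * Real.pi) := hx'.2
      have h3 : (i : ℝ) * (2 * Real.pi) = j * (2 * Real.pi) := by linarith
      exact_mod_cast mul_right_cancel₀ (by positivity) h3
    · exact fun j => hs.inter (hψc.measurable (measurableSet_singleton _))
  simp_rw [hcount]
  rw [lintegral_tsum]
  · rw [← hint]
    have hfd := isAddFundamentalDomain_Ioc Real.two_pi_pos 0
    rw [zero_add] at hfd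
    rw [hfd.lintegral_eq_tsum'' N]
    let e : ℤ ≃ AddSubgroup.zmultiples (2 * Real.pi) :=
      Equiv.ofBijective (fun j => ⟨j • (2 * Real.pi), j, rfl⟩) (by
        constructor
        · intro i j hij
          have h := congrArg Subtype.val hij
          simp only [zsmul_eq_mul] at h
          exact_mod_cast mul_right_cancel₀ (by positivity) h
        · rintro ⟨_, j, rfl⟩
          exact ⟨j, rfl⟩)
    rw [← e.tsum_eq]
    refine tsum_congr fun j => lintegral_congr fun u => ?_
    simp only [e, Equiv.ofBijective_apply, AddSubgroup.vadd_def, zsmul_eq_mul, vadd_eq_add]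
    rw [add_comm]
  · intro j
    refine AEMeasurable.restrict ?_
    exact hm.comp_quasiMeasurePreserving
      (measurePreserving_add_right volume ((j : ℝ) * (2 * Real.pi))).quasiMeasurePreserving

end AreaFormula

/-! ### The self-inversive polynomial on the unit circle -/

section CircleCount

open Complex (I)
open scoped ComplexConjugate

/-- `1 + ∑_{k=1}^m c(k) x_k e^{ikθ}`. With `c = b` it is the first half of the self-inversive
polynomial at `e^{iθ}`. -/
noncomputable def trigSum (c : ℕ → ℝ) (m : ℕ) (x : ℕ → ℂ) (θ : ℝ) : ℂ :=
  1 + ∑ k ∈ Finset.Icc 1 m, (c k : ℂ) * x k * Complex.exp ((k * θ : ℝ) * I)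

/-- `c(k) (1 - 2k / n)` with `n = 2m + 1`, the coefficients of `P - (2 / n) z P'` when `c(k)` are
those of `P`. -/
noncomputable def tiltedCoeff (c : ℕ → ℝ) (m k : ℕ) : ℝ := c k * (1 - 2 * k / (2 * m + 1))

/-- Multiplication of `x_k` by `e^{ikτ}`. -/
noncomputable def rotateSeq (τ : ℝ) (x : ℕ → ℂ) : ℕ → ℂ :=
  fun k => Complex.exp ((k * τ : ℝ) * I) * x k

lemma trigSum_rotateSeq (c : ℕ → ℝ) (m : ℕ) (x : ℕ → ℂ) (τ θ : ℝ) :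
    trigSum c m (rotateSeq τ x) θ = trigSum c m x (θ + τ) := by
  simp only [trigSum, rotateSeq]
  congr 1
  refine Finset.sum_congr rfl fun k _ => ?_
  rw [mul_add, Complex.ofReal_add, add_mul, Complex.exp_add]
  ring

lemma conj_exp_ofReal_mul_I (a : ℝ) :
    conj (Complex.exp (a * I)) = Complex.exp ((-a : ℝ) * I) := by
  rw [← Complex.exp_conj]
  simp

lemma eval_selfInversivePoly (b : ℝ → ℝ) (x : ℕ → ℂ) (m : ℕ) (φ : ℝ) :
    (selfInversivePoly b x m).eval (Complex.exp (φ * I)) = trigSum (fun k => b k) m x φ +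
      Complex.exp (((2 * m + 1) * φ : ℝ) * I) * conj (trigSum (fun k => b k) m x φ) := by
  have hpow : ∀ j : ℕ, Complex.exp (φ * I) ^ j = Complex.exp ((j * φ : ℝ) * I) := by
    intro j
    rw [← Complex.exp_nat_mul]
    congr 1; push_cast; ring
  simp only [selfInversivePoly, trigSum, eval_add, eval_one, eval_finsetSum, eval_mul, eval_C,
    eval_pow, eval_X, hpow, map_add, map_one, map_sum, map_mul, Complex.conj_ofReal,
    conj_exp_ofReal_mul_I, mul_add, mul_one, Finset.mul_sum]
  have h1 : ∀ k ∈ Finset.Icc 1 m,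
      (b k : ℂ) * conj (x k) * Complex.exp (((2 * m + 1 - k : ℕ) * φ : ℝ) * I)
        = Complex.exp ((2 * m * φ + 1 * φ : ℝ) * I) *
          ((b k : ℂ) * conj (x k) * Complex.exp ((-(k * φ) : ℝ) * I)) := by
    intro k hk
    rw [Finset.mem_Icc] at hk
    rw [Nat.cast_sub (by omega), mul_left_comm, ← Complex.exp_add]
    congr 2
    push_cast; ring
  rw [Finset.sum_congr rfl h1]
  have h2 : ((2 * m + 1 : ℕ) * φ : ℝ) = 2 * m * φ + 1 * φ := by push_cast; ring
  have h3 : ((2 * m + 1) * φ : ℝ) = 2 * m * φ + 1 * φ := by ring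
  rw [h2, h3]
  ring

lemma selfInversivePoly_ne_zero (b : ℝ → ℝ) (x : ℕ → ℂ) (m : ℕ) :
    selfInversivePoly b x m ≠ 0 := by
  intro h
  have h0 : (selfInversivePoly b x m).eval 0 = 1 := by
    simp only [selfInversivePoly, eval_add, eval_one, eval_finsetSum, eval_mul, eval_C, eval_pow,
      eval_X]
    rw [Finset.sum_eq_zero, Finset.sum_eq_zero]
    · simp
    · intro k hk
      rw [Finset.mem_Icc] at hk
      rw [zero_pow (by omega), mul_zero]
    · intro k hk
      rw [Finset.mem_Icc] at hk
      rw [zero_pow (by omega), mul_zero]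
  rw [h] at h0
  simp at h0

/-- If all roots on the unit circle are simple, counting them with multiplicity is counting
points. -/
lemma card_filter_roots_eq_encard {p : ℂ[X]} (hp : p ≠ 0)
    (hs : ∀ z : ℂ, ‖z‖ = 1 → p.IsRoot z → p.derivative.eval z ≠ 0) :
    (((p.roots.filter (fun z => ‖z‖ = 1)).card : ℕ) : ℕ∞) = {z : ℂ | ‖z‖ = 1 ∧ p.IsRoot z}.encard := by
  classical
  have hnd : (p.roots.filter (fun z => ‖z‖ = 1)).Nodup := by
    rw [Multiset.nodup_iff_count_le_one]
    intro z
    by_cases hz : ‖z‖ = 1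
    · rw [Multiset.count_filter_of_pos (p := fun z : ℂ => ‖z‖ = 1) hz, count_roots]
      by_contra hlt
      push Not at hlt
      rw [one_lt_rootMultiplicity_iff_isRoot hp] at hlt
      exact hs z hz hlt.1 hlt.2
    · rw [Multiset.count_filter_of_neg (p := fun z : ℂ => ‖z‖ = 1) hz]; exact Nat.zero_le _
  rw [← Multiset.toFinset_card_of_nodup hnd, ← Set.encard_coe_eq_coe_finsetCard]
  congr 1
  ext z
  simp [hp, and_comm]

/-- A `C¹` curve on the unit circle has a `C¹` lift. -/
lemma exists_angle_lift {B : ℝ → ℂ} {ψ' : ℝ → ℝ} (hc : Continuous ψ')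
    (hB : ∀ θ, HasDerivAt B (ψ' θ * I * B θ) θ) (h0 : ‖B 0‖ = 1) :
    ∃ ψ : ℝ → ℝ, (∀ θ, HasDerivAt ψ (ψ' θ) θ) ∧ ∀ θ, B θ = Complex.exp (ψ θ * I) := by
  set ψ : ℝ → ℝ := fun θ => Complex.arg (B 0) + ∫ t in (0 : ℝ)..θ, ψ' t with hψ
  have hd : ∀ θ, HasDerivAt ψ (ψ' θ) θ := fun θ =>
    (intervalIntegral.integral_hasDerivAt_right (hc.intervalIntegrable _ _)
      (hc.stronglyMeasurableAtFilter _ _) hc.continuousAt).const_add _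
  refine ⟨ψ, hd, fun θ => ?_⟩
  have hF : ∀ θ, HasDerivAt (fun θ => B θ * Complex.exp (-(ψ θ * I))) 0 θ := by
    intro θ
    have h1 : HasDerivAt (fun θ : ℝ => -((ψ θ : ℂ) * I)) (-((ψ' θ : ℂ) * I)) θ :=
      ((hd θ).ofReal_comp.mul_const I).neg
    refine ((hB θ).mul h1.cexp).congr_deriv ?_
    ring
  have hconst := is_const_of_deriv_eq_zero (fun θ => (hF θ).differentiableAt)
    (fun θ => (hF θ).deriv) θ 0
  have hψ0 : B 0 = Complex.exp (ψ 0 * I) := by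
    simp only [hψ, intervalIntegral.integral_same, add_zero]
    have := Complex.norm_mul_exp_arg_mul_I (B 0)
    rw [h0] at this
    simpa using this.symm
  simp only [Complex.exp_neg] at hconst
  rw [← hψ0, mul_inv_cancel₀ (by rw [← norm_ne_zero_iff, h0]; exact one_ne_zero)] at hconst
  exact (mul_inv_eq_one₀ (Complex.exp_ne_zero _)).1 hconst

lemma hasDerivAt_trigSum (c : ℕ → ℝ) (m : ℕ) (x : ℕ → ℂ) (θ : ℝ) :
    HasDerivAt (trigSum c m x)
      ((2 * m + 1) / 2 * I * (trigSum c m x θ - trigSum (tiltedCoeff c m) m x θ)) θ := by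
  have h1 : ∀ k ∈ Finset.Icc 1 m, HasDerivAt
      (fun θ : ℝ => (c k : ℂ) * x k * Complex.exp ((k * θ : ℝ) * I))
      ((c k : ℂ) * x k * (Complex.exp ((k * θ : ℝ) * I) * (k * I))) θ := by
    intro k _
    refine HasDerivAt.const_mul _ (HasDerivAt.cexp ?_)
    have := (((hasDerivAt_id θ).const_mul (k : ℝ)).ofReal_comp).mul_const I
    simpa using this
  refine ((HasDerivAt.fun_sum h1).const_add 1).congr_deriv ?_
  symm
  simp only [trigSum, tiltedCoeff, add_sub_add_left_eq_sub]
  rw [← Finset.sum_sub_distrib, Finset.mul_sum]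
  refine Finset.sum_congr rfl fun k _ => ?_
  have : (2 * (m : ℂ) + 1) ≠ 0 := by exact_mod_cast (by omega : 2 * m + 1 ≠ 0)
  push_cast
  field_simp
  ring

lemma continuous_trigSum (c : ℕ → ℝ) (m : ℕ) (x : ℕ → ℂ) : Continuous (trigSum c m x) :=
  continuous_iff_continuousAt.2 fun θ => (hasDerivAt_trigSum c m x θ).continuousAt

/-- The phase of `-e^{inθ} conj(P) / P` moves at speed `n Re (R / P)`, where `n = 2m + 1` and `R` is
the tilted sum. -/
lemma hasDerivAt_phase {c : ℕ → ℝ} {m : ℕ} {x : ℕ → ℂ} (hP : ∀ θ, trigSum c m x θ ≠ 0) (θ : ℝ) :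
    HasDerivAt (fun θ : ℝ => -(Complex.exp (((2 * m + 1) * θ : ℝ) * I) * conj (trigSum c m x θ) /
        trigSum c m x θ))
      ((((2 * m + 1) * (trigSum (tiltedCoeff c m) m x θ / trigSum c m x θ).re : ℝ) : ℂ) * I *
        -(Complex.exp (((2 * m + 1) * θ : ℝ) * I) * conj (trigSum c m x θ) / trigSum c m x θ)) θ := by
  have hd := hasDerivAt_trigSum c m x θ
  set P := trigSum c m x θ with hPdef
  set R := trigSum (tiltedCoeff c m) m x θ
  have hP0 : P ≠ 0 := hP θ
  have hPc : conj P ≠ 0 := by simpa using hP0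
  have hE : HasDerivAt (fun θ : ℝ => Complex.exp (((2 * m + 1) * θ : ℝ) * I))
      (Complex.exp (((2 * m + 1) * θ : ℝ) * I) * ((2 * m + 1) * I)) θ := by
    refine HasDerivAt.cexp ?_
    have := (((hasDerivAt_id θ).const_mul (2 * m + 1 : ℝ)).ofReal_comp).mul_const I
    simpa using this
  have hre : (((R / P).re : ℝ) : ℂ) = (R / P + conj R / conj P) / 2 := by
    rw [← map_div₀, Complex.re_eq_add_conj]
  have hcd : HasDerivAt (fun θ : ℝ => conj (trigSum c m x θ))
      (conj ((2 * m + 1) / 2 * I * (P - R))) θ := hd.star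
  have hmain := ((hE.mul hcd).div hd hP0).neg
  refine hmain.congr_deriv ?_
  symm
  simp only [Pi.mul_apply, ← hPdef]
  rw [Complex.ofReal_mul, hre]
  simp only [map_mul, map_sub, Complex.conj_I, map_div₀, map_add, map_natCast, map_ofNat, map_one]
  push_cast
  field_simp
  ring

lemma exists_Ico_exp_eq {z : ℂ} (hz : ‖z‖ = 1) (τ : ℝ) :
    ∃ θ ∈ Set.Ico 0 (2 * Real.pi), Complex.exp ((θ - τ : ℝ) * I) = z := by
  refine ⟨toIcoMod Real.two_pi_pos 0 (z.arg + τ), ?_, ?_⟩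
  · simpa using toIcoMod_mem_Ico Real.two_pi_pos 0 (z.arg + τ)
  · have h1 : Complex.exp (z.arg * I) = z := by
      have := Complex.norm_mul_exp_arg_mul_I z
      rwa [hz, Complex.ofReal_one, one_mul] at this
    refine Eq.trans ?_ h1
    rw [exp_mul_I_eq_iff]
    refine ⟨-toIcoDiv Real.two_pi_pos 0 (z.arg + τ), ?_⟩
    have h2 := self_sub_toIcoDiv_zsmul Real.two_pi_pos 0 (z.arg + τ)
    rw [zsmul_eq_mul] at h2
    rw [← h2]
    push_cast
    ring

lemma injOn_exp_sub_mul_I (τ : ℝ) :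
    Set.InjOn (fun θ : ℝ => Complex.exp ((θ - τ : ℝ) * I)) (Set.Ico 0 (2 * Real.pi)) := by
  intro θ hθ φ hφ h
  obtain ⟨j, hj⟩ := exp_mul_I_eq_iff.1 h
  have hj' : θ - φ = j * (2 * Real.pi) := by linarith
  have hpi := Real.two_pi_pos
  have h1 : (j : ℝ) < 1 := by
    by_contra hcon
    push Not at hcon
    nlinarith [hθ.2, hφ.1]
  have h2 : (-1 : ℝ) < j := by
    by_contra hcon
    push Not at hcon
    nlinarith [hθ.1, hφ.2]
  have h3 : j = 0 := by
    have : j < 1 := by exact_mod_cast h1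
    have : -1 < j := by exact_mod_cast h2
    omega
  rw [h3] at hj'
  simp at hj'
  linarith

lemma eval_selfInversivePoly_rotateSeq (b : ℝ → ℝ) (x : ℕ → ℂ) (m : ℕ) (u θ : ℝ)
    (hP : trigSum (fun k => b k) m x θ ≠ 0) :
    (selfInversivePoly b (rotateSeq (u / (2 * m + 1)) x) m).eval
        (Complex.exp ((θ - u / (2 * m + 1) : ℝ) * I)) =
      trigSum (fun k => b k) m x θ * (1 - Complex.exp ((-u : ℝ) * I) *
        -(Complex.exp (((2 * m + 1) * θ : ℝ) * I) * conj (trigSum (fun k => b k) m x θ) /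
          trigSum (fun k => b k) m x θ)) := by
  rw [eval_selfInversivePoly, trigSum_rotateSeq, sub_add_cancel]
  have hn : (2 * (m : ℝ) + 1) ≠ 0 := by positivity
  have h1 : ((2 * m + 1) * (θ - u / (2 * m + 1)) : ℝ) = -u + (2 * m + 1) * θ := by
    field_simp; ring
  rw [h1, Complex.ofReal_add, add_mul, Complex.exp_add]
  field_simp
  ring

/-- Averaged over the rotations `x_k ↦ e^{iku/n} x_k`, the number of zeros on the unit circle is the
total variation of the phase of `-e^{inθ} conj(P) / P`: the zeros of the rotated polynomial are the
points where this phase equals `u` modulo `2π`. -/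
theorem lintegral_numUnitCircleZeros_rotateSeq {b : ℝ → ℝ} {x : ℕ → ℂ} {m : ℕ}
    (hP : ∀ θ, trigSum (fun k => b k) m x θ ≠ 0) :
    ∫⁻ u in Set.Ioc 0 (2 * Real.pi),
        (numUnitCircleZeros b (rotateSeq (u / (2 * m + 1)) x) m : ENNReal)
      = ∫⁻ θ in Set.Ico 0 (2 * Real.pi), ENNReal.ofReal |(2 * m + 1) *
          (trigSum (tiltedCoeff (fun k => b k) m) m x θ / trigSum (fun k => b k) m x θ).re| := by
  set P := trigSum (fun k => b k) m x with hPdef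
  set R := trigSum (tiltedCoeff (fun k => b k) m) m x with hRdef
  set B : ℝ → ℂ := fun θ => -(Complex.exp (((2 * m + 1) * θ : ℝ) * I) * conj (P θ) / P θ) with hB
  set ψ' : ℝ → ℝ := fun θ => (2 * m + 1) * (R θ / P θ).re with hψ'
  have hPc : Continuous P := continuous_trigSum _ _ _
  have hRc : Continuous R := continuous_trigSum _ _ _
  have hψ'c : Continuous ψ' :=
    continuous_const.mul (Complex.continuous_re.comp (hRc.div hPc hP))
  have hB1 : ‖B 0‖ = 1 := by
    simp only [hB, norm_neg, norm_div, norm_mul, Complex.norm_exp_ofReal_mul_I, RCLike.norm_conj,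
      one_mul]
    exact div_self (norm_ne_zero_iff.2 (hP 0))
  obtain ⟨ψ, hψ, hBψ⟩ := exists_angle_lift hψ'c (fun θ => hasDerivAt_phase hP θ) hB1
  rw [← lintegral_count_exp_eq hψ hψ'c measurableSet_Ico]
  refine lintegral_congr_ae (ae_restrict_of_ae ?_)
  filter_upwards [ae_regular_value hψ] with u hu
  set τ : ℝ := u / (2 * m + 1) with hτ
  set p := selfInversivePoly b (rotateSeq τ x) m with hp
  have heval : ∀ θ : ℝ, p.eval (Complex.exp ((θ - τ : ℝ) * I))
      = P θ * (1 - Complex.exp ((-u : ℝ) * I) * Complex.exp (ψ θ * I)) := by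
    intro θ
    rw [← hBψ θ]
    exact eval_selfInversivePoly_rotateSeq b x m u θ (hP θ)
  have hroot : ∀ θ : ℝ, p.IsRoot (Complex.exp ((θ - τ : ℝ) * I)) ↔
      Complex.exp (ψ θ * I) = Complex.exp (u * I) := by
    intro θ
    rw [IsRoot.def, heval, mul_eq_zero, or_iff_right (hP θ), sub_eq_zero, Complex.ofReal_neg,
      neg_mul, Complex.exp_neg, eq_comm, inv_mul_eq_iff_eq_mul₀ (Complex.exp_ne_zero _), mul_one]
  have hsimple : ∀ z : ℂ, ‖z‖ = 1 → p.IsRoot z → p.derivative.eval z ≠ 0 := by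
    intro z hz hr h0
    obtain ⟨θ, -, rfl⟩ := exists_Ico_exp_eq hz τ
    have hψu := (hroot θ).1 hr
    -- the derivative of `θ ↦ p (e^{i(θ - τ)})`, computed in two ways
    have hd1 : HasDerivAt (fun θ : ℝ => p.eval (Complex.exp ((θ - τ : ℝ) * I))) 0 θ := by
      have hin : HasDerivAt (fun θ : ℝ => Complex.exp ((θ - τ : ℝ) * I))
          (Complex.exp ((θ - τ : ℝ) * I) * (1 * I)) θ := by
        refine HasDerivAt.cexp ?_
        have := (((hasDerivAt_id θ).sub_const τ).ofReal_comp).mul_const I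
        simpa using this
      have := (p.hasDerivAt (Complex.exp ((θ - τ : ℝ) * I))).comp θ hin
      rw [h0, zero_mul] at this
      exact this
    have hd2 : HasDerivAt (fun θ : ℝ => p.eval (Complex.exp ((θ - τ : ℝ) * I)))
        (-(P θ * (ψ' θ * I))) θ := by
      have hin : HasDerivAt (fun θ : ℝ => Complex.exp (ψ θ * I))
          (Complex.exp (ψ θ * I) * (ψ' θ * I)) θ :=
        HasDerivAt.cexp ((hψ θ).ofReal_comp.mul_const I)
      have h2 := (hasDerivAt_trigSum (fun k => b k) m x θ).mul
        ((hin.const_mul (Complex.exp ((-u : ℝ) * I))).const_sub 1)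
      have hfun : (fun θ : ℝ => p.eval (Complex.exp ((θ - τ : ℝ) * I)))
          = P * fun θ => 1 - Complex.exp ((-u : ℝ) * I) * Complex.exp (ψ θ * I) := by
        funext t; exact heval t
      rw [hfun]
      refine h2.congr_deriv ?_
      have h3 : Complex.exp ((-u : ℝ) * I) * Complex.exp (u * I) = 1 := by
        rw [← Complex.exp_add]; simp
      rw [hψu, ← mul_assoc (Complex.exp ((-u : ℝ) * I)), h3]
      simp only [hPdef]
      ring
    have h4 := hd1.unique hd2
    have h5 : (ψ' θ : ℂ) ≠ 0 := by exact_mod_cast hu θ hψu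
    have h6 := hP θ
    have : P θ * (ψ' θ * I) ≠ 0 := mul_ne_zero h6 (mul_ne_zero h5 Complex.I_ne_zero)
    exact this (by rw [← neg_eq_zero]; exact h4.symm)
  have hcard := card_filter_roots_eq_encard (selfInversivePoly_ne_zero b (rotateSeq τ x) m) hsimple
  have hset : {z : ℂ | ‖z‖ = 1 ∧ p.IsRoot z} = (fun θ : ℝ => Complex.exp ((θ - τ : ℝ) * I)) ''
      {θ ∈ Set.Ico 0 (2 * Real.pi) | Complex.exp (ψ θ * I) = Complex.exp (u * I)} := by
    ext z
    constructor
    · rintro ⟨hz, hr⟩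
      obtain ⟨θ, hθ, rfl⟩ := exists_Ico_exp_eq hz τ
      exact ⟨θ, ⟨hθ, (hroot θ).1 hr⟩, rfl⟩
    · rintro ⟨θ, hθ, rfl⟩
      exact ⟨Complex.norm_exp_ofReal_mul_I _, (hroot θ).2 hθ.2⟩
  have hψcont : Continuous ψ := continuous_iff_continuousAt.2 fun θ => (hψ θ).continuousAt
  have hmeas : MeasurableSet
      {θ ∈ Set.Ico 0 (2 * Real.pi) | Complex.exp (ψ θ * I) = Complex.exp (u * I)} := by
    refine measurableSet_Ico.inter (IsClosed.measurableSet ?_)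
    exact isClosed_eq (by fun_prop) continuous_const
  rw [Measure.count_apply hmeas]
  rw [hset, Set.InjOn.encard_image ((injOn_exp_sub_mul_I τ).mono fun _ h => h.1)] at hcard
  rw [← hcard]
  simp [numUnitCircleZeros]

end CircleCount

/-! ### Measurability of the number of zeros -/

section Measurability

open scoped ComplexConjugate

lemma continuous_eval_selfInversivePoly (b : ℝ → ℝ) (m : ℕ) (t : ℂ) :
    Continuous fun x : ℕ → ℂ => (selfInversivePoly b x m).eval t := by
  simp only [selfInversivePoly, eval_add, eval_one, eval_finsetSum, eval_mul, eval_C, eval_pow,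
    eval_X]
  have : Continuous fun z : ℂ => conj z := Complex.continuous_conj
  fun_prop

lemma monic_selfInversivePoly (b : ℝ → ℝ) (x : ℕ → ℂ) (m : ℕ) :
    (selfInversivePoly b x m).Monic ∧ (selfInversivePoly b x m).natDegree = 2 * m + 1 := by
  have hmem : 1 + ∑ k ∈ Finset.Icc 1 m, C ((b k : ℂ) * x k) * X ^ k
      + ∑ k ∈ Finset.Icc 1 m, C ((b k : ℂ) * conj (x k)) * X ^ (2 * m + 1 - k)
      ∈ degreeLT ℂ (2 * m + 1) := by
    have hX : ∀ (a : ℂ) (j : ℕ), j < 2 * m + 1 → C a * X ^ j ∈ degreeLT ℂ (2 * m + 1) := by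
      intro a j hj
      rw [mem_degreeLT]
      exact (degree_C_mul_X_pow_le j a).trans_lt (by exact_mod_cast hj)
    refine Submodule.add_mem _ (Submodule.add_mem _ ?_ (Submodule.sum_mem _ fun k hk => ?_))
      (Submodule.sum_mem _ fun k hk => ?_)
    · simpa using hX 1 0 (by omega)
    · rw [Finset.mem_Icc] at hk
      exact hX _ _ (by omega)
    · rw [Finset.mem_Icc] at hk
      exact hX _ _ (by omega)
  rw [mem_degreeLT] at hmem
  have e : selfInversivePoly b x m = X ^ (2 * m + 1) +
      (1 + ∑ k ∈ Finset.Icc 1 m, C ((b k : ℂ) * x k) * X ^ k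
      + ∑ k ∈ Finset.Icc 1 m, C ((b k : ℂ) * conj (x k)) * X ^ (2 * m + 1 - k)) := by
    rw [selfInversivePoly, add_comm]
  rw [e]
  refine ⟨monic_X_pow_add hmem, ?_⟩
  rw [natDegree_add_eq_left_of_degree_lt (by rwa [degree_X_pow]), natDegree_X_pow]

lemma numUnitCircleZeros_le (b : ℝ → ℝ) (x : ℕ → ℂ) (m : ℕ) :
    numUnitCircleZeros b x m ≤ 2 * m + 1 := by
  rw [← (monic_selfInversivePoly b x m).2]
  exact (Multiset.card_le_card (Multiset.filter_le _ _)).trans (card_roots' _)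

/-- At least `j` zeros on the unit circle means a factorization with `j` roots of modulus one. -/
lemma le_numUnitCircleZeros_iff (b : ℝ → ℝ) (x : ℕ → ℂ) (m j : ℕ) :
    j ≤ numUnitCircleZeros b x m ↔ ∃ (T : Finset (Fin (2 * m + 1))) (z : Fin (2 * m + 1) → ℂ),
      T.card = j ∧ (∀ i ∈ T, ‖z i‖ = 1) ∧
        ∀ t, (selfInversivePoly b x m).eval t = ∏ i, (t - z i) := by
  classical
  obtain ⟨hmon, hdeg⟩ := monic_selfInversivePoly b x m
  constructor
  · intro hj
    have hcard : (selfInversivePoly b x m).roots.card = 2 * m + 1 := by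
      rw [← hdeg]
      exact (IsAlgClosed.splits _).natDegree_eq_card_roots.symm
    obtain ⟨l, hl⟩ := Quot.exists_rep (selfInversivePoly b x m).roots
    have hl' : (l : Multiset ℂ) = (selfInversivePoly b x m).roots := hl
    have hlen : l.length = 2 * m + 1 := by rw [← hcard, ← hl']; rfl
    set z : Fin (2 * m + 1) → ℂ := fun i => l.get (i.cast hlen.symm) with hz
    have hmap : Multiset.map z Finset.univ.val = (selfInversivePoly b x m).roots := by
      rw [← hl']
      have : List.ofFn z = l := by
        apply List.ext_get
        · simp [hlen]
        · intro i h1 h2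
          simp [hz, -List.ofFn_succ]
      rw [← this]
      simp only [List.ofFn_eq_map, ← Multiset.map_coe]
      rfl
    have hTcard : j ≤ (Finset.univ.filter fun i => ‖z i‖ = 1).card := by
      refine hj.trans (le_of_eq ?_)
      rw [numUnitCircleZeros, ← hmap, Multiset.filter_map, Multiset.card_map]
      rfl
    obtain ⟨T, hT, hTj⟩ := Finset.exists_subset_card_eq hTcard
    refine ⟨T, z, hTj, fun i hi => (Finset.mem_filter.1 (hT hi)).2, fun t => ?_⟩
    have hprod := (IsAlgClosed.splits (selfInversivePoly b x m)).eq_prod_roots_of_monic hmon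
    rw [hprod, ← hmap, Multiset.map_map, eval_multiset_prod, Multiset.map_map]
    simp [Finset.prod]
  · rintro ⟨T, z, hTj, hT, heval⟩
    have hpoly : selfInversivePoly b x m = ∏ i, (X - C (z i)) := by
      refine Polynomial.funext fun t => ?_
      rw [heval, eval_prod]
      simp
    have hroots : (selfInversivePoly b x m).roots = Multiset.map z Finset.univ.val := by
      rw [hpoly, roots_prod _ _ (Finset.prod_ne_zero_iff.2 fun i _ => X_sub_C_ne_zero _)]
      simp
    rw [numUnitCircleZeros, hroots, Multiset.filter_map, Multiset.card_map, ← hTj]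
    exact Finset.card_le_card (fun i hi => Finset.mem_filter.2 ⟨Finset.mem_univ _, hT i hi⟩)

/-- The number of zeros on the unit circle is a measurable function of the coefficients: having at
least `j` of them is a countable union of closed conditions, each the projection of a closed
condition along a compact set of roots. -/
theorem measurable_numUnitCircleZeros (b : ℝ → ℝ) (m : ℕ) :
    Measurable fun x : ℕ → ℂ => numUnitCircleZeros b x m := by
  refine measurable_of_Ici fun j => ?_
  have e : (fun x : ℕ → ℂ => numUnitCircleZeros b x m) ⁻¹' Set.Ici j =
      ⋃ T ∈ {T : Finset (Fin (2 * m + 1)) | T.card = j}, ⋃ r : ℕ, Prod.fst ''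
        {q : (ℕ → ℂ) × Metric.closedBall (0 : Fin (2 * m + 1) → ℂ) r |
          (∀ i ∈ T, ‖(q.2 : Fin (2 * m + 1) → ℂ) i‖ = 1) ∧ ∀ t, (selfInversivePoly b q.1 m).eval t
            = ∏ i, (t - (q.2 : Fin (2 * m + 1) → ℂ) i)} := by
    ext x
    simp only [Set.mem_preimage, Set.mem_Ici, le_numUnitCircleZeros_iff, Set.mem_iUnion,
      Set.mem_image, Set.mem_ofPred_eq, Prod.exists, Subtype.exists, exists_and_right,
      exists_eq_right]
    constructor
    · rintro ⟨T, z, h1, h2, h3⟩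
      obtain ⟨r, hr⟩ := exists_nat_ge ‖z‖
      exact ⟨T, h1, r, z, ⟨by simpa using hr, h2⟩, h3⟩
    · rintro ⟨T, h1, r, z, ⟨-, h2⟩, h3⟩
      exact ⟨T, z, h1, h2, h3⟩
  rw [e]
  refine MeasurableSet.biUnion (Set.to_countable _) fun T _ => MeasurableSet.iUnion fun r => ?_
  refine IsClosed.measurableSet (isClosedMap_fst_of_compactSpace _ ?_)
  have hcoord : ∀ i : Fin (2 * m + 1), Continuous
      fun q : (ℕ → ℂ) × Metric.closedBall (0 : Fin (2 * m + 1) → ℂ) r =>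
        (q.2 : Fin (2 * m + 1) → ℂ) i := fun i =>
    (continuous_apply i).comp (continuous_subtype_val.comp continuous_snd)
  have hset : {q : (ℕ → ℂ) × Metric.closedBall (0 : Fin (2 * m + 1) → ℂ) r |
      (∀ i ∈ T, ‖(q.2 : Fin (2 * m + 1) → ℂ) i‖ = 1) ∧ ∀ t, (selfInversivePoly b q.1 m).eval t
        = ∏ i, (t - (q.2 : Fin (2 * m + 1) → ℂ) i)} =
      (⋂ i ∈ T, {q | ‖(q.2 : Fin (2 * m + 1) → ℂ) i‖ = 1}) ∩
      ⋂ t : ℂ, {q | (selfInversivePoly b q.1 m).eval t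
        = ∏ i, (t - (q.2 : Fin (2 * m + 1) → ℂ) i)} := by
    ext q; simp
  rw [hset]
  refine (isClosed_biInter fun i _ => isClosed_eq (hcoord i).norm continuous_const).inter
    (isClosed_iInter fun t => isClosed_eq ?_ ?_)
  · exact (continuous_eval_selfInversivePoly b m t).comp continuous_fst
  · exact continuous_finsetProd _ fun i _ => continuous_const.sub (hcoord i)

end Measurability

/-! ### Isotropic Gaussian sequences -/

section Isotropic

open Complex (I)

instance (σ : ℝ) : IsProbabilityMeasure (isotropicGaussian σ) := by
  unfold isotropicGaussian
  exact Measure.isProbabilityMeasure_map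
    (Complex.measurableEquivRealProd.symm.measurable.aemeasurable)

lemma isotropicGaussian_eq_map (σ : ℝ) : isotropicGaussian σ =
    ((gaussianReal 0 (σ ^ 2).toNNReal).prod (gaussianReal 0 (σ ^ 2).toNNReal)).map
      Complex.measurableEquivRealProd.symm := rfl

lemma charFun_isotropicGaussian (σ : ℝ) (t : ℂ) :
    charFun (isotropicGaussian σ) t = Complex.exp (-(σ ^ 2 * ‖t‖ ^ 2 / 2 : ℝ)) := by
  rw [charFun_apply, isotropicGaussian_eq_map, integral_map_equiv]
  have h1 : ∀ p : ℝ × ℝ,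
      Complex.exp ((inner ℝ (Complex.measurableEquivRealProd.symm p) t : ℝ) * I)
        = Complex.exp (t.re * p.1 * I) * Complex.exp (t.im * p.2 * I) := by
    intro p
    rw [← Complex.exp_add, Complex.inner]
    congr 1
    simp [Complex.measurableEquivRealProd_symm_apply]
    ring
  simp_rw [h1]
  rw [integral_prod_mul (fun a : ℝ => Complex.exp (t.re * a * I))
    (fun a : ℝ => Complex.exp (t.im * a * I)), ← charFun_apply_real, ← charFun_apply_real,
    charFun_gaussianReal, charFun_gaussianReal, ← Complex.exp_add]
  congr 1
  have : ((Real.toNNReal (σ ^ 2) : NNReal) : ℂ) = ((σ ^ 2 : ℝ) : ℂ) := by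
    rw [← Real.coe_toNNReal (σ ^ 2) (sq_nonneg σ)]; simp
  rw [this, Complex.sq_norm, Complex.normSq_apply]
  push_cast
  ring

lemma isotropicGaussian_absolutelyContinuous {σ : ℝ} (hσ : 0 < σ) :
    isotropicGaussian σ ≪ volume := by
  have hv : (σ ^ 2).toNNReal ≠ 0 := by
    rw [Ne, Real.toNNReal_eq_zero]; push Not; positivity
  have h1 := (gaussianReal_absolutelyContinuous 0 hv).prod (gaussianReal_absolutelyContinuous 0 hv)
  have h2 := h1.map Complex.measurableEquivRealProd.symm.measurable
  rw [isotropicGaussian_eq_map]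
  refine h2.trans ?_
  rw [← Measure.volume_eq_prod,
    (Complex.volume_preserving_equiv_real_prod.symm).map_eq]

lemma isotropicGaussian_map_mul (σ : ℝ) {c : ℂ} (hc : ‖c‖ = 1) :
    (isotropicGaussian σ).map (fun z => c * z) = isotropicGaussian σ := by
  have : IsProbabilityMeasure ((isotropicGaussian σ).map (fun z => c * z)) :=
    Measure.isProbabilityMeasure_map (by fun_prop)
  refine Measure.ext_of_charFun (funext fun t => ?_)
  rw [charFun_apply, integral_map (by fun_prop) (by fun_prop)]
  have h1 : ∀ z : ℂ, inner ℝ (c * z) t = inner ℝ z (star c * t) := by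
    intro z
    simp [Complex.inner]
    ring
  simp_rw [h1]
  rw [← charFun_apply, charFun_isotropicGaussian, charFun_isotropicGaussian, norm_mul, norm_star,
    hc, one_mul]

/-- The law of a sequence of independent isotropic Gaussian variables. -/
noncomputable def gaussianSeq (σ : ℝ) : Measure (ℕ → ℂ) :=
  Measure.infinitePi fun _ => isotropicGaussian σ

instance (σ : ℝ) : IsProbabilityMeasure (gaussianSeq σ) := by
  unfold gaussianSeq; infer_instance

lemma measurePreserving_rotateSeq (σ τ : ℝ) :
    MeasurePreserving (rotateSeq τ) (gaussianSeq σ) (gaussianSeq σ) := by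
  refine ⟨by unfold rotateSeq; fun_prop, ?_⟩
  have h := Measure.infinitePi_map_pi (fun _ : ℕ => isotropicGaussian σ)
    (f := fun k z => Complex.exp ((k * τ : ℝ) * I) * z) (fun k => by fun_prop)
  unfold gaussianSeq
  rw [show rotateSeq τ = fun (x : ℕ → ℂ) (k : ℕ) => Complex.exp ((k * τ : ℝ) * I) * x k from rfl]
  rw [h]
  congr 1
  funext k
  exact isotropicGaussian_map_mul σ (Complex.norm_exp_ofReal_mul_I _)

lemma volume_range_curve_eq_zero {γ : ℝ → ℂ} (hγ : ContDiff ℝ 1 γ) :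
    volume (Set.range γ) = 0 := by
  have h1 : dimH (Set.range γ) < (2 : NNReal) := by
    refine (hγ.dimH_range_le).trans_lt ?_
    rw [Module.finrank_self]
    norm_num
  refine measure_zero_of_dimH_lt (d := 2) ?_ h1
  have h2 : ((2 : NNReal) : ℝ) = (Module.finrank ℝ ℂ : ℝ) := by
    rw [Complex.finrank_real_complex]; norm_num
  rw [h2]
  exact Measure.absolutelyContinuous_isAddHaarMeasure _ _

end Isotropic

/-! ### The mean number of zeros -/

section ExpectedZeros

open Complex (I)

/-- If some coefficient is nonzero, the first half of the polynomial almost surely has no zero on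
the unit circle: given the other variables, a zero would force one `x_k` to lie on a `C¹` curve. -/
lemma ae_trigSum_ne_zero {σ : ℝ} (hσ : 0 < σ) (c : ℕ → ℝ) (m : ℕ) {k₀ : ℕ}
    (hk₀ : k₀ ∈ Finset.Icc 1 m) (hc : c k₀ ≠ 0) :
    ∀ᵐ x ∂(gaussianSeq σ), ∀ θ, trigSum c m x θ ≠ 0 := by
  classical
  set S := (Finset.Icc 1 m).erase k₀ with hS
  -- the trigonometric sum as a function of `x_{k₀}` and of the other variables
  obtain ⟨W, hW⟩ : ∃ W : ((S → ℂ) × ℂ) → ℝ → ℂ, W = fun q θ =>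
    1 + ∑ k : S, (c k : ℂ) * q.1 k * Complex.exp ((k * θ : ℝ) * I)
      + c k₀ * q.2 * Complex.exp ((k₀ * θ : ℝ) * I) := ⟨_, rfl⟩
  have hWeq : ∀ (x : ℕ → ℂ) (θ : ℝ), trigSum c m x θ = W (fun k => x k, x k₀) θ := by
    intro x θ
    simp only [trigSum, hW]
    rw [Finset.sum_coe_sort S (fun k => (c k : ℂ) * x k * Complex.exp ((k * θ : ℝ) * I)),
      add_assoc, hS, Finset.sum_erase_add _ _ hk₀]
  have hWc : Continuous fun q : ((S → ℂ) × ℂ) × ℝ => W q.1 q.2 := by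
    simp only [hW]; fun_prop
  obtain ⟨D, hD⟩ : ∃ D : Set ((S → ℂ) × ℂ), D = ⋃ r : ℕ, Prod.fst ''
    {q : ((S → ℂ) × ℂ) × Set.Icc (-(r : ℝ)) r | W q.1 q.2 = 0} := ⟨_, rfl⟩
  have hDm : MeasurableSet D := by
    rw [hD]
    refine MeasurableSet.iUnion fun r => ?_
    refine IsClosed.measurableSet (isClosedMap_fst_of_compactSpace _ (isClosed_eq ?_ continuous_const))
    exact hWc.comp (continuous_fst.prodMk (continuous_subtype_val.comp continuous_snd))
  have hDmem : ∀ q, q ∈ D ↔ ∃ θ, W q θ = 0 := by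
    intro q
    simp only [hD, Set.mem_iUnion, Set.mem_image, Set.mem_ofPred_eq, Prod.exists, Subtype.exists,
      exists_and_right, exists_eq_right]
    constructor
    · rintro ⟨r, θ, -, h⟩; exact ⟨θ, h⟩
    · rintro ⟨θ, h⟩
      obtain ⟨r, hr⟩ := exists_nat_ge |θ|
      exact ⟨r, θ, abs_le.1 hr, h⟩
  have hind : IndepFun (fun (x : ℕ → ℂ) (k : S) => x k) (fun x : ℕ → ℂ => x k₀)
      (gaussianSeq σ) := by
    have h1 : iIndepFun (fun (i : ℕ) (x : ℕ → ℂ) => x i) (gaussianSeq σ) :=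
      iIndepFun_infinitePi (X := fun _ z => z) (fun _ => measurable_id)
    have h2 := h1.indepFun_finset S {k₀} (by simp [hS]) (fun i => measurable_pi_apply i)
    exact h2.comp measurable_id
      (measurable_pi_apply (⟨k₀, Finset.mem_singleton_self k₀⟩ : ({k₀} : Finset ℕ)))
  have hmapk : (gaussianSeq σ).map (fun x : ℕ → ℂ => x k₀) = isotropicGaussian σ :=
    Measure.infinitePi_map_eval _ k₀
  have hpair := (indepFun_iff_map_prod_eq_prod_map_map
    (measurable_pi_lambda _ fun k : S => measurable_pi_apply (k : ℕ)).aemeasurable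
    (measurable_pi_apply k₀).aemeasurable).1 hind
  rw [hmapk] at hpair
  have hnull : (gaussianSeq σ).map (fun x : ℕ → ℂ => ((fun k : S => x k), x k₀)) D = 0 := by
    rw [hpair, Measure.measure_prod_null hDm]
    refine Eventually.of_forall fun y => ?_
    refine isotropicGaussian_absolutelyContinuous hσ ?_
    set γ : ℝ → ℂ := fun θ => -(c k₀ : ℂ)⁻¹ * (1 + ∑ k : S, (c k : ℂ) * y k *
      Complex.exp ((k * θ : ℝ) * I)) * Complex.exp ((-(k₀ * θ) : ℝ) * I) with hγ
    have hcont : ContDiff ℝ 1 γ := by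
      have hexp : ∀ a : ℝ, ContDiff ℝ 1 fun θ : ℝ => Complex.exp ((a * θ : ℝ) * I) := fun a =>
        ((Complex.ofRealCLM.contDiff.comp (contDiff_const.mul contDiff_id)).mul
          contDiff_const).cexp
      have h1 : ContDiff ℝ 1 fun θ : ℝ => 1 + ∑ k : S, (c k : ℂ) * y k *
          Complex.exp ((k * θ : ℝ) * I) :=
        contDiff_const.add (ContDiff.sum fun k _ => contDiff_const.mul (hexp k))
      have h2 := (contDiff_const (c := -(c k₀ : ℂ)⁻¹)).mul h1
      have h3 := h2.mul (hexp (-k₀))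
      simp only [neg_mul (k₀ : ℝ)] at h3
      exact h3
    refine measure_mono_null ?_ (volume_range_curve_eq_zero hcont)
    intro a ha
    obtain ⟨θ, hθ⟩ := (hDmem (y, a)).1 ha
    refine ⟨θ, ?_⟩
    simp only [hW] at hθ
    have hsum := eq_neg_of_add_eq_zero_left hθ
    have hck : (c k₀ : ℂ) ≠ 0 := by exact_mod_cast hc
    simp only [hγ]
    rw [hsum]
    have hE : Complex.exp ((k₀ * θ : ℝ) * I) * Complex.exp ((-(k₀ * θ) : ℝ) * I) = 1 := by
      rw [← Complex.exp_add]; simp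
    calc _ = (c k₀ : ℂ)⁻¹ * c k₀ * a *
          (Complex.exp ((k₀ * θ : ℝ) * I) * Complex.exp ((-(k₀ * θ) : ℝ) * I)) := by ring
      _ = a := by rw [hE, inv_mul_cancel₀ hck]; ring
  rw [Measure.map_apply (by fun_prop) hDm] at hnull
  filter_upwards [measure_eq_zero_iff_ae_notMem.1 hnull] with x hx θ h0
  refine hx ((hDmem _).2 ⟨θ, ?_⟩)
  rw [← hWeq, h0]

lemma measurable_trigSum (c : ℕ → ℝ) (m : ℕ) :
    Measurable fun q : (ℕ → ℂ) × ℝ => trigSum c m q.1 q.2 := by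
  refine Continuous.measurable ?_
  simp only [trigSum]
  fun_prop

/-- **Expected number of zeros on the circle.** With `P`, `R` the value at `z = 1` of the first half
of the polynomial and of its tilted version, the mean number of zeros is `n E |Re (R / P)|`. Both
averages over rotations, the one in the level `u` and the one in the angle `θ`, are trivial because
the law of the coefficients is invariant under rotations. -/
theorem lintegral_numUnitCircleZeros {σ : ℝ} (hσ : 0 < σ) (b : ℝ → ℝ) (m : ℕ) {k₀ : ℕ}
    (hk₀ : k₀ ∈ Finset.Icc 1 m) (hc : b k₀ ≠ 0) :
    ∫⁻ x, (numUnitCircleZeros b x m : ENNReal) ∂(gaussianSeq σ)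
      = ∫⁻ x, ENNReal.ofReal |(2 * m + 1) * (trigSum (tiltedCoeff (fun k => b k) m) m x 0 /
          trigSum (fun k => b k) m x 0).re| ∂(gaussianSeq σ) := by
  have hν : Measurable fun x : ℕ → ℂ => (numUnitCircleZeros b x m : ENNReal) :=
    (measurable_of_countable (fun k : ℕ => (k : ENNReal))).comp (measurable_numUnitCircleZeros b m)
  obtain ⟨G, hG⟩ : ∃ G : (ℕ → ℂ) → ℝ → ENNReal, G = fun x θ => ENNReal.ofReal |(2 * m + 1) *
    (trigSum (tiltedCoeff (fun k => b k) m) m x θ / trigSum (fun k => b k) m x θ).re| := ⟨_, rfl⟩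
  have hGm : Measurable (Function.uncurry G) := by
    rw [hG]
    refine Measurable.ennreal_ofReal (continuous_abs.measurable.comp (measurable_const.mul
      (Complex.measurable_re.comp ?_)))
    exact (measurable_trigSum _ m).div (measurable_trigSum _ m)
  have hGrot : ∀ θ, ∫⁻ x, G x θ ∂(gaussianSeq σ) = ∫⁻ x, G x 0 ∂(gaussianSeq σ) := by
    intro θ
    have h0 : Measurable fun x => G x 0 := hGm.of_uncurry_right
    rw [← (measurePreserving_rotateSeq σ θ).lintegral_comp h0]
    refine lintegral_congr fun x => ?_
    simp only [hG, trigSum_rotateSeq, zero_add]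
  have hrotm : Measurable fun q : ℝ × (ℕ → ℂ) => rotateSeq (q.1 / (2 * m + 1)) q.2 := by
    unfold rotateSeq
    fun_prop
  have h2pi : volume (Set.Ioc 0 (2 * Real.pi)) = ENNReal.ofReal (2 * Real.pi) := by simp
  have h2pi' : volume (Set.Ico 0 (2 * Real.pi)) = ENNReal.ofReal (2 * Real.pi) := by simp
  have key : ENNReal.ofReal (2 * Real.pi) *
      ∫⁻ x, (numUnitCircleZeros b x m : ENNReal) ∂(gaussianSeq σ)
      = ENNReal.ofReal (2 * Real.pi) * ∫⁻ x, G x 0 ∂(gaussianSeq σ) := by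
    calc _ = ∫⁻ _ in Set.Ioc 0 (2 * Real.pi),
          ∫⁻ x, (numUnitCircleZeros b x m : ENNReal) ∂(gaussianSeq σ) := by
            rw [setLIntegral_const, h2pi, mul_comm]
      _ = ∫⁻ u in Set.Ioc 0 (2 * Real.pi), ∫⁻ x,
          (numUnitCircleZeros b (rotateSeq (u / (2 * m + 1)) x) m : ENNReal) ∂(gaussianSeq σ) :=
            lintegral_congr fun u =>
              ((measurePreserving_rotateSeq σ (u / (2 * m + 1))).lintegral_comp hν).symm
      _ = ∫⁻ x, (∫⁻ u in Set.Ioc 0 (2 * Real.pi),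
          (numUnitCircleZeros b (rotateSeq (u / (2 * m + 1)) x) m : ENNReal)) ∂(gaussianSeq σ) :=
            lintegral_lintegral_swap (f := fun (u : ℝ) (x : ℕ → ℂ) =>
              (numUnitCircleZeros b (rotateSeq (u / (2 * m + 1)) x) m : ENNReal))
              (hν.comp hrotm).aemeasurable
      _ = ∫⁻ x, (∫⁻ θ in Set.Ico 0 (2 * Real.pi), G x θ) ∂(gaussianSeq σ) := by
            refine lintegral_congr_ae ?_
            filter_upwards [ae_trigSum_ne_zero hσ (fun k => b k) m hk₀ hc] with x hx
            rw [lintegral_numUnitCircleZeros_rotateSeq hx, hG]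
      _ = ∫⁻ θ in Set.Ico 0 (2 * Real.pi), ∫⁻ x, G x θ ∂(gaussianSeq σ) :=
            lintegral_lintegral_swap hGm.aemeasurable
      _ = _ := by
            simp_rw [hGrot]
            rw [setLIntegral_const, h2pi', mul_comm]
  rw [hG] at key
  have h0 : ENNReal.ofReal (2 * Real.pi) ≠ 0 := by
    rw [Ne, ENNReal.ofReal_eq_zero, not_le]; exact Real.two_pi_pos
  exact (ENNReal.mul_right_inj h0 ENNReal.ofReal_ne_top).1 key

end ExpectedZeros

/-! ### The joint law of two linear statistics -/

section GaussianPair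

open Complex (I)

/-- Two linear combinations with orthogonal real coefficients of independent isotropic Gaussian
variables are independent isotropic Gaussian variables. -/
lemma gaussianSeq_map_pair (σ : ℝ) (e f : ℕ → ℝ) (m : ℕ)
    (hef : ∑ k ∈ Finset.Icc 1 m, e k * f k = 0) :
    (gaussianSeq σ).map (fun x => (∑ k ∈ Finset.Icc 1 m, (e k : ℂ) * x k,
        ∑ k ∈ Finset.Icc 1 m, (f k : ℂ) * x k)) =
      (isotropicGaussian (σ * √(∑ k ∈ Finset.Icc 1 m, e k ^ 2))).prod
        (isotropicGaussian (σ * √(∑ k ∈ Finset.Icc 1 m, f k ^ 2))) := by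
  have hFm : Measurable (fun x : ℕ → ℂ => (∑ k ∈ Finset.Icc 1 m, (e k : ℂ) * x k,
        ∑ k ∈ Finset.Icc 1 m, (f k : ℂ) * x k)) := by fun_prop
  have : IsProbabilityMeasure ((gaussianSeq σ).map (fun x => (∑ k ∈ Finset.Icc 1 m, (e k : ℂ) * x k,
        ∑ k ∈ Finset.Icc 1 m, (f k : ℂ) * x k))) :=
    Measure.isProbabilityMeasure_map hFm.aemeasurable
  refine charFun_eq_prod_iff.1 fun t => ?_
  rw [Measure.map_map (by fun_prop) hFm]
  set g : ℕ → ℂ → WithLp 2 (ℂ × ℂ) := fun k z => WithLp.toLp 2 ((e k : ℂ) * z, (f k : ℂ) * z)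
    with hg
  have hgm : ∀ k, Measurable (g k) := fun k => by
    simp only [hg]
    fun_prop
  have hsum : (WithLp.toLp 2 ∘ fun x : ℕ → ℂ => (∑ k ∈ Finset.Icc 1 m, (e k : ℂ) * x k,
        ∑ k ∈ Finset.Icc 1 m, (f k : ℂ) * x k)) =
      fun x => ∑ k ∈ Finset.Icc 1 m, (fun (k : ℕ) (x : ℕ → ℂ) => g k (x k)) k x := by
    funext x
    simp only [Function.comp, hg]
    rw [← WithLp.toLp_sum]
    exact congrArg _ (Prod.ext (by simp [Prod.fst_sum]) (by simp [Prod.snd_sum]))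
  have hind : iIndepFun (fun (k : ℕ) (x : ℕ → ℂ) => g k (x k)) (gaussianSeq σ) :=
    iIndepFun_infinitePi hgm
  have hprod := iIndepFun.charFun_map_fun_finsetSum_eq_prod (s := Finset.Icc 1 m)
    (X := fun (k : ℕ) (x : ℕ → ℂ) => g k (x k))
    (fun k _ => ((hgm k).comp (measurable_pi_apply k)).aemeasurable) (hind.restrict _)
  rw [hsum, hprod, Finset.prod_apply]
  have hk : ∀ k ∈ Finset.Icc 1 m, charFun ((gaussianSeq σ).map fun x : ℕ → ℂ => g k (x k)) t
      = Complex.exp (-(σ ^ 2 * ‖e k • t.fst + f k • t.snd‖ ^ 2 / 2 : ℝ)) := by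
    intro k _
    have hmk : (gaussianSeq σ).map (fun x : ℕ → ℂ => g k (x k)) = (isotropicGaussian σ).map (g k) := by
      rw [← Measure.infinitePi_map_eval (fun _ : ℕ => isotropicGaussian σ) k,
        Measure.map_map (hgm k) (measurable_pi_apply k)]
      rfl
    rw [hmk, ← charFun_isotropicGaussian, charFun_apply, charFun_apply,
      integral_map (hgm k).aemeasurable (by fun_prop)]
    congr 1
    funext z
    congr 3
    simp [hg, WithLp.prod_inner_apply, Complex.inner]
    ring
  rw [Finset.prod_congr rfl hk, charFun_isotropicGaussian, charFun_isotropicGaussian,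
    ← Complex.exp_sum, ← Complex.exp_add]
  congr 1
  rw [mul_pow, mul_pow, Real.sq_sqrt (Finset.sum_nonneg fun _ _ => sq_nonneg _),
    Real.sq_sqrt (Finset.sum_nonneg fun _ _ => sq_nonneg _), ← Complex.ofReal_neg,
    ← Complex.ofReal_neg, ← Complex.ofReal_add]
  simp_rw [← Complex.ofReal_neg]
  rw [← Complex.ofReal_sum]
  congr 1
  have hexp : ∀ k, -(σ ^ 2 * ‖e k • t.fst + f k • t.snd‖ ^ 2 / 2)
      = -(σ ^ 2 * ‖t.fst‖ ^ 2 / 2) * e k ^ 2 + (-(σ ^ 2 * ‖t.snd‖ ^ 2 / 2) * f k ^ 2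
        + -(σ ^ 2 * inner ℝ t.fst t.snd) * (e k * f k)) := by
    intro k
    rw [norm_add_sq_real, norm_smul, norm_smul, real_inner_smul_left, real_inner_smul_right,
      mul_pow, mul_pow, Real.norm_eq_abs, Real.norm_eq_abs, sq_abs, sq_abs]
    ring
  simp_rw [hexp]
  rw [Finset.sum_add_distrib, Finset.sum_add_distrib, ← Finset.mul_sum, ← Finset.mul_sum,
    ← Finset.mul_sum, hef]
  simp only [WithLp.ofLp_fst, WithLp.ofLp_snd]
  ring

end GaussianPair

/-! ### The mean of `|Re (R / P)|` for a Gaussian pair -/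

section PolarMean

open Complex (I)
open scoped NNReal ENNReal

/-- `(2πv)^{-1/2} exp (-sin² t / (2v))`. For `g` isotropic Gaussian with variance parameter `v` the
density of `1 + g` at `r e^{it}` is this weight times the density at `r` of a real Gaussian with
mean `cos t` and variance `v`. -/
noncomputable def angleWeight (v : ℝ≥0) (t : ℝ) : ℝ :=
  (√(2 * Real.pi * v))⁻¹ * Real.exp (-(Real.sin t) ^ 2 / (2 * v))

lemma isotropicGaussian_map_re (σ : ℝ) :
    (isotropicGaussian σ).map Complex.re = gaussianReal 0 (σ ^ 2).toNNReal := by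
  rw [isotropicGaussian_eq_map, Measure.map_map Complex.measurable_re
    Complex.measurableEquivRealProd.symm.measurable]
  have : Complex.re ∘ Complex.measurableEquivRealProd.symm = Prod.fst := by
    funext p; simp [Complex.measurableEquivRealProd_symm_apply]
  rw [this, Measure.map_fst_prod, measure_univ, one_smul]

/-- By rotation invariance, `Re (w / p)` is a centred real Gaussian scaled by `1 / |p|`. -/
lemma lintegral_isotropicGaussian_re_div (s A : ℝ) {p : ℂ} (hp : p ≠ 0) :
    ∫⁻ w, ENNReal.ofReal |A + (w / p).re| ∂(isotropicGaussian s)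
      = ∫⁻ z, ENNReal.ofReal |A + z / ‖p‖| ∂(gaussianReal 0 (s ^ 2).toNNReal) := by
  have hp0 : (‖p‖ : ℂ) ≠ 0 := by exact_mod_cast norm_ne_zero_iff.2 hp
  have hu : ‖(‖p‖ : ℂ) / p‖ = 1 := by
    rw [norm_div, Complex.norm_real, norm_norm, div_self (norm_ne_zero_iff.2 hp)]
  have h1 : ∀ w : ℂ, (w / p).re = ((‖p‖ : ℂ) / p * w).re / ‖p‖ := by
    intro w
    have : (‖p‖ : ℂ) / p * w = ((‖p‖ : ℝ) : ℂ) * (w / p) := by ring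
    rw [this, Complex.re_ofReal_mul]
    have : ‖p‖ ≠ 0 := norm_ne_zero_iff.2 hp
    field_simp
  simp_rw [h1]
  have hm1 : Measurable fun z : ℝ => ENNReal.ofReal |A + z / ‖p‖| := by fun_prop
  have hm2 : Measurable fun w : ℂ => ENNReal.ofReal |A + w.re / ‖p‖| :=
    hm1.comp Complex.measurable_re
  rw [← lintegral_map (f := fun w : ℂ => ENNReal.ofReal |A + w.re / ‖p‖|) hm2 (by fun_prop),
    isotropicGaussian_map_mul s hu, ← isotropicGaussian_map_re,
    lintegral_map hm1 Complex.measurable_re]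

lemma gaussianPDFReal_mul_polar {v : ℝ≥0} (hv : v ≠ 0) (r t : ℝ) :
    gaussianPDFReal 0 v (r * Real.cos t - 1) * gaussianPDFReal 0 v (r * Real.sin t)
      = angleWeight v t * gaussianPDFReal (Real.cos t) v r := by
  have hv' : (v : ℝ) ≠ 0 := by exact_mod_cast hv
  simp only [gaussianPDFReal, angleWeight]
  have key : Real.exp (-(r * Real.cos t - 1 - 0) ^ 2 / (2 * v)) *
      Real.exp (-(r * Real.sin t - 0) ^ 2 / (2 * v)) =
      Real.exp (-Real.sin t ^ 2 / (2 * v)) * Real.exp (-(r - Real.cos t) ^ 2 / (2 * v)) := by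
    rw [← Real.exp_add, ← Real.exp_add]
    congr 1
    have h := Real.sin_sq_add_cos_sq t
    field_simp
    linear_combination (-(r ^ 2) + 1) * h
  linear_combination ((√(2 * Real.pi * ↑v))⁻¹ * (√(2 * Real.pi * ↑v))⁻¹) * key

/-- Polar coordinates for a Gaussian centred at `1`. -/
lemma lintegral_isotropicGaussian_polar {a : ℝ} (ha : a ≠ 0) {f : ℂ → ℝ≥0∞} (hf : Measurable f) :
    ∫⁻ g, f (1 + g) ∂(isotropicGaussian a) =
      ∫⁻ q in Set.Ioi (0 : ℝ) ×ˢ Set.Ioo (-Real.pi) Real.pi, ENNReal.ofReal q.1 *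
        f (q.1 * (Real.cos q.2 + Real.sin q.2 * I)) *
          (ENNReal.ofReal (angleWeight (a ^ 2).toNNReal q.2) *
            gaussianPDF (Real.cos q.2) (a ^ 2).toNNReal q.1) := by
  have hv : (a ^ 2).toNNReal ≠ 0 := by
    rw [Ne, Real.toNNReal_eq_zero]; push Not; positivity
  set v := (a ^ 2).toNNReal
  set F : ℝ × ℝ → ℝ≥0∞ := fun z =>
    f (z.1 + z.2 * I) * (gaussianPDF 0 v (z.1 - 1) * gaussianPDF 0 v z.2) with hF
  have hfm : Measurable fun z : ℝ × ℝ => f (z.1 + z.2 * I) := hf.comp (by fun_prop)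
  have h1 : ∫⁻ g, f (1 + g) ∂(isotropicGaussian a) = ∫⁻ z, F z := by
    rw [isotropicGaussian_eq_map, lintegral_map (f := fun g => f (1 + g)) (hf.comp (by fun_prop))
      Complex.measurableEquivRealProd.symm.measurable, gaussianReal_of_var_ne_zero _ hv,
      prod_withDensity (measurable_gaussianPDF _ _) (measurable_gaussianPDF _ _),
      lintegral_withDensity_eq_lintegral_mul]
    · rw [← Measure.volume_eq_prod, ← lintegral_add_right_eq_self F (1, 0)]
      refine lintegral_congr fun z => ?_
      simp only [hF, Pi.mul_apply, Prod.fst_add, Prod.snd_add, add_zero, add_sub_cancel_right]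
      rw [mul_comm]
      congr 2
      rw [Complex.measurableEquivRealProd_symm_apply]
      apply Complex.ext <;> simp
      ring
    · exact ((measurable_gaussianPDF _ _).comp measurable_fst).mul
        ((measurable_gaussianPDF _ _).comp measurable_snd)
    · exact (hf.comp (by fun_prop : Measurable fun g : ℂ => 1 + g)).comp
        Complex.measurableEquivRealProd.symm.measurable
  rw [h1, ← lintegral_comp_polarCoord_symm, polarCoord_target]
  refine setLIntegral_congr_fun (measurableSet_Ioi.prod measurableSet_Ioo) fun q _ => ?_
  simp only [hF, smul_eq_mul, polarCoord_symm_apply]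
  rw [mul_assoc]
  congr 2
  · congr 1; push_cast; ring
  · simp only [gaussianPDF]
    rw [← ENNReal.ofReal_mul (gaussianPDFReal_nonneg _ _ _), gaussianPDFReal_mul_polar hv,
      ENNReal.ofReal_mul (by unfold angleWeight; positivity)]

/-- With `r` and `z` independent, `κ r + (1 - κ) μ + z` is Gaussian with the mean `μ` of `r`. -/
lemma lintegral_lintegral_abs_add (κ μ : ℝ) (v u : ℝ≥0) :
    ∫⁻ r, ∫⁻ z, ENNReal.ofReal |κ * r + (1 - κ) * μ + z| ∂(gaussianReal 0 u) ∂(gaussianReal μ v)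
      = ∫⁻ z, ENNReal.ofReal |z| ∂(gaussianReal μ ((κ ^ 2).toNNReal * v + u)) := by
  have hlaw : (gaussianReal μ v).map (fun r => κ * r + (1 - κ) * μ)
      = gaussianReal μ ((κ ^ 2).toNNReal * v) := by
    have h1 := gaussianReal_map_const_mul (μ := μ) (v := v) κ
    have h2 := gaussianReal_map_add_const (μ := κ * μ) (v := (κ ^ 2).toNNReal * v) ((1 - κ) * μ)
    have h3 : NNReal.mk (κ ^ 2) (sq_nonneg κ) = (κ ^ 2).toNNReal :=
      (Real.toNNReal_of_nonneg (sq_nonneg κ)).symm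
    rw [h3] at h1
    rw [← h1, Measure.map_map (by fun_prop) (by fun_prop),
      show κ * μ + (1 - κ) * μ = μ by ring] at h2
    exact h2
  have hm : Measurable fun z : ℝ => ENNReal.ofReal |z| := by fun_prop
  have hm2 : Measurable fun y : ℝ => ∫⁻ z, ENNReal.ofReal |y + z| ∂(gaussianReal 0 u) :=
    Measurable.lintegral_prod_right' (f := fun q : ℝ × ℝ => ENNReal.ofReal |q.1 + q.2|)
      (by fun_prop)
  rw [← lintegral_map (f := fun y : ℝ => ∫⁻ z, ENNReal.ofReal |y + z| ∂(gaussianReal 0 u)) hm2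
    (by fun_prop), hlaw, ← Measure.lintegral_conv hm, gaussianReal_conv_gaussianReal, add_zero]

lemma lintegral_abs_affine_neg (A : ℝ) (u : ℝ≥0) :
    ∫⁻ z, ENNReal.ofReal |-A + z| ∂(gaussianReal 0 u)
      = ∫⁻ z, ENNReal.ofReal |A + z| ∂(gaussianReal 0 u) := by
  have h : (gaussianReal 0 u).map (fun z => -z) = gaussianReal 0 u := by
    simpa using gaussianReal_map_neg (μ := 0) (v := u)
  nth_rw 1 [← h]
  rw [lintegral_map (by fun_prop) (by fun_prop)]
  refine lintegral_congr fun z => ?_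
  rw [← neg_add, abs_neg]

/-- Over a full turn, twice the integral of a `2π`-periodic function is the integral of its sum with
the antipodal values. -/
lemma lintegral_add_half_turn (J : ℝ → ℝ≥0∞) (hJ : Measurable J)
    (hper : Function.Periodic J (2 * Real.pi)) :
    2 * ∫⁻ t in Set.Ioc (-Real.pi) Real.pi, J t
      = ∫⁻ t in Set.Ioc (-Real.pi) Real.pi, (J t + J (t + Real.pi)) := by
  rw [lintegral_add_left hJ, two_mul]
  congr 1
  have h1 : ∫⁻ t in Set.Ioc (-Real.pi) Real.pi, J (t + Real.pi)
      = ∫⁻ t in Set.Ioc 0 (2 * Real.pi), J t := by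
    have hmp := measurePreserving_add_right (volume : Measure ℝ) Real.pi
    have hset : Set.Ioc (-Real.pi) Real.pi
        = (fun t => t + Real.pi) ⁻¹' Set.Ioc 0 (2 * Real.pi) := by
      ext t
      simp only [Set.mem_Ioc, Set.mem_preimage]
      constructor <;> rintro ⟨h1, h2⟩ <;> constructor <;> linarith
    rw [hset, hmp.setLIntegral_comp_preimage measurableSet_Ioc hJ]
  rw [h1]
  have hf1 := isAddFundamentalDomain_Ioc Real.two_pi_pos (-Real.pi) volume
  have hf2 := isAddFundamentalDomain_Ioc Real.two_pi_pos 0 volume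
  rw [show -Real.pi + 2 * Real.pi = Real.pi by ring] at hf1
  rw [zero_add] at hf2
  refine hf1.setLIntegral_eq hf2 J ?_
  rintro ⟨g, hg⟩ x
  obtain ⟨j, hj⟩ := AddSubgroup.mem_zmultiples_iff.1 hg
  change J (g + x) = J x
  rw [← hj, add_comm]
  exact hper.zsmul j x

/-- `2 E |Re (R / P)|` with `P = 1 + g` and `R = 1 + κ g + w` is an average over the angle of
absolute means of real Gaussians. In polar coordinates the Jacobian `r` cancels the denominator of
`R / P`, and `t` and `t + π` together let the radius run over the whole line, so that the radial integral is a
Gaussian mean. -/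
theorem two_mul_lintegral_abs_re_div {a : ℝ} (ha : a ≠ 0) (κ s : ℝ) :
    2 * ∫⁻ g, (∫⁻ w, ENNReal.ofReal |((1 + κ * g + w) / (1 + g)).re| ∂(isotropicGaussian s))
        ∂(isotropicGaussian a) =
      ∫⁻ t in Set.Ioc (-Real.pi) Real.pi, ENNReal.ofReal (angleWeight (a ^ 2).toNNReal t) *
        ∫⁻ z, ENNReal.ofReal |z| ∂(gaussianReal (Real.cos t)
          ((κ ^ 2).toNNReal * (a ^ 2).toNNReal + (s ^ 2).toNNReal)) := by
  have hv : (a ^ 2).toNNReal ≠ 0 := by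
    rw [Ne, Real.toNNReal_eq_zero]; push Not; positivity
  obtain ⟨v, hvdef⟩ : ∃ v, v = (a ^ 2).toNNReal := ⟨_, rfl⟩
  obtain ⟨u, hudef⟩ : ∃ u, u = (s ^ 2).toNNReal := ⟨_, rfl⟩
  obtain ⟨H, hH⟩ : ∃ H : ℝ → ℝ → ℝ≥0∞, H = fun r t =>
    ∫⁻ z, ENNReal.ofReal |κ * r + (1 - κ) * Real.cos t + z| ∂(gaussianReal 0 u) := ⟨_, rfl⟩
  have hHm : Measurable fun q : ℝ × ℝ => H q.1 q.2 := by
    rw [hH]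
    exact Measurable.lintegral_prod_right' (f := fun q : (ℝ × ℝ) × ℝ =>
      ENNReal.ofReal |κ * q.1.1 + (1 - κ) * Real.cos q.1.2 + q.2|) (by fun_prop)
  obtain ⟨f, hf⟩ : ∃ f : ℂ → ℝ≥0∞, f = fun p =>
    ∫⁻ w, ENNReal.ofReal |((1 + κ * (p - 1) + w) / p).re| ∂(isotropicGaussian s) := ⟨_, rfl⟩
  have hfm : Measurable f := by
    rw [hf]
    refine Measurable.lintegral_prod_right' (f := fun q : ℂ × ℂ =>
      ENNReal.ofReal |((1 + κ * (q.1 - 1) + q.2) / q.1).re|) ?_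
    fun_prop
  have hfg : ∀ g : ℂ, ∫⁻ w, ENNReal.ofReal |((1 + κ * g + w) / (1 + g)).re| ∂(isotropicGaussian s)
      = f (1 + g) := by
    intro g
    rw [hf]
    simp only [add_sub_cancel_left]
  have hradial : ∀ r t : ℝ, 0 < r → ENNReal.ofReal r * f (r * (Real.cos t + Real.sin t * I))
      = H r t := by
    intro r t hr
    set p : ℂ := r * (Real.cos t + Real.sin t * I) with hp
    have hpe : p = r * Complex.exp (t * I) := by
      rw [hp, Complex.exp_mul_I, Complex.ofReal_cos, Complex.ofReal_sin]
    have hpn : ‖p‖ = r := by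
      rw [hpe, norm_mul, Complex.norm_exp_ofReal_mul_I, mul_one, Complex.norm_real,
        Real.norm_eq_abs, abs_of_pos hr]
    have hp0 : p ≠ 0 := by rw [← norm_ne_zero_iff, hpn]; exact hr.ne'
    have hinv : (p⁻¹).re = Real.cos t / r := by
      rw [Complex.inv_re, Complex.normSq_eq_norm_sq, hpn]
      have : p.re = r * Real.cos t := by
        rw [hpe, Complex.re_ofReal_mul, Complex.exp_ofReal_mul_I_re]
      rw [this]; field_simp
    have hre : ∀ w : ℂ, ((1 + κ * (p - 1) + w) / p).re
        = (κ + (1 - κ) * (Real.cos t / r)) + (w / p).re := by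
      intro w
      have : (1 + κ * (p - 1) + w) / p = (κ : ℝ) + ((1 - κ : ℝ) : ℂ) * p⁻¹ + w / p := by
        push_cast; field_simp; ring
      rw [this, Complex.add_re, Complex.add_re, Complex.re_ofReal_mul, hinv, Complex.ofReal_re]
    rw [hf]
    simp only [hre]
    rw [lintegral_isotropicGaussian_re_div s _ hp0, hpn, ← hudef,
      ← lintegral_const_mul _ (by fun_prop), hH]
    refine lintegral_congr fun z => ?_
    rw [← ENNReal.ofReal_mul hr.le]
    congr 1
    nth_rw 1 [← abs_of_pos hr]
    rw [← abs_mul]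
    congr 1
    field_simp
  obtain ⟨J, hJ⟩ : ∃ J : ℝ → ℝ≥0∞, J = fun t => ENNReal.ofReal (angleWeight v t) *
    ∫⁻ r in Set.Ioi 0, H r t * gaussianPDF (Real.cos t) v r := ⟨_, rfl⟩
  have hpdf : Measurable fun q : ℝ × ℝ => gaussianPDF (Real.cos q.2) v q.1 := by
    simp only [gaussianPDF, gaussianPDFReal]
    fun_prop
  have hKm : Measurable fun t => ENNReal.ofReal (angleWeight v t) := by
    simp only [angleWeight]
    fun_prop
  have hHp : Measurable fun q : ℝ × ℝ => H q.1 q.2 * gaussianPDF (Real.cos q.2) v q.1 :=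
    hHm.mul hpdf
  have hHt : ∀ t, Measurable fun r => H r t * gaussianPDF (Real.cos t) v r := fun t =>
    Measurable.of_uncurry_right (f := fun r t => H r t * gaussianPDF (Real.cos t) v r) hHp
  have hJm : Measurable J := by
    rw [hJ]
    exact hKm.mul (Measurable.lintegral_prod_left' (f := fun q : ℝ × ℝ =>
      H q.1 q.2 * gaussianPDF (Real.cos q.2) v q.1) hHp)
  have hJper : Function.Periodic J (2 * Real.pi) := by
    intro t
    rw [hJ]
    simp only [hH, angleWeight, Real.cos_add_two_pi, Real.sin_add_two_pi]
  have hE : ∫⁻ g, (∫⁻ w, ENNReal.ofReal |((1 + κ * g + w) / (1 + g)).re| ∂(isotropicGaussian s))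
        ∂(isotropicGaussian a) = ∫⁻ t in Set.Ioc (-Real.pi) Real.pi, J t := by
    simp_rw [hfg]
    rw [lintegral_isotropicGaussian_polar ha hfm, ← hvdef]
    have h1 : ∫⁻ q in Set.Ioi (0 : ℝ) ×ˢ Set.Ioo (-Real.pi) Real.pi, ENNReal.ofReal q.1 *
        f (q.1 * (Real.cos q.2 + Real.sin q.2 * I)) * (ENNReal.ofReal (angleWeight v q.2) *
            gaussianPDF (Real.cos q.2) v q.1)
        = ∫⁻ q in Set.Ioi (0 : ℝ) ×ˢ Set.Ioo (-Real.pi) Real.pi,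
          ENNReal.ofReal (angleWeight v q.2) * (H q.1 q.2 * gaussianPDF (Real.cos q.2) v q.1) := by
      refine setLIntegral_congr_fun (measurableSet_Ioi.prod measurableSet_Ioo) fun q hq => ?_
      rw [hradial q.1 q.2 hq.1]
      ring
    have hm : Measurable fun q : ℝ × ℝ =>
        ENNReal.ofReal (angleWeight v q.2) * (H q.1 q.2 * gaussianPDF (Real.cos q.2) v q.1) :=
      (hKm.comp measurable_snd).mul hHp
    rw [h1, Measure.volume_eq_prod, ← Measure.prod_restrict, lintegral_prod_symm' _ hm,
      ← restrict_Ioo_eq_restrict_Ioc]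
    refine lintegral_congr fun t => ?_
    rw [hJ]
    exact lintegral_const_mul (ENNReal.ofReal (angleWeight v t)) (hHt t)
  -- the antipodal angle supplies the negative radii
  rw [hE, lintegral_add_half_turn J hJm hJper]
  refine lintegral_congr fun t => ?_
  have hhalf : J (t + Real.pi) = ENNReal.ofReal (angleWeight v t) *
      ∫⁻ r in Set.Iic 0, H r t * gaussianPDF (Real.cos t) v r := by
    have hK : angleWeight v (t + Real.pi) = angleWeight v t := by
      simp [angleWeight, Real.sin_add_pi]
    rw [hJ]
    simp only [hK, Real.cos_add_pi]
    congr 1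
    rw [setLIntegral_congr Iio_ae_eq_Iic.symm]
    have hset : Set.Ioi (0 : ℝ) = (fun r => -r) ⁻¹' Set.Iio 0 := by ext r; simp
    rw [← (Measure.measurePreserving_neg (volume : Measure ℝ)).setLIntegral_comp_preimage
      measurableSet_Iio (hHt t), ← hset]
    refine lintegral_congr fun r => ?_
    congr 1
    · rw [hH]
      simp only [Real.cos_add_pi]
      rw [← lintegral_abs_affine_neg]
      refine lintegral_congr fun z => ?_
      congr 2; ring
    · simp only [gaussianPDF, gaussianPDFReal]
      congr 4; ring
  rw [hhalf, ← hvdef, ← hudef]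
  rw [hJ]
  simp only
  rw [← mul_add, ← Set.compl_Ioi, lintegral_add_compl _ measurableSet_Ioi]
  congr 1
  rw [← lintegral_lintegral_abs_add, gaussianReal_of_var_ne_zero _ (hvdef ▸ hv),
    lintegral_withDensity_eq_lintegral_mul _ (measurable_gaussianPDF _ _)]
  · refine lintegral_congr fun r => ?_
    rw [hH, Pi.mul_apply, mul_comm]
  · exact Measurable.lintegral_prod_right' (f := fun q : ℝ × ℝ =>
      ENNReal.ofReal |κ * q.1 + (1 - κ) * Real.cos t + q.2|) (by fun_prop)

/-- The mean of `|Re (R / P)|` for two linear combinations `P`, `R` with mean one of independent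
isotropic Gaussian variables. It depends on the coefficients only through the variances of `P` and
`R`. -/
theorem two_mul_lintegral_abs_re_trigSum_div {σ : ℝ} (hσ : 0 < σ) (c d : ℕ → ℝ) (m : ℕ)
    (hc : 0 < ∑ k ∈ Finset.Icc 1 m, c k ^ 2) :
    2 * ∫⁻ x, ENNReal.ofReal |(trigSum d m x 0 / trigSum c m x 0).re| ∂(gaussianSeq σ) =
      ∫⁻ t in Set.Ioc (-Real.pi) Real.pi,
        ENNReal.ofReal (angleWeight (σ ^ 2 * ∑ k ∈ Finset.Icc 1 m, c k ^ 2).toNNReal t) *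
        ∫⁻ z, ENNReal.ofReal |z| ∂(gaussianReal (Real.cos t)
          (σ ^ 2 * ∑ k ∈ Finset.Icc 1 m, d k ^ 2).toNNReal) := by
  obtain ⟨V, hV⟩ : ∃ V, V = ∑ k ∈ Finset.Icc 1 m, c k ^ 2 := ⟨_, rfl⟩
  rw [← hV] at hc
  -- `κ` makes `d - κ c` orthogonal to `c`
  set κ : ℝ := (∑ k ∈ Finset.Icc 1 m, c k * d k) / V with hκ
  set f : ℕ → ℝ := fun k => d k - κ * c k with hf
  have hκV : κ * V = ∑ k ∈ Finset.Icc 1 m, c k * d k := by rw [hκ]; field_simp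
  have horth : ∑ k ∈ Finset.Icc 1 m, c k * f k = 0 := by
    have : ∀ k, c k * f k = c k * d k - κ * c k ^ 2 := fun k => by simp only [hf]; ring
    simp_rw [this]
    rw [Finset.sum_sub_distrib, ← Finset.mul_sum, ← hV, hκV, sub_self]
  have hpyth : κ ^ 2 * V + ∑ k ∈ Finset.Icc 1 m, f k ^ 2 = ∑ k ∈ Finset.Icc 1 m, d k ^ 2 := by
    have : ∀ k, f k ^ 2 = d k ^ 2 - 2 * κ * (c k * d k) + κ ^ 2 * c k ^ 2 := fun k => by
      simp only [hf]; ring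
    simp_rw [this]
    rw [Finset.sum_add_distrib, Finset.sum_sub_distrib, ← Finset.mul_sum, ← Finset.mul_sum, ← hV,
      ← hκV]
    ring
  have hlaw := gaussianSeq_map_pair σ c f m horth
  rw [← hV] at hlaw
  set F2 := ∑ k ∈ Finset.Icc 1 m, f k ^ 2 with hF2
  have hF2n : 0 ≤ F2 := Finset.sum_nonneg fun _ _ => sq_nonneg _
  have hP : ∀ x, trigSum c m x 0 = 1 + ∑ k ∈ Finset.Icc 1 m, (c k : ℂ) * x k := by
    intro x; simp [trigSum]
  have hR : ∀ x, trigSum d m x 0 = 1 + κ * (∑ k ∈ Finset.Icc 1 m, (c k : ℂ) * x k)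
      + ∑ k ∈ Finset.Icc 1 m, (f k : ℂ) * x k := by
    intro x
    simp only [trigSum, hf, mul_zero, Complex.ofReal_zero, zero_mul, Complex.exp_zero, mul_one]
    rw [add_assoc, Finset.mul_sum, ← Finset.sum_add_distrib]
    congr 1
    refine Finset.sum_congr rfl fun k _ => ?_
    push_cast; ring
  have hint : ∫⁻ x, ENNReal.ofReal |(trigSum d m x 0 / trigSum c m x 0).re| ∂(gaussianSeq σ)
      = ∫⁻ g, (∫⁻ w, ENNReal.ofReal |((1 + κ * g + w) / (1 + g)).re|
          ∂(isotropicGaussian (σ * √F2))) ∂(isotropicGaussian (σ * √V)) := by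
    have hm : Measurable fun q : ℂ × ℂ =>
        ENNReal.ofReal |((1 + κ * q.1 + q.2) / (1 + q.1)).re| := by fun_prop
    have hFm : Measurable (fun x : ℕ → ℂ => (∑ k ∈ Finset.Icc 1 m, (c k : ℂ) * x k,
        ∑ k ∈ Finset.Icc 1 m, (f k : ℂ) * x k)) := by fun_prop
    rw [← lintegral_prod _ hm.aemeasurable, ← hlaw, lintegral_map hm hFm]
    refine lintegral_congr fun x => ?_
    rw [hP, hR]
  have hsq1 : (σ * √V) ^ 2 = σ ^ 2 * V := by rw [mul_pow, Real.sq_sqrt hc.le]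
  have hsq2 : (σ * √F2) ^ 2 = σ ^ 2 * F2 := by rw [mul_pow, Real.sq_sqrt hF2n]
  have ha : σ * √V ≠ 0 := by positivity
  rw [hint, two_mul_lintegral_abs_re_div ha, hsq1, hsq2]
  have hvar : (κ ^ 2).toNNReal * (σ ^ 2 * V).toNNReal + (σ ^ 2 * F2).toNNReal
      = (σ ^ 2 * ∑ k ∈ Finset.Icc 1 m, d k ^ 2).toNNReal := by
    rw [← hpyth]
    apply NNReal.eq
    rw [NNReal.coe_add, NNReal.coe_mul, Real.coe_toNNReal _ (by positivity),
      Real.coe_toNNReal _ (by positivity), Real.coe_toNNReal _ (by positivity),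
      Real.coe_toNNReal _ (by positivity)]
    ring
  rw [hvar, hV]

end PolarMean

/-! ### Comparison of absolute means of Gaussians of different variance -/

section AbsMean

open scoped NNReal ENNReal

/-- `E |s + b Z|` for a standard Gaussian variable `Z`. -/
noncomputable def absMean (b s : ℝ) : ℝ := ∫ z, |s + b * z| ∂(gaussianReal 0 1)

lemma integrable_id_stdGaussian : Integrable (fun z : ℝ => z) (gaussianReal 0 1) :=
  (memLp_id_gaussianReal 1).integrable (by norm_num)

lemma integrable_abs_affine (b s : ℝ) : Integrable (fun z : ℝ => |s + b * z|) (gaussianReal 0 1) :=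
  ((integrable_const s).add (integrable_id_stdGaussian.const_mul b)).abs

lemma setIntegral_Ioi_id_stdGaussian (c : ℝ) :
    ∫ z in Set.Ioi c, z ∂(gaussianReal 0 1) = gaussianPDFReal 0 1 c := by
  have hd : ∀ x : ℝ, HasDerivAt (fun x => -gaussianPDFReal 0 1 x) (gaussianPDFReal 0 1 x * x) x := by
    intro x
    simp only [gaussianPDFReal]
    have h1 : HasDerivAt (fun x : ℝ => -(x - 0) ^ 2 / (2 * ((1 : ℝ≥0) : ℝ))) (-x) x := by
      have := (((hasDerivAt_id x).sub_const 0).pow 2).neg.div_const (2 * ((1 : ℝ≥0) : ℝ))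
      refine this.congr_deriv ?_
      simp
      ring
    exact ((h1.exp.const_mul _).neg).congr_deriv (by ring)
  have hint : Integrable (fun z : ℝ => gaussianPDFReal 0 1 z * z) := by
    have h := integrable_id_stdGaussian
    rw [gaussianReal_of_var_ne_zero _ one_ne_zero, integrable_withDensity_iff
      (measurable_gaussianPDF _ _) (ae_of_all _ fun _ => ENNReal.ofReal_lt_top)] at h
    refine h.congr (ae_of_all _ fun z => ?_)
    simp only [gaussianPDF, ENNReal.toReal_ofReal (gaussianPDFReal_nonneg 0 1 z)]
    ring
  have hlim : Tendsto (fun x => -gaussianPDFReal 0 1 x) atTop (𝓝 0) := by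
    suffices Tendsto (gaussianPDFReal 0 1) atTop (𝓝 0) by simpa using this.neg
    have hpdf : gaussianPDFReal 0 1 = fun x => (√(2 * Real.pi * ((1 : ℝ≥0) : ℝ)))⁻¹ *
        Real.exp (-(x - 0) ^ 2 / (2 * ((1 : ℝ≥0) : ℝ))) := by
      funext x; simp only [gaussianPDFReal]
    rw [hpdf, ← mul_zero ((√(2 * Real.pi * ((1 : ℝ≥0) : ℝ)))⁻¹)]
    refine Tendsto.const_mul _ (Real.tendsto_exp_atBot.comp ?_)
    have h2 : Tendsto (fun x : ℝ => x ^ 2 / 2) atTop atTop :=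
      (tendsto_pow_atTop (by norm_num)).atTop_div_const (by norm_num)
    have h3 := tendsto_neg_atTop_atBot.comp h2
    refine h3.congr fun x => ?_
    simp [neg_div]
  have h := integral_Ioi_of_hasDerivAt_of_tendsto (a := c)
    (hd c).continuousAt.continuousWithinAt (fun x _ => hd x) hint.integrableOn hlim
  rw [zero_sub, neg_neg] at h
  rw [← h, ← integral_indicator measurableSet_Ioi, integral_gaussianReal_eq_integral_smul one_ne_zero,
    ← integral_indicator measurableSet_Ioi]
  congr 1
  funext z
  by_cases hz : z ∈ Set.Ioi c <;> simp [hz]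

/-- The derivative of `b ↦ E |s + b Z|` at `a > 0` is `2 φ(s / a)`. -/
lemma integral_id_mul_sign_affine {a : ℝ} (ha : 0 < a) (s : ℝ) :
    ∫ z, z * (if 0 < s + a * z then 1 else -1) ∂(gaussianReal 0 1)
      = 2 * gaussianPDFReal 0 1 (s / a) := by
  have h1 : ∀ z : ℝ, z * (if 0 < s + a * z then 1 else -1)
      = 2 * (Set.Ioi (-(s / a))).indicator (fun z => z) z - z := by
    intro z
    have hiff : 0 < s + a * z ↔ z ∈ Set.Ioi (-(s / a)) := by
      rw [Set.mem_Ioi, neg_lt_iff_pos_add, show z + s / a = (s + a * z) / a by field_simp; ring]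
      exact (div_pos_iff_of_pos_right ha).symm
    by_cases hz : 0 < s + a * z
    · rw [if_pos hz, Set.indicator_of_mem (hiff.1 hz)]; ring
    · rw [if_neg hz, Set.indicator_of_notMem (fun h => hz (hiff.2 h))]; ring
  simp_rw [h1]
  rw [integral_sub ((integrable_id_stdGaussian.indicator measurableSet_Ioi).const_mul 2)
    integrable_id_stdGaussian, integral_const_mul, integral_indicator measurableSet_Ioi,
    setIntegral_Ioi_id_stdGaussian, integral_id_gaussianReal, sub_zero]
  simp [gaussianPDFReal]

/-- `b ↦ E |s + b Z|` lies above its tangent at `a`, as it is convex. -/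
lemma absMean_tangent_le {a : ℝ} (ha : 0 < a) (b s : ℝ) :
    (b - a) * (2 * gaussianPDFReal 0 1 (s / a)) ≤ absMean b s - absMean a s := by
  rw [← integral_id_mul_sign_affine ha, ← integral_const_mul, absMean, absMean,
    ← integral_sub (integrable_abs_affine b s) (integrable_abs_affine a s)]
  refine integral_mono ?_ ((integrable_abs_affine b s).sub (integrable_abs_affine a s)) fun z => ?_
  · refine Integrable.const_mul ?_ _
    have hm : Measurable fun z : ℝ => z * (if 0 < s + a * z then (1 : ℝ) else -1) :=
      measurable_id.mul (Measurable.ite (measurableSet_lt (by fun_prop) (by fun_prop))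
        measurable_const measurable_const)
    refine integrable_id_stdGaussian.mono hm.aestronglyMeasurable (ae_of_all _ fun z => ?_)
    split_ifs <;> simp
  · simp only
    split_ifs with h
    · rw [abs_of_pos h]
      have := le_abs_self (s + b * z)
      linarith
    · rw [abs_of_nonpos (not_lt.1 h)]
      have := neg_abs_le (s + b * z)
      linarith

lemma continuous_absMean (b : ℝ) : Continuous (absMean b) := by
  refine (LipschitzWith.of_dist_le_mul (K := 1) fun s t => ?_).continuous
  rw [Real.dist_eq, absMean, absMean,
    ← integral_sub (integrable_abs_affine b s) (integrable_abs_affine b t)]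
  refine (abs_integral_le_integral_abs).trans ?_
  have h1 : ∫ z, |(|s + b * z| - |t + b * z|)| ∂(gaussianReal 0 1)
      ≤ ∫ _, |s - t| ∂(gaussianReal 0 1) := by
    refine integral_mono ((integrable_abs_affine b s).sub (integrable_abs_affine b t)).abs
      (integrable_const _) fun z => ?_
    refine (abs_abs_sub_abs_le_abs_sub _ _).trans (le_of_eq ?_)
    congr 1; ring
  simpa [Real.dist_eq] using h1

lemma absMean_nonneg (b s : ℝ) : 0 ≤ absMean b s := integral_nonneg fun _ => abs_nonneg _

lemma lintegral_abs_gaussianReal {w : ℝ} (hw : 0 ≤ w) (s : ℝ) :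
    ∫⁻ z, ENNReal.ofReal |z| ∂(gaussianReal s w.toNNReal) = ENNReal.ofReal (absMean (√w) s) := by
  have hlaw : (gaussianReal 0 1).map (fun z => s + √w * z) = gaussianReal s w.toNNReal := by
    have h1 := gaussianReal_map_const_mul (μ := 0) (v := 1) (√w)
    have h2 := gaussianReal_map_const_add (μ := 0) (v := w.toNNReal) s
    have h3 : NNReal.mk (√w ^ 2) (sq_nonneg _) * 1 = w.toNNReal := by
      rw [mul_one]
      apply NNReal.eq
      rw [Real.coe_toNNReal _ hw]
      exact Real.sq_sqrt hw
    rw [h3, mul_zero] at h1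
    rw [← h1, Measure.map_map (by fun_prop) (by fun_prop), zero_add] at h2
    exact h2
  rw [← hlaw, lintegral_map (by fun_prop) (by fun_prop), absMean,
    ofReal_integral_eq_lintegral_ofReal (integrable_abs_affine _ _)
      (ae_of_all _ fun _ => abs_nonneg _)]

end AbsMean

/-! ### Bounds for the mean number of zeros -/

section ZeroBounds

open scoped NNReal ENNReal

/-- `∫_{-π}^{π} angleWeight v t · E |cos t + b Z| dt`, which is `2 E |Re (R / P)|` when `P`, `R`
have mean one and variance parameters `v`, `b²`. -/
noncomputable def angleMean (v b : ℝ) : ℝ :=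
  ∫ t in Set.Ioc (-Real.pi) Real.pi, angleWeight v.toNNReal t * absMean b (Real.cos t)

lemma continuous_angleWeight (v : ℝ≥0) : Continuous (angleWeight v) := by
  unfold angleWeight
  fun_prop

lemma integrableOn_angleMean (v b : ℝ) : IntegrableOn
    (fun t => angleWeight v.toNNReal t * absMean b (Real.cos t)) (Set.Ioc (-Real.pi) Real.pi) := by
  have hc : Continuous fun t => angleWeight v.toNNReal t * absMean b (Real.cos t) :=
    (continuous_angleWeight _).mul ((continuous_absMean b).comp Real.continuous_cos)
  exact (hc.integrableOn_Icc (a := -Real.pi) (b := Real.pi)).mono_set Set.Ioc_subset_Icc_self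

lemma angleWeight_nonneg (v : ℝ≥0) (t : ℝ) : 0 ≤ angleWeight v t := by
  unfold angleWeight
  positivity

lemma two_mul_lintegral_abs_re_eq_angleMean {σ : ℝ} (hσ : 0 < σ) (c d : ℕ → ℝ) (m : ℕ)
    (hc : 0 < ∑ k ∈ Finset.Icc 1 m, c k ^ 2) :
    2 * ∫⁻ x, ENNReal.ofReal |(trigSum d m x 0 / trigSum c m x 0).re| ∂(gaussianSeq σ) =
      ENNReal.ofReal (angleMean (σ ^ 2 * ∑ k ∈ Finset.Icc 1 m, c k ^ 2)
        (√(σ ^ 2 * ∑ k ∈ Finset.Icc 1 m, d k ^ 2))) := by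
  have hd : 0 ≤ σ ^ 2 * ∑ k ∈ Finset.Icc 1 m, d k ^ 2 :=
    mul_nonneg (sq_nonneg _) (Finset.sum_nonneg fun _ _ => sq_nonneg _)
  rw [two_mul_lintegral_abs_re_trigSum_div hσ c d m hc, angleMean,
    ofReal_integral_eq_lintegral_ofReal (integrableOn_angleMean _ _)
      (ae_of_all _ fun t => mul_nonneg (angleWeight_nonneg _ _) (absMean_nonneg _ _))]
  refine lintegral_congr fun t => ?_
  rw [lintegral_abs_gaussianReal hd, ENNReal.ofReal_mul (angleWeight_nonneg _ _)]

/-- With `R = P` the quotient is `1`, which evaluates the average. -/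
lemma angleMean_sqrt_self {v : ℝ} (hv : 0 < v) : angleMean v (√v) = 2 := by
  have hs : 0 < √v := Real.sqrt_pos.2 hv
  have h := two_mul_lintegral_abs_re_eq_angleMean hs (fun _ => 1) (fun _ => 1) 1 (by simp)
  have h1 : ∫⁻ x, ENNReal.ofReal |(trigSum (fun _ => 1) 1 x 0 / trigSum (fun _ => 1) 1 x 0).re|
      ∂(gaussianSeq (√v)) = 1 := by
    have hae := ae_trigSum_ne_zero hs (fun _ => 1) 1 (k₀ := 1) (by simp) one_ne_zero
    calc _ = ∫⁻ _, 1 ∂(gaussianSeq (√v)) := by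
          refine lintegral_congr_ae ?_
          filter_upwards [hae] with x hx
          rw [div_self (hx 0)]
          simp
      _ = 1 := by simp
  rw [h1] at h
  simp only [one_pow, Finset.Icc_self, Finset.sum_const, Finset.card_singleton, one_smul, mul_one,
    Real.sq_sqrt hv.le] at h
  have h2 : ENNReal.ofReal (angleMean v √v) = ENNReal.ofReal 2 := by rw [← h]; simp
  have h3 : 0 ≤ angleMean v √v :=
    integral_nonneg fun t => mul_nonneg (angleWeight_nonneg _ _) (absMean_nonneg _ _)
  exact (ENNReal.ofReal_eq_ofReal_iff h3 (by norm_num)).1 h2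

/-- The weight times the tangent slope `2 φ(cos t / √w)` of `absMean` at `√w`. -/
lemma angleWeight_mul_gaussianPDFReal {v : ℝ} (hv : 0 < v) {w : ℝ} (hw : 0 < w) (t : ℝ) :
    angleWeight v.toNNReal t * (2 * gaussianPDFReal 0 1 (Real.cos t / √w))
      = (Real.pi * √v)⁻¹ * Real.exp (-Real.sin t ^ 2 / (2 * v) - Real.cos t ^ 2 / (2 * w)) := by
  have hπ := Real.pi_pos
  have h1 : √(2 * Real.pi * v) = √(2 * Real.pi) * √v := Real.sqrt_mul (by positivity) _
  have h2 : √(2 * Real.pi) * √(2 * Real.pi) = 2 * Real.pi := Real.mul_self_sqrt (by positivity)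
  have h3 : -(Real.cos t / √w - 0) ^ 2 / (2 * ((1 : ℝ≥0) : ℝ)) = -(Real.cos t ^ 2 / (2 * w)) := by
    rw [sub_zero, div_pow, Real.sq_sqrt hw.le, NNReal.coe_one]
    field_simp
  rw [angleWeight, gaussianPDFReal, h3, Real.coe_toNNReal _ hv.le, h1, NNReal.coe_one, mul_one,
    sub_eq_add_neg, Real.exp_add]
  have h4 : (√(2 * Real.pi) * √v)⁻¹ * (2 * (√(2 * Real.pi))⁻¹) = (Real.pi * √v)⁻¹ := by
    rw [mul_inv, mul_inv]
    have : (√(2 * Real.pi))⁻¹ * (√(2 * Real.pi))⁻¹ = (2 * Real.pi)⁻¹ := by rw [← mul_inv, h2]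
    calc _ = 2 * ((√(2 * Real.pi))⁻¹ * (√(2 * Real.pi))⁻¹) * (√v)⁻¹ := by ring
      _ = _ := by rw [this]; field_simp
  rw [← h4]
  ring

/-- The tangent inequalities for `absMean` at `√w` and at `√v`, averaged over the angle. At `√v` the
weighted slope is `e^{-1/(2v)}` for every angle, up to a constant factor. At `√w` it is
`e^{-sin² t / (2v) - cos² t / (2w)}`, which is at least `e^{-1/(2w)}`. -/
lemma angleMean_sub_le {v w : ℝ} (hw : 0 < w) (hwv : w ≤ v) :
    2 * (1 - √w / √v) * Real.exp (-1 / (2 * w)) ≤ angleMean v (√v) - angleMean v (√w) ∧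
    angleMean v (√v) - angleMean v (√w) ≤ 2 * (1 - √w / √v) * Real.exp (-1 / (2 * v)) := by
  have hv : 0 < v := hw.trans_le hwv
  have hsv : 0 < √v := Real.sqrt_pos.2 hv
  have hsw : 0 < √w := Real.sqrt_pos.2 hw
  have hle : √w ≤ √v := Real.sqrt_le_sqrt hwv
  have hπ := Real.pi_pos
  have hsub : angleMean v (√v) - angleMean v (√w) = ∫ t in Set.Ioc (-Real.pi) Real.pi,
      angleWeight v.toNNReal t * (absMean (√v) (Real.cos t) - absMean (√w) (Real.cos t)) := by
    rw [angleMean, angleMean, ← integral_sub (integrableOn_angleMean _ _)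
      (integrableOn_angleMean _ _)]
    simp_rw [mul_sub]
  have hint : IntegrableOn (fun t => angleWeight v.toNNReal t *
      (absMean (√v) (Real.cos t) - absMean (√w) (Real.cos t))) (Set.Ioc (-Real.pi) Real.pi) := by
    simp_rw [mul_sub]
    exact (integrableOn_angleMean _ _).sub (integrableOn_angleMean _ _)
  have hconst : ∀ C : ℝ, ∫ _ in Set.Ioc (-Real.pi) Real.pi, C = 2 * Real.pi * C := by
    intro C
    rw [setIntegral_const, Real.volume_real_Ioc_of_le (by linarith), smul_eq_mul]
    ring
  have hsc := fun t => Real.sin_sq_add_cos_sq t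
  have hC : ∀ E : ℝ, 2 * Real.pi * ((√v - √w) * ((Real.pi * √v)⁻¹ * E))
      = 2 * (1 - √w / √v) * E := by
    intro E; field_simp
  have hci : ∀ C : ℝ, IntegrableOn (fun _ => C) (Set.Ioc (-Real.pi) Real.pi) := fun C =>
    integrableOn_const (by simp)
  rw [hsub]
  constructor
  · rw [← hC, ← hconst]
    refine setIntegral_mono (hci _) hint fun t => ?_
    have h1 := mul_le_mul_of_nonneg_left (absMean_tangent_le hsw (√v) (Real.cos t))
      (angleWeight_nonneg v.toNNReal t)
    refine le_trans ?_ h1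
    rw [mul_left_comm (angleWeight _ _), angleWeight_mul_gaussianPDFReal hv hw]
    gcongr
    · have h2 : Real.sin t ^ 2 / (2 * v) ≤ Real.sin t ^ 2 / (2 * w) := by gcongr
      have h3 : -1 / (2 * w) = -(Real.sin t ^ 2 / (2 * w)) - Real.cos t ^ 2 / (2 * w) := by
        rw [← hsc t]; ring
      rw [h3, neg_div]
      linarith
  · rw [← hC, ← hconst]
    refine setIntegral_mono hint (hci _) fun t => ?_
    have h0 := absMean_tangent_le hsv (√w) (Real.cos t)
    have h1 := mul_le_mul_of_nonneg_left (show absMean (√v) (Real.cos t) - absMean (√w) (Real.cos t)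
      ≤ (√v - √w) * (2 * gaussianPDFReal 0 1 (Real.cos t / √v)) by linarith)
      (angleWeight_nonneg v.toNNReal t)
    refine h1.trans (le_of_eq ?_)
    rw [mul_left_comm, angleWeight_mul_gaussianPDFReal hv hv]
    congr 3
    rw [← hsc t]; ring

lemma tiltedCoeff_sq_le (c : ℕ → ℝ) {m k : ℕ} (hk : k ∈ Finset.Icc 1 m) :
    0 < 1 - 2 * (k : ℝ) / (2 * m + 1) ∧ 1 - 2 * (k : ℝ) / (2 * m + 1) ≤ 1 ∧
      tiltedCoeff c m k ^ 2 ≤ c k ^ 2 := by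
  rw [Finset.mem_Icc] at hk
  have hkm : (k : ℝ) ≤ m := by exact_mod_cast hk.2
  have h1 : 2 * (k : ℝ) / (2 * m + 1) < 1 := by rw [div_lt_one (by positivity)]; linarith
  have h2 : 0 ≤ 2 * (k : ℝ) / (2 * m + 1) := by positivity
  refine ⟨by linarith, by linarith, ?_⟩
  rw [tiltedCoeff, mul_pow]
  refine mul_le_of_le_one_right (sq_nonneg _) ?_
  exact pow_le_one₀ (by linarith) (by linarith)

/-- Two-sided bound for the mean proportion of zeros off the unit circle, in terms of the variances
`v` and `w` of the first half of the polynomial and of its tilted version. -/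
theorem one_sub_integral_numUnitCircleZeros_bounds {σ : ℝ} (hσ : 0 < σ) (b : ℝ → ℝ) (m : ℕ) {v w : ℝ}
    (hv : v = σ ^ 2 * ∑ k ∈ Finset.Icc 1 m, b k ^ 2)
    (hw : w = σ ^ 2 * ∑ k ∈ Finset.Icc 1 m, tiltedCoeff (fun k => b k) m k ^ 2) (hv0 : 0 < v) :
    0 < w ∧ w ≤ v ∧
    (1 - √w / √v) * Real.exp (-1 / (2 * w)) ≤
      1 - ∫ x, (numUnitCircleZeros b x m : ℝ) / (2 * m + 1) ∂(gaussianSeq σ) ∧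
    1 - ∫ x, (numUnitCircleZeros b x m : ℝ) / (2 * m + 1) ∂(gaussianSeq σ) ≤
      (1 - √w / √v) * Real.exp (-1 / (2 * v)) := by
  have hsum : 0 < ∑ k ∈ Finset.Icc 1 m, b k ^ 2 := by
    rw [hv] at hv0
    exact pos_of_mul_pos_right hv0 (sq_nonneg σ)
  obtain ⟨k₀, hk₀, hbk⟩ : ∃ k ∈ Finset.Icc 1 m, b k ≠ 0 := by
    by_contra hcon
    push Not at hcon
    rw [Finset.sum_eq_zero fun k hk => by rw [hcon k hk]; simp] at hsum
    exact lt_irrefl _ hsum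
  have hw0 : 0 < w := by
    rw [hw]
    refine mul_pos (by positivity) (Finset.sum_pos' (fun _ _ => sq_nonneg _) ⟨k₀, hk₀, ?_⟩)
    have := (tiltedCoeff_sq_le (fun k => b k) hk₀).1
    have hne : tiltedCoeff (fun k => b k) m k₀ ≠ 0 := mul_ne_zero hbk this.ne'
    positivity
  have hwv : w ≤ v := by
    rw [hw, hv]
    refine mul_le_mul_of_nonneg_left (Finset.sum_le_sum fun k hk => ?_) (sq_nonneg σ)
    exact (tiltedCoeff_sq_le (fun k => b k) hk).2.2
  have hn : (0 : ℝ) < 2 * m + 1 := by positivity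
  obtain ⟨L, hL⟩ : ∃ L, L = ∫⁻ x, ENNReal.ofReal |(trigSum (tiltedCoeff (fun k => b k) m) m x 0 /
          trigSum (fun k => b k) m x 0).re| ∂(gaussianSeq σ) := ⟨_, rfl⟩
  have h1 : 2 * L = ENNReal.ofReal (angleMean v (√w)) := by
    rw [hL, two_mul_lintegral_abs_re_eq_angleMean hσ _ _ m hsum, ← hv, ← hw]
  have h2 : ∫⁻ x, (numUnitCircleZeros b x m : ENNReal) ∂(gaussianSeq σ)
      = ENNReal.ofReal (2 * m + 1) * L := by
    rw [lintegral_numUnitCircleZeros hσ b m hk₀ hbk, hL]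
    rw [← lintegral_const_mul' _ _ ENNReal.ofReal_ne_top]
    refine lintegral_congr fun x => ?_
    rw [abs_mul, abs_of_pos hn, ENNReal.ofReal_mul hn.le]
  have hnn : 0 ≤ angleMean v (√w) :=
    integral_nonneg fun t => mul_nonneg (angleWeight_nonneg _ _) (absMean_nonneg _ _)
  have hLreal : L.toReal = angleMean v (√w) / 2 := by
    have := congrArg ENNReal.toReal h1
    rw [ENNReal.toReal_mul, ENNReal.toReal_ofReal hnn, ENNReal.toReal_ofNat] at this
    linarith
  have h3 : ∫ x, (numUnitCircleZeros b x m : ℝ) / (2 * m + 1) ∂(gaussianSeq σ)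
      = angleMean v (√w) / 2 := by
    rw [integral_div, integral_eq_lintegral_of_nonneg_ae (ae_of_all _ fun _ => Nat.cast_nonneg _)
      ((measurable_of_countable (fun k : ℕ => (k : ℝ))).comp
        (measurable_numUnitCircleZeros b m)).aestronglyMeasurable]
    simp_rw [ENNReal.ofReal_natCast]
    rw [h2, ENNReal.toReal_mul, ENNReal.toReal_ofReal hn.le, hLreal]
    field_simp
  obtain ⟨h4, h5⟩ := angleMean_sub_le hw0 hwv
  rw [angleMean_sqrt_self hv0] at h4 h5
  refine ⟨hw0, hwv, ?_, ?_⟩ <;> rw [h3] <;> linarith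

end ZeroBounds

/-! ### Asymptotics of the coefficient sums -/

section Asymptotics

/-- A quantity `D` between `(1 - √(w/v)) e^{-1/(2w)}` and `(1 - √(w/v)) e^{-1/(2v)}` is asymptotic
to `e^{-1/(2v)} G` whenever `(v - w) / (2v) ∼ G → 0` and `v` stays away from zero. -/
lemma tendsto_div_of_sqrt_bounds {D v w G : ℕ → ℝ} {v₀ : ℝ} (hv₀ : 0 < v₀)
    (hv : ∀ᶠ m in atTop, v₀ ≤ v m)
    (hD : ∀ᶠ m in atTop, 0 < w m ∧ w m ≤ v m ∧
      (1 - √(w m) / √(v m)) * Real.exp (-1 / (2 * w m)) ≤ D m ∧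
      D m ≤ (1 - √(w m) / √(v m)) * Real.exp (-1 / (2 * v m)))
    (hG : ∀ᶠ m in atTop, 0 < G m) (hG0 : Tendsto G atTop (𝓝 0))
    (hr : Tendsto (fun m => (v m - w m) / (2 * v m) / G m) atTop (𝓝 1)) :
    Tendsto (fun m => D m / (Real.exp (-1 / (2 * v m)) * G m)) atTop (𝓝 1) := by
  -- the relative gap `r = 1 - w / v`
  set r : ℕ → ℝ := fun m => (v m - w m) / v m with hrdef
  have hr0 : Tendsto r atTop (𝓝 0) := by
    have h := (hr.mul hG0).const_mul 2
    simp only [mul_zero] at h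
    refine h.congr' ?_
    filter_upwards [hG, hv] with m hGm hvm
    have : 0 < v m := hv₀.trans_le hvm
    simp only [hrdef]
    field_simp
  have hgap : ∀ᶠ m in atTop, 1 - √(w m) / √(v m)
      = (v m - w m) / (2 * v m) * (2 / (1 + √(1 - r m))) := by
    filter_upwards [hv, hD, hr0.eventually_lt_const one_pos] with m hvm hDm hrm
    have hv0 : 0 < v m := hv₀.trans_le hvm
    have hwr : w m / v m = 1 - r m := by simp only [hrdef]; field_simp; ring
    have h1 : √(1 - r m) * √(1 - r m) = 1 - r m := Real.mul_self_sqrt (by linarith)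
    have h2 : 0 ≤ √(1 - r m) := Real.sqrt_nonneg _
    have h3 : (v m - w m) / (2 * v m) = r m / 2 := by simp only [hrdef]; field_simp
    rw [← Real.sqrt_div hDm.1.le, hwr, h3]
    field_simp
    linear_combination -h1
  have hsq : Tendsto (fun m => 2 / (1 + √(1 - r m))) atTop (𝓝 1) := by
    have h1 : Tendsto (fun m => √(1 - r m)) atTop (𝓝 1) := by
      have := (hr0.const_sub 1).sqrt
      simpa using this
    have h2 := (tendsto_const_nhds (x := (2 : ℝ))).div (h1.const_add 1) (by norm_num)
    norm_num at h2
    exact h2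
  have hup := hr.mul hsq
  rw [one_mul] at hup
  have hexp : Tendsto (fun m => Real.exp (-(1 / (2 * v₀)) * (r m / (1 - r m)))) atTop (𝓝 1) := by
    have h1 := (hr0.div (hr0.const_sub 1) (by norm_num)).const_mul (-(1 / (2 * v₀)))
    norm_num at h1
    have h2 := (Real.continuous_exp.tendsto 0).comp h1
    simp only [Real.exp_zero] at h2
    refine h2.congr fun m => ?_
    simp [Function.comp]
  have hlo := hup.mul hexp
  rw [one_mul] at hlo
  refine tendsto_of_tendsto_of_tendsto_of_le_of_le' hlo hup ?_ ?_
  · filter_upwards [hG, hv, hD, hgap, hr0.eventually_lt_const one_pos] with m hGm hvm hDm hgapm hrm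
    have hv0 : 0 < v m := hv₀.trans_le hvm
    obtain ⟨hw0, hwv, hl, -⟩ := hDm
    have hwr : w m / v m = 1 - r m := by simp only [hrdef]; field_simp; ring
    have hrn : 0 ≤ r m := div_nonneg (by linarith) hv0.le
    rw [hgapm] at hl
    have hE : Real.exp (-(1 / (2 * v₀)) * (r m / (1 - r m))) * Real.exp (-1 / (2 * v m))
        ≤ Real.exp (-1 / (2 * w m)) := by
      rw [← Real.exp_add]
      refine Real.exp_le_exp.2 ?_
      have h4 : -1 / (2 * w m) = -1 / (2 * v m) - 1 / (2 * v m) * (r m / (1 - r m)) := by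
        rw [← hwr]; simp only [hrdef]; field_simp; ring
      have h5 : 1 / (2 * v m) * (r m / (1 - r m)) ≤ 1 / (2 * v₀) * (r m / (1 - r m)) := by
        have : 0 ≤ r m / (1 - r m) := div_nonneg hrn (by linarith)
        gcongr
      rw [h4]; linarith
    rw [le_div_iff₀ (by positivity)]
    refine le_trans ?_ hl
    have hA : 0 ≤ (v m - w m) / (2 * v m) * (2 / (1 + √(1 - r m))) := by
      have : 0 ≤ v m - w m := by linarith
      positivity
    calc _ = (v m - w m) / (2 * v m) * (2 / (1 + √(1 - r m))) *
          (Real.exp (-(1 / (2 * v₀)) * (r m / (1 - r m))) * Real.exp (-1 / (2 * v m))) := by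
            field_simp
      _ ≤ _ := mul_le_mul_of_nonneg_left hE hA
  · filter_upwards [hG, hv, hD, hgap, hr0.eventually_lt_const one_pos] with m hGm hvm hDm hgapm hrm
    have hv0 : 0 < v m := hv₀.trans_le hvm
    obtain ⟨hw0, hwv, -, hu⟩ := hDm
    rw [hgapm] at hu
    rw [div_le_iff₀ (by positivity)]
    refine hu.trans (le_of_eq ?_)
    field_simp

/-- `∑_{k ≤ m} k ^ γ ℓ(k)²`. -/
noncomputable def powSum (ℓ : ℝ → ℝ) (γ : ℝ) (m : ℕ) : ℝ :=
  ∑ k ∈ Finset.Icc 1 m, (k : ℝ) ^ γ * ℓ k ^ 2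

variable {ℓ b : ℝ → ℝ} {α : ℝ}

lemma sq_mul_pow_eq (hb : ∀ x : ℝ, 0 < x → b x = x ^ α * ℓ x) {k : ℕ} (hk : 1 ≤ k) (j : ℕ) :
    b k ^ 2 * (k : ℝ) ^ j = (k : ℝ) ^ (2 * α + j) * ℓ k ^ 2 := by
  have hk0 : (0 : ℝ) < k := by exact_mod_cast hk
  rw [hb k hk0, mul_pow, Real.rpow_add hk0, Real.rpow_natCast, mul_comm 2 α, Real.rpow_mul hk0.le,
    Real.rpow_two]
  ring

/-- The defect `v - w` in terms of the first two moments of `b(k)²`. -/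
lemma variance_gap_eq (hb : ∀ x : ℝ, 0 < x → b x = x ^ α * ℓ x) (m : ℕ) :
    ∑ k ∈ Finset.Icc 1 m, b k ^ 2 - ∑ k ∈ Finset.Icc 1 m, tiltedCoeff (fun k => b k) m k ^ 2
      = 4 * powSum ℓ (2 * α + 1) m / (2 * m + 1) - 4 * powSum ℓ (2 * α + 2) m / (2 * m + 1) ^ 2 := by
  have hn : (2 * (m : ℝ) + 1) ≠ 0 := by positivity
  rw [powSum, powSum, Finset.mul_sum, Finset.mul_sum, Finset.sum_div, Finset.sum_div,
    ← Finset.sum_sub_distrib, ← Finset.sum_sub_distrib]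
  refine Finset.sum_congr rfl fun k hk => ?_
  rw [Finset.mem_Icc] at hk
  have h1 := sq_mul_pow_eq hb hk.1 1
  have h2 := sq_mul_pow_eq hb hk.1 2
  push_cast at h1 h2
  rw [← h1, ← h2, tiltedCoeff]
  field_simp
  ring

lemma sum_sq_eq_powSum (hb : ∀ x : ℝ, 0 < x → b x = x ^ α * ℓ x) (m : ℕ) :
    ∑ k ∈ Finset.Icc 1 m, b k ^ 2 = powSum ℓ (2 * α) m := by
  refine Finset.sum_congr rfl fun k hk => ?_
  rw [Finset.mem_Icc] at hk
  simpa using sq_mul_pow_eq hb hk.1 0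

lemma sum_range_sTerm (ℓ : ℝ → ℝ) (γ : ℝ) (m : ℕ) :
    ∑ j ∈ Finset.range m, sTerm ℓ γ j = powSum ℓ γ m := by
  rw [powSum, Finset.range_eq_Ico, ← Finset.Ico_add_one_right_eq_Icc,
    ← Finset.sum_Ico_add' _ 0 m 1]
  simp [sTerm]

lemma powSum_nonneg (ℓ : ℝ → ℝ) (γ : ℝ) (m : ℕ) : 0 ≤ powSum ℓ γ m :=
  Finset.sum_nonneg fun _ _ => mul_nonneg (Real.rpow_nonneg (Nat.cast_nonneg _) _) (sq_nonneg _)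

lemma exists_pos_le_powSum (hℓ : IsSlowlyVarying ℓ) (γ : ℝ) :
    ∃ c > 0, ∀ᶠ m in atTop, c ≤ powSum ℓ γ m := by
  obtain ⟨N, hN, hN1⟩ := ((tendsto_natCast_atTop_atTop.eventually hℓ.eventually_pos).and
    (eventually_ge_atTop 1)).exists
  have hN0 : (0 : ℝ) < N := by exact_mod_cast hN1
  refine ⟨(N : ℝ) ^ γ * ℓ N ^ 2, by positivity, ?_⟩
  filter_upwards [eventually_ge_atTop N] with m hm
  exact Finset.single_le_sum (f := fun k : ℕ => (k : ℝ) ^ γ * ℓ k ^ 2)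
    (fun k _ => mul_nonneg (Real.rpow_nonneg (Nat.cast_nonneg _) _) (sq_nonneg _))
    (Finset.mem_Icc.2 ⟨hN1, hm⟩)

lemma tendsto_powSum_div (hℓ : IsSlowlyVarying ℓ) {γ : ℝ} (hγ : -1 < γ) :
    Tendsto (fun m : ℕ => powSum ℓ γ m / ((m : ℝ) ^ (γ + 1) * ℓ m ^ 2)) atTop (𝓝 (1 / (γ + 1))) := by
  have h := (hℓ.sq.tendsto_sum_div hγ).div_const (γ + 1)
  refine h.congr fun m => ?_
  have hγ' : γ + 1 ≠ 0 := by linarith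
  rw [powSum, show Finset.Icc 1 m = Finset.Ioc 0 m by ext; simp [Nat.succ_le_iff]]
  field_simp

/-- By Cesàro averaging, since `k ^ γ ℓ(k)² → 0`. -/
lemma tendsto_powSum_div_natCast (hℓ : IsSlowlyVarying ℓ) {γ : ℝ} (hγ : γ < 0) :
    Tendsto (fun m : ℕ => powSum ℓ γ m / m) atTop (𝓝 0) := by
  have h := (((tendsto_add_atTop_iff_nat 1).2 (hℓ.sq.tendsto_rpow_mul hγ))).cesaro
  refine h.congr fun m => ?_
  rw [← sum_range_sTerm, div_eq_inv_mul]
  simp [sTerm]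

end Asymptotics

/-! ### The gap between the two variances -/

section Gap

variable {ℓ : ℝ → ℝ} {α : ℝ}

lemma tendsto_natCast_div_two_mul_add_one :
    Tendsto (fun m : ℕ => (m : ℝ) / (2 * m + 1)) atTop (𝓝 (1 / 2)) := by
  have h : Tendsto (fun m : ℕ => 1 / (2 + ((m : ℝ))⁻¹)) atTop (𝓝 (1 / (2 + 0))) :=
    tendsto_const_nhds.div
      ((tendsto_inv_atTop_zero.comp tendsto_natCast_atTop_atTop).const_add 2) (by norm_num)
  rw [add_zero] at h
  refine h.congr' ?_
  filter_upwards [eventually_gt_atTop 0] with m hm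
  have : (0 : ℝ) < m := by exact_mod_cast hm
  field_simp

/-- The gap `v - w`, divided by `2σ²`. -/
noncomputable def halfGap (ℓ : ℝ → ℝ) (α : ℝ) (m : ℕ) : ℝ :=
  2 * powSum ℓ (2 * α + 1) m / (2 * m + 1) - 2 * powSum ℓ (2 * α + 2) m / (2 * m + 1) ^ 2

/-- When `α > -1` both moments have the order `m ^ (1 + 2α) ℓ(m)²`, and Karamata's theorem gives the
limit `1 / (2 + 2α) - 1 / (2 (3 + 2α))`. -/
lemma tendsto_halfGap_div (hℓ : IsSlowlyVarying ℓ) (hα : -1 < α) :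
    Tendsto (fun m : ℕ => halfGap ℓ α m / ((m : ℝ) ^ (1 + 2 * α) * ℓ m ^ 2)) atTop
      (𝓝 ((2 + α) / (2 * (1 + α) * (3 + 2 * α)))) := by
  have hq := tendsto_natCast_div_two_mul_add_one
  have h1 := ((tendsto_powSum_div hℓ (γ := 2 * α + 1) (by linarith)).mul hq).const_mul 2
  have h2 := ((tendsto_powSum_div hℓ (γ := 2 * α + 2) (by linarith)).mul (hq.pow 2)).const_mul 2
  have h := h1.sub h2
  have e : 2 * (1 / (2 * α + 1 + 1) * (1 / 2)) - 2 * (1 / (2 * α + 2 + 1) * (1 / 2) ^ 2)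
      = (2 + α) / (2 * (1 + α) * (3 + 2 * α)) := by
    have e1 : 1 + α ≠ 0 := by linarith
    have e2 : 3 + 2 * α ≠ 0 := by linarith
    have e3 : 2 * α + 1 + 1 = 2 * (1 + α) := by ring
    have e4 : 2 * α + 2 + 1 = 3 + 2 * α := by ring
    rw [e3, e4]
    field_simp
    ring
  rw [e] at h
  refine h.congr' ?_
  filter_upwards [eventually_gt_atTop 0] with m hm
  have hm0 : (0 : ℝ) < m := by exact_mod_cast hm
  rw [show 2 * α + 1 + 1 = (1 + 2 * α) + 1 by ring, show 2 * α + 2 + 1 = (1 + 2 * α) + 1 + 1 by ring,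
    Real.rpow_add_one hm0.ne' (1 + 2 * α + 1), Real.rpow_add_one hm0.ne', halfGap]
  have : (m : ℝ) ^ (1 + 2 * α) ≠ 0 := (Real.rpow_pos_of_pos hm0 _).ne'
  field_simp

/-- For `α ≤ -1` the second moment is negligible, and the first moment alone governs the gap. -/
lemma tendsto_powSum_div_mul_powSum (hℓ : IsSlowlyVarying ℓ) (hα : α ≤ -1) :
    Tendsto (fun m : ℕ => powSum ℓ (2 * α + 2) m / (m * powSum ℓ (2 * α + 1) m)) atTop (𝓝 0) := by
  rcases hα.eq_or_lt with rfl | hα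
  · have h1 := tendsto_powSum_div hℓ (γ := 0) (by norm_num)
    have h2 := hℓ.sq.tendsto_div_sum_inv fun x => sq_nonneg (ℓ x)
    have h := h1.mul h2
    rw [mul_zero] at h
    refine h.congr' ?_
    filter_upwards [tendsto_natCast_atTop_atTop.eventually hℓ.eventually_pos,
      eventually_gt_atTop 0] with m hm hm0
    have hm0 : (0 : ℝ) < m := by exact_mod_cast hm0
    have e : ∑ k ∈ Finset.Ioc 0 m, ℓ k ^ 2 / (k : ℝ) = powSum ℓ (2 * -1 + 1) m := by
      rw [powSum, show Finset.Icc 1 m = Finset.Ioc 0 m by ext; simp [Nat.succ_le_iff]]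
      refine Finset.sum_congr rfl fun k _ => ?_
      rw [show (2 * -1 + 1 : ℝ) = -1 by norm_num, Real.rpow_neg_one, div_eq_inv_mul]
    rw [e, show (2 * -1 + 2 : ℝ) = 0 by norm_num, zero_add, Real.rpow_one]
    field_simp
  · obtain ⟨c, hc, hcm⟩ := exists_pos_le_powSum hℓ (2 * α + 1)
    have h := (tendsto_powSum_div_natCast hℓ (γ := 2 * α + 2) (by linarith)).div_const c
    rw [zero_div] at h
    refine squeeze_zero' (Eventually.of_forall fun m => ?_) ?_ h
    · exact div_nonneg (powSum_nonneg _ _ _)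
        (mul_nonneg (Nat.cast_nonneg _) (powSum_nonneg _ _ _))
    · filter_upwards [hcm] with m hm
      rw [← div_div]
      exact div_le_div_of_nonneg_left (div_nonneg (powSum_nonneg _ _ _) (Nat.cast_nonneg _)) hc hm

lemma tendsto_halfGap_div_powSum (hℓ : IsSlowlyVarying ℓ) (hα : α ≤ -1) :
    Tendsto (fun m : ℕ => halfGap ℓ α m / (powSum ℓ (2 * α + 1) m / m)) atTop (𝓝 1) := by
  have hq := tendsto_natCast_div_two_mul_add_one
  have h := (hq.const_mul 2).sub
    (((tendsto_powSum_div_mul_powSum hℓ hα).mul (hq.pow 2)).const_mul 2)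
  norm_num at h
  refine h.congr' ?_
  obtain ⟨c, hc, hcm⟩ := exists_pos_le_powSum hℓ (2 * α + 1)
  filter_upwards [hcm, eventually_gt_atTop 0] with m hm hm0
  have hm0 : (0 : ℝ) < m := by exact_mod_cast hm0
  have : powSum ℓ (2 * α + 1) m ≠ 0 := (hc.trans_le hm).ne'
  rw [halfGap]
  field_simp

lemma summable_sTerm (hℓ : IsSlowlyVarying ℓ) {γ : ℝ} (hγ : γ < -1) : Summable (sTerm ℓ γ) := by
  refine ((summable_nat_add_iff 1).2 (hℓ.sq.summable_rpow_mul hγ)).congr fun j => ?_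
  simp [sTerm]

lemma tendsto_powSum_sSum (hℓ : IsSlowlyVarying ℓ) {γ : ℝ} (hγ : γ < -1) :
    Tendsto (powSum ℓ γ) atTop (𝓝 (sSum ℓ γ)) := by
  refine (summable_sTerm hℓ hγ).hasSum.tendsto_sum_nat.congr fun m => ?_
  exact sum_range_sTerm ℓ γ m

lemma sSum_pos (hℓ : IsSlowlyVarying ℓ) {γ : ℝ} (hγ : γ < -1) : 0 < sSum ℓ γ := by
  obtain ⟨c, hc, hcm⟩ := exists_pos_le_powSum hℓ γ
  exact hc.trans_le (ge_of_tendsto (tendsto_powSum_sSum hℓ hγ) hcm)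

end Gap

/-! ### Asymptotics of the mean number of zeros -/

section Transfer

variable {Ω : Type*} [MeasurableSpace Ω] {P : Measure Ω} {σ : ℝ} {ξ : ℕ → Ω → ℂ}

lemma hasLaw_gaussianSeq [IsProbabilityMeasure P]
    (hξ : ∀ k, HasLaw (ξ k) (isotropicGaussian σ) P) (hind : iIndepFun ξ P) :
    HasLaw (fun ω k => ξ k ω) (gaussianSeq σ) P :=
  hind.hasLaw_infinitePi hξ (aemeasurable_pi_iff.2 fun k => (hξ k).aemeasurable)

lemma integrable_numUnitCircleZeros [IsProbabilityMeasure P] (b : ℝ → ℝ)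
    (hξ : ∀ k, HasLaw (ξ k) (isotropicGaussian σ) P) (m : ℕ) :
    Integrable (fun ω => (numUnitCircleZeros b (fun k => ξ k ω) m : ℝ)) P := by
  refine Integrable.of_bound (C := 2 * m + 1) ?_ (Eventually.of_forall fun ω => ?_)
  · have h : Measurable fun x : ℕ → ℂ => (numUnitCircleZeros b x m : ℝ) :=
      measurable_from_top.comp (measurable_numUnitCircleZeros b m)
    exact (h.comp_aemeasurable
      (aemeasurable_pi_iff.2 fun k => (hξ k).aemeasurable)).aestronglyMeasurable
  · rw [Real.norm_of_nonneg (Nat.cast_nonneg _)]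
    exact_mod_cast numUnitCircleZeros_le b _ m

lemma integral_numUnitCircleZeros_eq [IsProbabilityMeasure P] (b : ℝ → ℝ)
    (hξ : ∀ k, HasLaw (ξ k) (isotropicGaussian σ) P) (hind : iIndepFun ξ P) (m : ℕ) :
    ∫ ω, (numUnitCircleZeros b (fun k => ξ k ω) m : ℝ) / (2 * m + 1) ∂P
      = ∫ x, (numUnitCircleZeros b x m : ℝ) / (2 * m + 1) ∂(gaussianSeq σ) := by
  have h : Measurable fun x : ℕ → ℂ => (numUnitCircleZeros b x m : ℝ) / (2 * m + 1) :=
    (measurable_from_top.comp (measurable_numUnitCircleZeros b m) : Measurable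
      fun x : ℕ → ℂ => (numUnitCircleZeros b x m : ℝ)).div_const _
  exact (hasLaw_gaussianSeq hξ hind).integral_comp h.aestronglyMeasurable

/-- It suffices to find the asymptotics `G` of the relative gap `(v - w) / (2v)`. -/
lemma tendsto_one_sub_integral_div [IsProbabilityMeasure P] (hσ : 0 < σ) {α : ℝ} {ℓ b : ℝ → ℝ}
    (hℓ : IsSlowlyVarying ℓ) (hb : ∀ x : ℝ, 0 < x → b x = x ^ α * ℓ x)
    (hξ : ∀ k, HasLaw (ξ k) (isotropicGaussian σ) P) (hind : iIndepFun ξ P) {G : ℕ → ℝ}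
    (hG : ∀ᶠ m in atTop, 0 < G m) (hG0 : Tendsto G atTop (𝓝 0))
    (hr : Tendsto (fun m => halfGap ℓ α m / powSum ℓ (2 * α) m / G m) atTop (𝓝 1)) :
    Tendsto (fun m => (1 - ∫ ω, (numUnitCircleZeros b (fun k => ξ k ω) m : ℝ) / (2 * m + 1) ∂P) /
      (Real.exp (-1 / (2 * gOne b σ m)) * G m)) atTop (𝓝 1) := by
  obtain ⟨c, hc, hcm⟩ := exists_pos_le_powSum hℓ (2 * α)
  have hv : ∀ m, gOne b σ m = σ ^ 2 * powSum ℓ (2 * α) m := fun m => by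
    rw [gOne, sum_sq_eq_powSum hb]
  have hvc : ∀ᶠ m in atTop, σ ^ 2 * c ≤ gOne b σ m := by
    filter_upwards [hcm] with m hm
    rw [hv]
    gcongr
  have hc' : 0 < σ ^ 2 * c := by positivity
  refine tendsto_div_of_sqrt_bounds
    (w := fun m => σ ^ 2 * ∑ k ∈ Finset.Icc 1 m, tiltedCoeff (fun k => b k) m k ^ 2)
    hc' hvc ?_ hG hG0 (hr.congr' ?_)
  · filter_upwards [hvc] with m hm
    rw [integral_numUnitCircleZeros_eq b hξ hind]
    exact one_sub_integral_numUnitCircleZeros_bounds hσ b m rfl rfl (hc'.trans_le hm)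
  · filter_upwards [hcm] with m hm
    congr 1
    rw [gOne, ← mul_sub, variance_gap_eq hb, sum_sq_eq_powSum hb, halfGap]
    have : powSum ℓ (2 * α) m ≠ 0 := (hc.trans_le hm).ne'
    field_simp
    ring

lemma tendsto_exp_gOne {α : ℝ} (hσ : 0 < σ) {ℓ b : ℝ → ℝ} (hℓ : IsSlowlyVarying ℓ)
    (hb : ∀ x : ℝ, 0 < x → b x = x ^ α * ℓ x) (hα : 2 * α < -1) :
    Tendsto (fun m => Real.exp (-1 / (2 * gOne b σ m))) atTop
      (𝓝 (Real.exp (-1 / (2 * σ ^ 2 * sSum ℓ (2 * α))))) := by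
  have hS := sSum_pos hℓ hα
  refine (Real.continuous_exp.tendsto _).comp (tendsto_const_nhds.div ?_ (by positivity))
  refine ((tendsto_powSum_sSum hℓ hα).const_mul (2 * σ ^ 2)).congr fun m => ?_
  rw [gOne, sum_sq_eq_powSum hb]
  ring

/-- When `∑ k ^ (2α) ℓ(k)²` converges, the variance may be replaced by its limit. -/
lemma tendsto_one_sub_integral_div_of_summable [IsProbabilityMeasure P] (hσ : 0 < σ) {α : ℝ}
    {ℓ b : ℝ → ℝ} (hℓ : IsSlowlyVarying ℓ) (hb : ∀ x : ℝ, 0 < x → b x = x ^ α * ℓ x)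
    (hα : 2 * α < -1)
    (hξ : ∀ k, HasLaw (ξ k) (isotropicGaussian σ) P) (hind : iIndepFun ξ P) {H : ℕ → ℝ}
    (hH : ∀ᶠ m in atTop, 0 < H m) (hH0 : Tendsto H atTop (𝓝 0))
    (hr : Tendsto (fun m => halfGap ℓ α m / H m) atTop (𝓝 1)) :
    Tendsto (fun m => (1 - ∫ ω, (numUnitCircleZeros b (fun k => ξ k ω) m : ℝ) / (2 * m + 1) ∂P) /
      (Real.exp (-1 / (2 * σ ^ 2 * sSum ℓ (2 * α))) / sSum ℓ (2 * α) * H m)) atTop (𝓝 1) := by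
  have hS := sSum_pos hℓ hα
  have hVS := tendsto_powSum_sSum hℓ hα
  have hr' : Tendsto (fun m => halfGap ℓ α m / powSum ℓ (2 * α) m / (H m / sSum ℓ (2 * α)))
      atTop (𝓝 1) := by
    have h := hr.mul ((tendsto_const_nhds (x := sSum ℓ (2 * α))).div hVS hS.ne')
    rw [div_self hS.ne', one_mul] at h
    refine h.congr fun m => ?_
    rw [Pi.div_apply, div_div_div_eq, div_mul_div_comm, mul_comm (H m)]
  have h := tendsto_one_sub_integral_div hσ hℓ hb hξ hind (G := fun m => H m / sSum ℓ (2 * α))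
    (hH.mono fun m hm => div_pos hm hS) (by simpa using hH0.div_const (sSum ℓ (2 * α))) hr'
  have hE := (tendsto_exp_gOne hσ hℓ hb hα).div_const
    (Real.exp (-1 / (2 * σ ^ 2 * sSum ℓ (2 * α))))
  rw [div_self (Real.exp_pos _).ne'] at hE
  have h' := h.mul hE
  rw [one_mul] at h'
  refine h'.congr fun m => ?_
  have e1 := (Real.exp_pos (-1 / (2 * gOne b σ m))).ne'
  have e2 := (Real.exp_pos (-1 / (2 * σ ^ 2 * sSum ℓ (2 * α)))).ne'
  field_simp

end Transfer

theorem proposition4p4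
    {Ω : Type*} [MeasurableSpace Ω] (P : Measure Ω) [IsProbabilityMeasure P]
    (α σ : ℝ) (hσ : 0 < σ)
    (ℓ b : ℝ → ℝ) (hℓ : IsSlowlyVarying ℓ) (hb : ∀ x : ℝ, 0 < x → b x = x ^ α * ℓ x)
    (ξ : ℕ → Ω → ℂ) (hξ : ∀ k, HasLaw (ξ k) (isotropicGaussian σ) P) (hind : iIndepFun ξ P) :
    (∀ m : ℕ, Integrable (fun ω => (numUnitCircleZeros b (fun k => ξ k ω) m : ℝ)) P) ∧
    (α = -1 / 2 →
      AsympEquiv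
        (fun m => 1 - ∫ ω, (numUnitCircleZeros b (fun k => ξ k ω) m : ℝ) / (2 * m + 1) ∂P)
        (fun m => 3 * Real.exp (-1 / (2 * gOne b σ m)) / 4 *
          (ℓ m ^ 2 / ∑ k ∈ Finset.Icc 1 m, ℓ k ^ 2 / k))) ∧
    (-1 < α → α < -1 / 2 →
      Summable (sTerm ℓ (2 * α)) ∧
      AsympEquiv
        (fun m => 1 - ∫ ω, (numUnitCircleZeros b (fun k => ξ k ω) m : ℝ) / (2 * m + 1) ∂P)
        (fun m => Real.exp (-1 / (2 * σ ^ 2 * sSum ℓ (2 * α))) * (2 + α) /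
            (2 * (1 + α) * (3 + 2 * α) * sSum ℓ (2 * α)) *
          ((m : ℝ) ^ (1 + 2 * α) * ℓ m ^ 2))) ∧
    (α ≤ -1 →
      Summable (sTerm ℓ (2 * α)) ∧
      AsympEquiv
        (fun m => 1 - ∫ ω, (numUnitCircleZeros b (fun k => ξ k ω) m : ℝ) / (2 * m + 1) ∂P)
        (fun m => Real.exp (-1 / (2 * σ ^ 2 * sSum ℓ (2 * α))) / sSum ℓ (2 * α) *
          ((∑ k ∈ Finset.Icc 1 m, (k : ℝ) ^ (1 + 2 * α) * ℓ k ^ 2) / m))) := by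
  have hℓpos : ∀ᶠ m : ℕ in atTop, 0 < ℓ m ∧ (0 : ℝ) < m := by
    filter_upwards [tendsto_natCast_atTop_atTop.eventually hℓ.eventually_pos,
      eventually_gt_atTop 0] with m hm hm0
    exact ⟨hm, by exact_mod_cast hm0⟩
  refine ⟨integrable_numUnitCircleZeros b hξ, ?_, ?_, ?_⟩
  · rintro rfl
    have hV : ∀ m : ℕ, ∑ k ∈ Finset.Icc 1 m, ℓ k ^ 2 / (k : ℝ) = powSum ℓ (2 * (-1 / 2)) m := by
      intro m
      refine Finset.sum_congr rfl fun k _ => ?_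
      rw [show (2 * (-1 / 2) : ℝ) = -1 by norm_num, Real.rpow_neg_one, div_eq_inv_mul]
    obtain ⟨c, hc, hcm⟩ := exists_pos_le_powSum hℓ (2 * (-1 / 2))
    have hlim := tendsto_halfGap_div hℓ (α := -1 / 2) (by norm_num)
    have h0 := hℓ.sq.tendsto_div_sum_inv fun x => sq_nonneg (ℓ x)
    have h := tendsto_one_sub_integral_div hσ hℓ hb hξ hind
      (G := fun m => 3 / 4 * (ℓ m ^ 2 / powSum ℓ (2 * (-1 / 2)) m)) ?_ ?_ ?_
    · refine h.congr fun m => ?_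
      simp only [hV]
      congr 1
      ring
    · filter_upwards [hℓpos, hcm] with m hm hcm
      have := hm.1
      have := hc.trans_le hcm
      positivity
    · have := h0.const_mul (3 / 4)
      rw [mul_zero] at this
      refine this.congr fun m => ?_
      rw [← hV, show Finset.Icc 1 m = Finset.Ioc 0 m by ext; simp [Nat.succ_le_iff]]
    · have := hlim.div_const (3 / 4)
      norm_num at this
      refine this.congr' ?_
      filter_upwards [hℓpos, hcm] with m hm hcm
      have h1 := hm.1
      have h2 := hc.trans_le hcm
      norm_num at h2 ⊢
      field_simp
  · intro h1 h2
    have hC : 0 < (2 + α) / (2 * (1 + α) * (3 + 2 * α)) := by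
      have e1 : 0 < 1 + α := by linarith
      have e2 : 0 < 3 + 2 * α := by linarith
      have e3 : 0 < 2 + α := by linarith
      positivity
    refine ⟨summable_sTerm hℓ (by linarith), ?_⟩
    have h := tendsto_one_sub_integral_div_of_summable hσ hℓ hb (by linarith) hξ hind
      (H := fun m => (2 + α) / (2 * (1 + α) * (3 + 2 * α)) * ((m : ℝ) ^ (1 + 2 * α) * ℓ m ^ 2))
      ?_ ?_ ?_
    · refine h.congr fun m => ?_
      congr 1
      rw [← mul_assoc, div_mul_div_comm]
      ring
    · filter_upwards [hℓpos] with m hm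
      have := hm.1
      have := Real.rpow_pos_of_pos hm.2 (1 + 2 * α)
      positivity
    · simpa using (hℓ.sq.tendsto_rpow_mul (γ := 1 + 2 * α) (by linarith)).const_mul
        ((2 + α) / (2 * (1 + α) * (3 + 2 * α)))
    · have := (tendsto_halfGap_div hℓ h1).div_const ((2 + α) / (2 * (1 + α) * (3 + 2 * α)))
      rw [div_self hC.ne'] at this
      refine this.congr fun m => ?_
      rw [div_div, mul_comm (_ * _)]
  · intro h1
    refine ⟨summable_sTerm hℓ (by linarith), ?_⟩
    obtain ⟨c, hc, hcm⟩ := exists_pos_le_powSum hℓ (2 * α + 1)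
    have h := tendsto_one_sub_integral_div_of_summable hσ hℓ hb (by linarith) hξ hind
      (H := fun m => powSum ℓ (2 * α + 1) m / m) ?_
      (tendsto_powSum_div_natCast hℓ (by linarith)) (tendsto_halfGap_div_powSum hℓ h1)
    · refine h.congr fun m => ?_
      rw [powSum, add_comm (2 * α) 1]
    · filter_upwards [hℓpos, hcm] with m hm hcm
      exact div_pos (hc.trans_le hcm) hm.2
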